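/- Graphs are finite and non-empty, and may have parallel edges but no loops. For a graph $G$ and $X\subseteq V(G)$ let $\partial_G(X)$ be the set of edges with precisely one end in $X$. An $r$-graph is an $r$-regular graph $G$ with $|\partial_G(X)|\ge r$ for every $X\subseteq V(G)$ of odd cardinality. A graph is class 1 if its edge-chromatic number equals its maximum degree, and class 2 otherwise. Let $\pi(G)$ be the largest integer $t$ such that $G$ has $t$ pairwise disjoint perfect matchings (perfect matchings being regarded as sets of edges). Let $\mathcal T_r$ be the set of $r$-graphs of class 2 with the smallest number of vertices among all $r$-graphs of class 2, and let $\mathcal T(r,k)$ be the set of $r$-graphs $G$ with $\pi(G)=k$ that have the smallest number of vertices among all $r$-graphs with $\pi=k$. Let $P$ be the Petersen graph, and for a finite multiset $\mathcal M$ of perfect matchings of $P$ let $P^{\mathcal M}$ be the graph obtained from $P$ by adding, for each member $M$ of $\mathcal M$ (counted with multiplicity), a parallel copy of every edge of $M$. Theorem. For all $r\ge 3$, $$\mathcal T_r=\mathcal T(r,r-2)=\{P^{\mathcal M} : \mathcal M \text{ is a multiset of } r-3 \text{ perfect matchings of } P\},$$ where the last set is understood up to isomorphism (a graph belongs to it if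 and only if it is isomorphic to some $P^{\mathcal M}$). In particular, every $G\in\mathcal T_r$ has exactly 10 vertices and satisfies $\pi(G)=r-2$. -/

import Mathlib

universe u v

open scoped Graph

namespace RGraphs

section Basic

variable {α : Type u} {β : Type v}

/-- The set of edges with precisely one end in `X`. -/
def edgeBoundary (G : Graph α β) (X : Set α) : Set β :=
  {e | ∃ x ∈ X, ∃ y ∉ X, G.IsLink e x y}

/-- The degree of `x`, i.e. the number of edges incident with `x`
(only used for loopless graphs). -/
noncomputable def degree (G : Graph α β) (x : α) : ℕ :=
  (G.incidenceSet x).ncard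

/-- The maximum degree of a finite graph. -/
noncomputable def maxDegree (G : Graph α β) : ℕ :=
  sSup (degree G '' V(G))

/-- An `r`-graph: a finite non-empty `r`-regular graph, possibly with parallel edges but without
loops, such that `|∂(X)| ≥ r` for every set `X` of vertices of odd cardinality. -/
structure IsRGraph (r : ℕ) (G : Graph α β) : Prop where
  finite_vertexSet : V(G).Finite
  finite_edgeSet : E(G).Finite
  nonempty : V(G).Nonempty
  loopless : G.Loopless
  regular : ∀ x ∈ V(G), degree G x = r
  le_boundary : ∀ X ⊆ V(G), Odd X.ncard → r ≤ (edgeBoundary G X).ncard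

/-- Two different edges are adjacent if they share an end. -/
def AdjacentEdges (G : Graph α β) (e f : β) : Prop :=
  e ≠ f ∧ ∃ x, G.Inc e x ∧ G.Inc f x

/-- `G` has a proper edge-coloring with `k` colors available. -/
def EdgeColorable (G : Graph α β) (k : ℕ) : Prop :=
  ∃ c : E(G) → Fin k, ∀ e f : E(G), AdjacentEdges G e f → c e ≠ c f

/-- The edge-chromatic number `χ'(G)` of a finite graph. -/
noncomputable def edgeChromaticNumber (G : Graph α β) : ℕ :=
  sInf {k | EdgeColorable G k}

/-- `G` is class 1 if its edge-chromatic number equals its maximum degree. -/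
def IsClassOne (G : Graph α β) : Prop :=
  edgeChromaticNumber G = maxDegree G

/-- `G` is class 2 if it is not class 1. -/
def IsClassTwo (G : Graph α β) : Prop :=
  ¬ IsClassOne G

/-- A matching: a set of pairwise non-adjacent edges. -/
def IsMatching (G : Graph α β) (M : Set β) : Prop :=
  M ⊆ E(G) ∧ ∀ e ∈ M, ∀ f ∈ M, ¬ AdjacentEdges G e f

/-- A perfect matching: a matching such that every vertex is incident with one of its edges. -/
def IsPerfectMatching (G : Graph α β) (M : Set β) : Prop :=
  IsMatching G M ∧ ∀ x ∈ V(G), ∃ e ∈ M, G.Inc e x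

/-- `G` has `t` pairwise disjoint perfect matchings. -/
def HasDisjointPerfectMatchings (G : Graph α β) (t : ℕ) : Prop :=
  ∃ M : Fin t → Set β, (∀ i, IsPerfectMatching G (M i)) ∧
    ∀ i j, i ≠ j → Disjoint (M i) (M j)

/-- `π(G) = k`: the largest number of pairwise disjoint perfect matchings of `G` is `k`. -/
def MaxDisjointPerfectMatchings (G : Graph α β) (k : ℕ) : Prop :=
  IsGreatest {t | HasDisjointPerfectMatchings G t} k

/-- `𝒢(r, k)`: the `r`-graphs `G` with `π(G) = k`. -/
def rGraphsWithPi (r k : ℕ) (G : Graph α β) : Prop :=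
  IsRGraph r G ∧ MaxDisjointPerfectMatchings G k

/-- `𝒯(r, k)`: the elements of `𝒢(r, k)` of smallest order. -/
def smallestWithPi (r k : ℕ) : Set (Graph α β) :=
  {G | rGraphsWithPi r k G ∧
    ∀ (α' : Type u) (β' : Type v) (H : Graph α' β'), rGraphsWithPi r k H →
      V(G).ncard ≤ V(H).ncard}

/-- `𝒯_r`: the `r`-graphs of class 2 of smallest order. -/
def smallestClassTwo (r : ℕ) : Set (Graph α β) :=
  {G | (IsRGraph r G ∧ IsClassTwo G) ∧
    ∀ (α' : Type u) (β' : Type v) (H : Graph α' β'), IsRGraph r H ∧ IsClassTwo H →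
      V(G).ncard ≤ V(H).ncard}

/-- Isomorphism of graphs: a bijection of the vertices and a bijection of the edges that
preserve and reflect incidence. -/
def Isomorphic {α β α' β' : Type*} (G : Graph α β) (H : Graph α' β') : Prop :=
  ∃ (θ : V(G) ≃ V(H)) (φ : E(G) ≃ E(H)), ∀ (e : E(G)) (x y : V(G)),
    G.IsLink e x y ↔ H.IsLink (φ e) (θ x) (θ y)

open Classical in
/-- `G + ∑_{M ∈ 𝓜} M`: the graph obtained from `G` by adding, for every member `M` of the
multiset `𝓜` (counted with multiplicity), a parallel copy of every edge in `M`.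
The pair `(e, 0)` is the original edge `e` of `G`, and `(e, 1), …, (e, m)` are its added copies,
where `m` is the number of members of `𝓜` that contain `e`. -/
noncomputable def addCopies (G : Graph α β) (𝓜 : Multiset (Set β)) : Graph α (β × ℕ) where
  vertexSet := V(G)
  IsLink p x y := G.IsLink p.1 x y ∧ p.2 ≤ 𝓜.countP (fun M => p.1 ∈ M)
  isLink_symm := fun _ _ => ⟨fun _ _ h => ⟨h.1.symm, h.2⟩⟩
  eq_or_eq_of_isLink_of_isLink := fun _ _ _ _ _ h h' => h.1.left_eq_or_eq h'.1
  left_mem_of_isLink := fun _ _ _ h => h.1.left_mem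

end Basic

/-- The vertices of the Petersen graph: the 2-element subsets of a 5-element set. -/
abbrev PetersenVertex : Type := {s : Finset (Fin 5) // s.card = 2}

/-- The Petersen graph as a simple graph: two 2-subsets are adjacent iff they are disjoint. -/
def petersenSimple : SimpleGraph PetersenVertex where
  Adj s t := Disjoint s.1 t.1
  symm := ⟨fun _ _ h => h.symm⟩
  loopless := ⟨fun s h => by
    have h0 : s.1 = ∅ := by simpa using h
    have h2 := s.2
    simp [h0] at h2⟩

/-- The Petersen graph `P`. -/
def petersen : Graph PetersenVertex (Sym2 PetersenVertex) :=
  Graph.ofSimpleGraph petersenSimple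

end RGraphs

/-! A graph is encoded by its symmetric matrix `w` of edge multiplicities. For `r > 0`, an `r`-graph
is class 1 exactly when `w` is a sum of `r` perfect matchings of the complete graph on its vertices
(`Decomposes`). The proof is an induction on `r` that splits off one perfect matching at a time;
such matchings exist by Tutte's theorem (`IsRWeight.exists_pairing`).

Consider odd cuts with at least three vertices on both sides. If one of them is tight, that is, has
weight `r`, contracting either side gives a smaller `r`-graph, and decompositions of the two
contractions can be glued along the cut (`IsRegularWeight.decomposes_of_contract`). Otherwise parity
makes all of them weigh at least `r + 2`, and removing a perfect matching that uses at most three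
edges of each is harmless. With at most eight vertices one side has at most three vertices, so every
such `r`-graph is class 1 (`IsRWeight.decomposes_of_card_le`).

With ten vertices, a perfect matching is obstructed only by a cut of weight `r + 2` into five and
five vertices that all its edges cross. For `r ≥ 4` some perfect matching is unobstructed
(`IsRWeight.exists_good_pairing`): otherwise three such cuts can be found that cross pairwise, and
uncrossing them gives a contradiction. For `r = 3` an obstruction forces two five-cycles joined by a
perfect matching, and among these only the Petersen graph `P` fails to decompose.

In the induction step a perfect matching `m` is put back onto `P` plus perfect matchings of `P`. If
`m` lies in `P`, the form is preserved. If not, exactly three edges of `m` join two complementary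
five-cycles of `P`; these cycles together with `m` form a `3`-graph with a tight cut, hence three
perfect matchings, and the spokes between the cycles are a fourth. This gives
`IsRWeight.decomposes_or_isPetersenSum`.

Conversely, three edges of `P` meet every perfect matching of `P` in an even number of edges, so `P`
plus perfect matchings of `P` never decomposes. Such a graph has `r - 2` disjoint perfect matchings,
and it cannot have `r - 1`, since the remainder would be one more. -/

namespace RGraphs

/-! ### Multigraphs as weight matrices, cuts and removal of perfect matchings -/

section Weights

variable {V : Type*} [Fintype V] [DecidableEq V]

/-- The total weight of the pairs with precisely one end in `X`. -/
def cutWeight (w : V → V → ℕ) (X : Finset V) : ℕ := ∑ x ∈ X, ∑ y ∈ Xᶜ, w x y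

/-- The adjacency matrix of an `r`-regular loopless multigraph. -/
structure IsRegularWeight (r : ℕ) (w : V → V → ℕ) : Prop where
  symm : ∀ x y, w x y = w y x
  diag : ∀ x, w x x = 0
  deg : ∀ x, ∑ y, w x y = r

/-- The adjacency matrix of an `r`-graph. -/
structure IsRWeight (r : ℕ) (w : V → V → ℕ) : Prop extends IsRegularWeight r w where
  le_cut : ∀ X : Finset V, Odd X.card → r ≤ cutWeight w X

/-- A perfect matching of the complete graph on `V`, given by the map that sends every vertex to
its partner. -/
structure IsPairing (m : V → V) : Prop where
  invol : ∀ x, m (m x) = x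
  ne : ∀ x, m x ≠ x

/-- The adjacency matrix of a perfect matching. -/
def pairingWeight (m : V → V) (x y : V) : ℕ := if m x = y then 1 else 0

/-- `w` is the sum of `r` perfect matchings. -/
def Decomposes (r : ℕ) (w : V → V → ℕ) : Prop :=
  ∃ m : Fin r → V → V, (∀ i, IsPairing (m i)) ∧ ∀ x y, w x y = ∑ i, pairingWeight (m i) x y

omit [Fintype V] in
theorem IsPairing.pairingWeight_symm {m : V → V} (hm : IsPairing m) (x y : V) :
    pairingWeight m x y = pairingWeight m y x := by
  unfold pairingWeight
  have : m x = y ↔ m y = x :=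
    ⟨fun h => by rw [← h, hm.invol], fun h => by rw [← h, hm.invol]⟩
  simp [this]

theorem IsPairing.isRegularWeight {m : V → V} (hm : IsPairing m) :
    IsRegularWeight 1 (pairingWeight m) where
  symm := hm.pairingWeight_symm
  diag x := by simp [pairingWeight, hm.ne]
  deg x := by simp [pairingWeight]

theorem IsRegularWeight.inner_add_cut {r : ℕ} {w : V → V → ℕ} (h : IsRegularWeight r w)
    (X : Finset V) : ∑ x ∈ X, ∑ y ∈ X, w x y + cutWeight w X = r * X.card := by
  unfold cutWeight
  rw [← Finset.sum_add_distrib]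
  simp_rw [Finset.sum_add_sum_compl, h.deg]
  simp [mul_comm]

theorem IsRegularWeight.cut_compl {r : ℕ} {w : V → V → ℕ} (h : IsRegularWeight r w)
    (X : Finset V) : cutWeight w Xᶜ = cutWeight w X := by
  unfold cutWeight
  rw [Finset.sum_comm, compl_compl]
  exact Finset.sum_congr rfl fun x _ => Finset.sum_congr rfl fun y _ => h.symm y x

theorem IsRegularWeight.even_inner {r : ℕ} {w : V → V → ℕ} (h : IsRegularWeight r w)
    (X : Finset V) : Even (∑ x ∈ X, ∑ y ∈ X, w x y) := by
  induction X using Finset.induction_on with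
  | empty => simp
  | insert a X ha ih =>
    have e : ∑ x ∈ insert a X, ∑ y ∈ insert a X, w x y =
        ∑ x ∈ X, ∑ y ∈ X, w x y + 2 * ∑ y ∈ X, w a y := by
      simp only [Finset.sum_insert ha, h.diag, Finset.sum_add_distrib, h.symm _ a]
      ring
    rw [e]
    exact ih.add (even_two_mul _)

theorem IsRegularWeight.even_cut_iff {r : ℕ} {w : V → V → ℕ} (h : IsRegularWeight r w)
    (X : Finset V) : Even (cutWeight w X) ↔ Even (r * X.card) := by
  rw [← h.inner_add_cut X, Nat.even_add]
  simp [h.even_inner X]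

theorem IsRegularWeight.cut_singleton {r : ℕ} {w : V → V → ℕ} (h : IsRegularWeight r w)
    (x : V) : cutWeight w {x} = r := by
  have := h.inner_add_cut {x}
  simpa [h.diag] using this

theorem IsRegularWeight.cut_of_card_eq_one {r : ℕ} {w : V → V → ℕ} (h : IsRegularWeight r w)
    {X : Finset V} (hX : X.card = 1) : cutWeight w X = r := by
  obtain ⟨x, rfl⟩ := Finset.card_eq_one.1 hX
  exact h.cut_singleton x

theorem IsRegularWeight.cut_of_card_compl_eq_one {r : ℕ} {w : V → V → ℕ}
    (h : IsRegularWeight r w) {X : Finset V} (hX : Xᶜ.card = 1) : cutWeight w X = r := by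
  rw [← h.cut_compl, h.cut_of_card_eq_one hX]

theorem IsRWeight.even_card {r : ℕ} {w : V → V → ℕ} (h : IsRWeight r w)
    (hr : 0 < r) : Even (Fintype.card V) := by
  by_contra hc
  have := h.le_cut Finset.univ (by simpa using hc)
  simp [cutWeight] at this
  omega

theorem IsPairing.cutWeight_eq (m : V → V) (X : Finset V) :
    cutWeight (pairingWeight m) X = (X.filter fun x => m x ∉ X).card := by
  simp [cutWeight, pairingWeight, Finset.card_filter]

theorem IsPairing.cutWeight_le_card (m : V → V) (X : Finset V) :
    cutWeight (pairingWeight m) X ≤ X.card := by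
  rw [IsPairing.cutWeight_eq]
  exact Finset.card_filter_le _ _

theorem IsPairing.cutWeight_le_card_compl {m : V → V} (hm : IsPairing m) (X : Finset V) :
    cutWeight (pairingWeight m) X ≤ Xᶜ.card := by
  rw [← hm.isRegularWeight.cut_compl]
  exact IsPairing.cutWeight_le_card _ _

theorem IsPairing.odd_cutWeight {m : V → V} (hm : IsPairing m) {X : Finset V}
    (hX : Odd X.card) : Odd (cutWeight (pairingWeight m) X) := by
  rw [← Nat.not_even_iff_odd, hm.isRegularWeight.even_cut_iff, one_mul, Nat.not_even_iff_odd]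
  exact hX

theorem cutWeight_add (w w' : V → V → ℕ) (X : Finset V) :
    cutWeight (fun x y => w x y + w' x y) X = cutWeight w X + cutWeight w' X := by
  simp [cutWeight, Finset.sum_add_distrib]

/-- Splitting off a perfect matching. -/
theorem IsRegularWeight.exists_sub {r : ℕ} {w : V → V → ℕ} (h : IsRegularWeight (r + 1) w)
    {m : V → V} (hm : IsPairing m) (hs : ∀ x, 1 ≤ w x (m x)) :
    ∃ w', IsRegularWeight r w' ∧ (∀ x y, w x y = w' x y + pairingWeight m x y) ∧
      ∀ X, cutWeight w X = cutWeight w' X + cutWeight (pairingWeight m) X := by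
  have key : ∀ x y, w x y = w x y - pairingWeight m x y + pairingWeight m x y := by
    intro x y
    unfold pairingWeight
    split_ifs with hxy
    · subst hxy
      have := hs x
      omega
    · simp
  refine ⟨fun x y => w x y - pairingWeight m x y, ⟨fun x y => ?_, fun x => ?_, fun x => ?_⟩,
    key, fun X => ?_⟩
  · simp only [h.symm x y, hm.pairingWeight_symm x y]
  · simp [h.diag]
  · have := h.deg x
    rw [Finset.sum_congr rfl fun y _ => key x y, Finset.sum_add_distrib,
      hm.isRegularWeight.deg] at this
    omega
  · rw [← cutWeight_add]
    congr 1
    funext x y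
    exact key x y

omit [Fintype V] in
theorem Decomposes.add_pairing {r : ℕ} {w w' : V → V → ℕ} (h : Decomposes r w')
    {m : V → V} (hm : IsPairing m) (hw : ∀ x y, w x y = w' x y + pairingWeight m x y) :
    Decomposes (r + 1) w := by
  obtain ⟨n, hn, hs⟩ := h
  refine ⟨Fin.cons m n, fun i => ?_, fun x y => ?_⟩
  · refine Fin.cases ?_ (fun i => ?_) i
    · simpa using hm
    · simpa using hn i
  · rw [hw, hs, Fin.sum_univ_succ]
    simp [add_comm]

theorem IsRegularWeight.decomposes_zero {w : V → V → ℕ} (h : IsRegularWeight 0 w) :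
    Decomposes 0 w := by
  refine ⟨Fin.elim0, fun i => i.elim0, fun x y => ?_⟩
  have := h.deg x
  simp only [Finset.sum_eq_zero_iff, Finset.mem_univ, true_implies] at this
  simp [this]

/-- All odd cuts separating at least three vertices from at least three others are not tight. -/
def NoTightCut (r : ℕ) (w : V → V → ℕ) : Prop :=
  ∀ X : Finset V, Odd X.card → 3 ≤ X.card → 3 ≤ Xᶜ.card → r + 2 ≤ cutWeight w X

/-- An odd cut has the same parity as `r`, so weight `r + 1` is impossible. -/
theorem IsRWeight.noTightCut {r : ℕ} {w : V → V → ℕ} (h : IsRWeight r w)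
    (ht : ∀ X : Finset V, Odd X.card → 3 ≤ X.card → 3 ≤ Xᶜ.card → cutWeight w X ≠ r) :
    NoTightCut r w := by
  intro X hX h3 h3'
  have h1 := h.le_cut X hX
  have h2 := ht X hX h3 h3'
  have h4 := h.even_cut_iff X
  rw [Nat.even_mul] at h4
  have : ¬ Even X.card := Nat.not_even_iff_odd.2 hX
  simp only [this, or_false] at h4
  by_contra hc
  have h5 : cutWeight w X = r + 1 := by omega
  rw [h5, Nat.even_add_one] at h4
  tauto

/-- If no odd cut becomes too small, splitting off a perfect matching yields an `(r-1)`-graph. -/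
theorem IsRWeight.exists_sub {r : ℕ} {w : V → V → ℕ} (h : IsRWeight (r + 1) w)
    {m : V → V} (hm : IsPairing m) (hs : ∀ x, 1 ≤ w x (m x))
    (hc : ∀ X : Finset V, Odd X.card → 3 ≤ X.card → 3 ≤ Xᶜ.card →
      r + cutWeight (pairingWeight m) X ≤ cutWeight w X) :
    ∃ w', IsRWeight r w' ∧ ∀ x y, w x y = w' x y + pairingWeight m x y := by
  obtain ⟨w', h1, h2, h3⟩ := h.toIsRegularWeight.exists_sub hm hs
  refine ⟨w', ⟨h1, fun X hX => ?_⟩, h2⟩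
  -- Cuts with a one-vertex side have the degree as weight. As the number of vertices is even, every
  -- other odd cut has at least three vertices on both sides, where `hc` applies.
  by_cases hX1 : X.card = 1
  · rw [h1.cut_of_card_eq_one hX1]
  by_cases hX2 : Xᶜ.card = 1
  · rw [h1.cut_of_card_compl_eq_one hX2]
  have he := h.even_card (Nat.succ_pos r)
  have hadd := Finset.card_add_card_compl X
  obtain ⟨a, ha⟩ := hX
  obtain ⟨b, hb⟩ := he
  have := hc X ⟨a, ha⟩ (by omega) (by omega)
  have := h3 X
  omega

omit [DecidableEq V] in
theorem IsRegularWeight.exists_pos {r : ℕ} {w : V → V → ℕ} (h : IsRegularWeight r w) (hr : 0 < r) (x : V) :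
    ∃ y, 1 ≤ w x y := by
  by_contra hc
  push Not at hc
  have := h.deg x
  rw [Finset.sum_eq_zero (fun y _ => by have := hc y; omega)] at this
  omega

end Weights

/-! ### Perfect matchings through a given edge -/

section Tutte

variable {V : Type*} [Fintype V] [DecidableEq V]

/-- The function `c` names the components after deleting `T`, and `Q` lists odd ones. All edges
leaving such a component end in `T`, and there are at least `r` of them. -/
theorem IsRWeight.mul_card_le {r : ℕ} {w : V → V → ℕ} (h : IsRWeight r w) (T : Finset V)
    {C : Type*} [DecidableEq C] (c : V → C) (Q : Finset C)
    (hodd : ∀ q ∈ Q, Odd (Tᶜ.filter fun x => c x = q).card)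
    (hsep : ∀ x ∉ T, ∀ y ∉ T, c x ≠ c y → w x y = 0) :
    r * Q.card ≤ ∑ x ∈ Tᶜ, ∑ y ∈ T, w x y := by
  have h1 : ∀ q ∈ Q, r ≤ ∑ x ∈ Tᶜ.filter (fun x => c x = q), ∑ y ∈ T, w x y := by
    intro q hq
    refine (h.le_cut _ (hodd q hq)).trans (Finset.sum_le_sum fun x hx => ?_)
    simp only [Finset.mem_filter, Finset.mem_compl] at hx
    rw [← Finset.sum_subset (s₁ := T ∩ (Tᶜ.filter (fun x => c x = q))ᶜ)
      Finset.inter_subset_right]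
    · exact Finset.sum_le_sum_of_subset Finset.inter_subset_left
    · intro y hy hy'
      simp only [Finset.mem_inter, Finset.mem_compl, Finset.mem_filter, not_and] at hy hy'
      have hyT : y ∉ T := fun hyT => hy' hyT hy
      exact hsep x hx.1 y hyT fun hxy => hy hyT (hxy ▸ hx.2)
  calc r * Q.card = ∑ _q ∈ Q, r := by simp [mul_comm]
    _ ≤ ∑ q ∈ Q, ∑ x ∈ Tᶜ.filter (fun x => c x = q), ∑ y ∈ T, w x y := Finset.sum_le_sum h1
    _ = ∑ x ∈ Q.biUnion (fun q => Tᶜ.filter (fun x => c x = q)), ∑ y ∈ T, w x y := by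
      rw [Finset.sum_biUnion]
      intro a _ b _ hab
      rw [Function.onFun, Finset.disjoint_left]
      intro x hx hx'
      simp only [Finset.mem_filter] at hx hx'
      exact hab (hx.2.symm.trans hx'.2)
    _ ≤ _ := Finset.sum_le_sum_of_subset fun x hx => by
      simp only [Finset.mem_biUnion, Finset.mem_filter] at hx
      obtain ⟨q, _, hx, _⟩ := hx
      exact hx

/-- The degrees in `T` sum to `r * T.card`, and the edges between `u` and `v` consume two units each
without leaving `T`. This small loss makes the count in Tutte's condition strict. -/
theorem IsRegularWeight.sum_compl_le {r : ℕ} {w : V → V → ℕ} (h : IsRegularWeight r w)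
    {T : Finset V} {u v : V} (hu : u ∈ T) (hv : v ∈ T) (huv : u ≠ v) :
    ∑ x ∈ Tᶜ, ∑ y ∈ T, w x y + 2 * w u v ≤ r * T.card := by
  have h1 := h.inner_add_cut T
  have h2 : cutWeight w T = ∑ x ∈ Tᶜ, ∑ y ∈ T, w x y := by
    rw [← h.cut_compl, cutWeight, compl_compl]
  have h3 : 2 * w u v ≤ ∑ x ∈ T, ∑ y ∈ T, w x y := by
    calc 2 * w u v = ∑ x ∈ {u, v}, ∑ y ∈ {u, v}, w x y := by
          rw [Finset.sum_pair huv, Finset.sum_pair huv, Finset.sum_pair huv]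
          simp [h.diag, h.symm v u]
          ring
      _ ≤ _ := by
          have hs : ({u, v} : Finset V) ⊆ T := by
            intro x hx
            simp only [Finset.mem_insert, Finset.mem_singleton] at hx
            rcases hx with rfl | rfl <;> assumption
          exact (Finset.sum_le_sum_of_subset hs).trans
            (Finset.sum_le_sum fun x _ => Finset.sum_le_sum_of_subset hs)
  omega

/-- Every edge of an `r`-graph is contained in a perfect matching. -/
theorem IsRWeight.exists_pairing {r : ℕ} {w : V → V → ℕ} (h : IsRWeight r w) {u v : V}
    (huv : 1 ≤ w u v) : ∃ m, IsPairing m ∧ (∀ x, 1 ≤ w x (m x)) ∧ m u = v := by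
  classical
  have hne : u ≠ v := by
    rintro rfl
    simp [h.diag] at huv
  have hr : 0 < r := by
    rw [← h.deg u]
    exact huv.trans (Finset.single_le_sum (f := fun y => w u y) (fun _ _ => Nat.zero_le _)
      (Finset.mem_univ v))
  let U := {x : V // x ≠ u ∧ x ≠ v}
  have hcU : Fintype.card U + 2 = Fintype.card V := by
    have h1 : Fintype.card U = (({u, v} : Finset V)ᶜ).card := by
      rw [Fintype.card_subtype]
      congr 1
      ext x
      simp
    have h2 := Finset.card_add_card_compl ({u, v} : Finset V)
    rw [Finset.card_pair hne] at h2
    omega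
  let G : SimpleGraph U :=
    { Adj := fun a b => 1 ≤ w a.1 b.1
      symm := ⟨fun a b hab => by rw [h.symm]; exact hab⟩
      loopless := ⟨fun a ha => by simp [h.diag] at ha⟩ }
  -- Tutte's theorem is applied to the graph without `u` and `v`; a perfect matching of it extends
  -- by the edge `uv`.
  have key : ∃ M : G.Subgraph, M.IsPerfectMatching := by
    rw [SimpleGraph.tutte]
    intro S hS
    unfold SimpleGraph.IsTutteViolator at hS
    set D := (⊤ : G.Subgraph).deleteVerts S with hD
    set H := D.coe with hH
    have hmem : ∀ z : U, z ∈ D.verts ↔ z ∉ S := fun z => by simp [hD]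
    let T : Finset V := Finset.univ.filter fun x => x = u ∨ x = v ∨ ∃ hx, (⟨x, hx⟩ : U) ∈ S
    have hT : ∀ x, x ∉ T → ∃ hx : x ≠ u ∧ x ≠ v, (⟨x, hx⟩ : U) ∈ D.verts := by
      intro x hx
      simp only [T, Finset.mem_filter, Finset.mem_univ, true_and, not_or, not_exists] at hx
      exact ⟨⟨hx.1, hx.2.1⟩, (hmem _).2 (hx.2.2 _)⟩
    have hT' : ∀ z : U, z ∈ D.verts → z.1 ∉ T := by
      intro z hz
      simp only [T, Finset.mem_filter, Finset.mem_univ, true_and, not_or, not_exists]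
      exact ⟨z.2.1, z.2.2, fun _ => (hmem _).1 hz⟩
    have hTcard : T.card = S.ncard + 2 := by
      have : (T : Set V) = insert u (insert v (Subtype.val '' S)) := by
        ext x
        simp [T]
      rw [← Set.ncard_coe_finset, this, Set.ncard_insert_of_notMem, Set.ncard_insert_of_notMem,
        Set.ncard_image_of_injective _ Subtype.val_injective]
      · simp
      · simp [hne]
    let c : V → Option H.ConnectedComponent := fun x =>
      if hx : x ∈ T then none
      else some (H.connectedComponentMk ⟨⟨x, (hT x hx).choose⟩, (hT x hx).choose_spec⟩)
    have hc : ∀ z : D.verts, c z.1.1 = some (H.connectedComponentMk z) := by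
      intro z
      simp only [c]
      rw [dif_neg (hT' z.1 z.2)]
    let Q : Finset (Option H.ConnectedComponent) :=
      (Set.toFinite H.oddComponents).toFinset.map Function.Embedding.some
    have hQ : Q.card = H.oddComponents.ncard := by
      rw [Finset.card_map, Set.ncard_eq_toFinset_card]
    have h1 := h.mul_card_le T c Q ?_ ?_
    · have h2 := h.toIsRegularWeight.sum_compl_le (T := T) (u := u) (v := v) (by simp [T])
        (by simp [T]) hne
      rw [hTcard] at h2
      rw [hQ] at h1
      -- For a violating set `S`, the set `T` is `S` with `u` and `v` added. The count leaves at
      -- most `|S| + 1` odd components, and a violation needs more than `|S|`; the value `|S| + 1`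
      -- has the wrong parity because the number of vertices is even.
      have h3 : r * H.oddComponents.ncard < r * (S.ncard + 2) := by omega
      have h4 := Nat.lt_of_mul_lt_mul_left h3
      have h5 := H.odd_ncard_oddComponents
      have h6 : Nat.card D.verts + S.ncard = Fintype.card U := by
        have : D.verts = Sᶜ := by
          ext z
          simp [hmem]
        rw [this, Nat.card_coe_set_eq, add_comm, Set.ncard_add_ncard_compl,
          Nat.card_eq_fintype_card]
      have h7 := h.even_card hr
      have h8 : H.oddComponents.ncard = S.ncard + 1 := by omega
      rw [h8] at h5
      obtain ⟨k, hk⟩ := h7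
      rcases Nat.even_or_odd S.ncard with ⟨j, hj⟩ | ⟨j, hj⟩
      · have : Odd (Nat.card D.verts) := h5.1 ⟨j, by omega⟩
        obtain ⟨i, hi⟩ := this
        omega
      · have : ¬ Odd (Nat.card D.verts) := fun hh => by
          obtain ⟨i, hi⟩ := h5.2 hh
          omega
        exact this ⟨(Nat.card D.verts) / 2, by omega⟩
    · intro q hq
      simp only [Q, Finset.mem_map, Set.Finite.mem_toFinset] at hq
      obtain ⟨d, hd, rfl⟩ := hq
      have hd' : Odd d.supp.ncard := hd
      convert hd' using 1
      rw [← Set.ncard_image_of_injective d.supp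
        (f := fun z : D.verts => z.1.1) (Subtype.val_injective.comp Subtype.val_injective),
        ← Set.ncard_coe_finset]
      congr 1
      ext x
      simp only [Finset.coe_filter, Finset.mem_compl, Set.mem_ofPred_eq, Set.mem_image]
      constructor
      · rintro ⟨hxT, hx⟩
        obtain ⟨hx1, hx2⟩ := hT x hxT
        refine ⟨⟨⟨x, hx1⟩, hx2⟩, ?_, rfl⟩
        have := hc ⟨⟨x, hx1⟩, hx2⟩
        rw [hx] at this
        rw [SimpleGraph.ConnectedComponent.mem_supp_iff]
        exact (Option.some_injective _ this).symm
      · rintro ⟨z, hz, rfl⟩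
        refine ⟨hT' _ z.2, ?_⟩
        rw [hc]
        rw [SimpleGraph.ConnectedComponent.mem_supp_iff] at hz
        rw [hz]
        rfl
    · intro x hx y hy hxy
      by_contra hw
      obtain ⟨hx1, hx2⟩ := hT x hx
      obtain ⟨hy1, hy2⟩ := hT y hy
      apply hxy
      have e1 := hc ⟨⟨x, hx1⟩, hx2⟩
      have e2 := hc ⟨⟨y, hy1⟩, hy2⟩
      simp only at e1 e2
      rw [e1, e2]
      congr 1
      apply SimpleGraph.ConnectedComponent.sound
      apply SimpleGraph.Adj.reachable
      rw [hH, SimpleGraph.Subgraph.coe_adj]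
      exact SimpleGraph.Subgraph.deleteVerts_adj.2 ⟨trivial, (hmem _).1 hx2, trivial, (hmem _).1 hy2, Nat.one_le_iff_ne_zero.2 hw⟩
  obtain ⟨M, hM⟩ := key
  rw [SimpleGraph.Subgraph.isPerfectMatching_iff] at hM
  choose p hp hpu using hM
  have hpp : ∀ z, p (p z) = z := fun z => (hpu (p z) z (hp z).symm).symm
  have hpne : ∀ z, p z ≠ z := fun z hz => by
    have := (hp z).adj_sub
    rw [hz] at this
    exact G.loopless.irrefl z this
  let m : V → V := fun x =>
    if hx : x ≠ u ∧ x ≠ v then (p ⟨x, hx⟩).1 else if x = u then v else u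
  have hmu : m u = v := by simp [m]
  have hmv : m v = u := by simp [m, hne.symm]
  have hmz : ∀ z : U, m z.1 = (p z).1 := fun z => by
    simp only [m]
    rw [dif_pos z.2]
  have hcases : ∀ x, x = u ∨ x = v ∨ ∃ z : U, z.1 = x := fun x => by
    by_cases h1 : x = u
    · exact Or.inl h1
    by_cases h2 : x = v
    · exact Or.inr (Or.inl h2)
    exact Or.inr (Or.inr ⟨⟨x, h1, h2⟩, rfl⟩)
  refine ⟨m, ⟨fun x => ?_, fun x => ?_⟩, fun x => ?_, hmu⟩
  · obtain rfl | rfl | ⟨z, rfl⟩ := hcases x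
    · rw [hmu, hmv]
    · rw [hmv, hmu]
    · rw [hmz, hmz, hpp]
  · obtain rfl | rfl | ⟨z, rfl⟩ := hcases x
    · rw [hmu]; exact hne.symm
    · rw [hmv]; exact hne
    · rw [hmz]
      exact fun hz => hpne z (Subtype.ext hz)
  · obtain rfl | rfl | ⟨z, rfl⟩ := hcases x
    · rw [hmu]; exact huv
    · rw [hmv, h.symm]; exact huv
    · rw [hmz]; exact (hp z).adj_sub

end Tutte

/-! ### Bijections and injections that respect fibres -/

section Fibers

variable {A B C : Type*} [Fintype A] [Fintype B] [DecidableEq C]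

theorem exists_equiv_of_card_fiber_eq (f : A → C) (g : B → C)
    (h : ∀ c, (Finset.univ.filter fun a => f a = c).card =
      (Finset.univ.filter fun b => g b = c).card) :
    ∃ e : A ≃ B, ∀ a, g (e a) = f a := by
  have h' : ∀ c, Fintype.card {a // f a = c} = Fintype.card {b // g b = c} := fun c => by
    rw [Fintype.card_subtype, Fintype.card_subtype, h]
  refine ⟨(Equiv.sigmaFiberEquiv f).symm.trans ((Equiv.sigmaCongrRight fun c =>
    Fintype.equivOfCardEq (h' c)).trans (Equiv.sigmaFiberEquiv g)), fun a => ?_⟩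
  exact (Fintype.equivOfCardEq (h' (f a)) ⟨a, rfl⟩).2

theorem exists_embedding_of_card_fiber_le (f : A → C) (g : B → C)
    (h : ∀ c, (Finset.univ.filter fun a => f a = c).card ≤
      (Finset.univ.filter fun b => g b = c).card) :
    ∃ e : A ↪ B, ∀ a, g (e a) = f a := by
  have h' : ∀ c, Nonempty ({a // f a = c} ↪ {b // g b = c}) := fun c => by
    apply Function.Embedding.nonempty_of_card_le
    rw [Fintype.card_subtype, Fintype.card_subtype]
    exact h c
  let F : ∀ c, {a // f a = c} ↪ {b // g b = c} := fun c => (h' c).some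
  refine ⟨(Equiv.sigmaFiberEquiv f).symm.toEmbedding.trans
    ((Function.Embedding.sigmaMap (Function.Embedding.refl C) F).trans
      (Equiv.sigmaFiberEquiv g).toEmbedding), fun a => ?_⟩
  exact (F (f a) ⟨a, rfl⟩).2

end Fibers

/-! ### Contracting the sides of a tight cut and gluing decompositions -/

section Contraction

variable {V : Type u} [Fintype V] [DecidableEq V]

/-- The adjacency matrix of the multigraph obtained by identifying all vertices outside `X`. -/
def contract (w : V → V → ℕ) (X : Finset V) : Option {x // x ∈ X} → Option {x // x ∈ X} → ℕ
  | none, none => 0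
  | none, some b => ∑ y ∈ Xᶜ, w y b
  | some a, none => ∑ y ∈ Xᶜ, w y a
  | some a, some b => w a b

theorem IsRegularWeight.contract {r : ℕ} {w : V → V → ℕ} (h : IsRegularWeight r w) {X : Finset V}
    (hX : cutWeight w X = r) : IsRegularWeight r (contract w X) where
  symm x y := by
    cases x <;> cases y <;> simp only [RGraphs.contract]
    exact h.symm _ _
  diag x := by
    cases x <;> simp only [RGraphs.contract]
    exact h.diag _
  deg x := by
    cases x with
    | none =>
      simp only [Fintype.sum_option, RGraphs.contract, zero_add]
      rw [← hX, cutWeight, Finset.univ_eq_attach, Finset.sum_attach X fun b => ∑ y ∈ Xᶜ, w y b]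
      simp_rw [h.symm]
    | some a =>
      simp only [Fintype.sum_option, RGraphs.contract]
      rw [Finset.univ_eq_attach, Finset.sum_attach X fun b => w a b, add_comm]
      simp_rw [h.symm _ (a : V)]
      rw [Finset.sum_add_sum_compl, h.deg]

/-- A set avoiding the contracted vertex `none` has the same cut weight as in the original graph. A
set containing `none` is replaced by its complement, which is again odd since the contraction has
`X.card + 1` vertices. -/
theorem IsRWeight.contract {r : ℕ} {w : V → V → ℕ} (h : IsRWeight r w) {X : Finset V}
    (hX : cutWeight w X = r) (hodd : Odd X.card) : IsRWeight r (contract w X) := by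
  have hreg := h.toIsRegularWeight.contract hX
  have key : ∀ Z : Finset (Option {x // x ∈ X}), Odd Z.card → none ∉ Z →
      r ≤ cutWeight (RGraphs.contract w X) Z := by
    intro Z hZ hn
    let f : {x // x ∈ X} ↪ V := Function.Embedding.subtype _
    have hZ' : Z = (Finset.eraseNone Z).map Function.Embedding.some := by
      rw [Finset.map_some_eraseNone, Finset.erase_eq_of_notMem hn]
    generalize Finset.eraseNone Z = Y at hZ'
    subst hZ'
    rw [Finset.card_map] at hZ
    have h1 := hreg.inner_add_cut (Y.map Function.Embedding.some)
    have h2 := h.toIsRegularWeight.inner_add_cut (Y.map f)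
    have h3 := h.le_cut (Y.map f) (by rwa [Finset.card_map])
    simp only [Finset.sum_map, Finset.card_map, Function.Embedding.some_apply,
      RGraphs.contract] at h1 h2
    simp only [f, Function.Embedding.subtype_apply] at h2 h3
    omega
  refine ⟨hreg, fun Z hZ => ?_⟩
  by_cases hn : none ∈ Z
  · rw [← hreg.cut_compl]
    refine key _ ?_ (by simpa using hn)
    have h1 := Finset.card_add_card_compl Z
    rw [Fintype.card_option, Fintype.card_coe] at h1
    obtain ⟨a, ha⟩ := hZ
    obtain ⟨b, hb⟩ := hodd
    exact ⟨b - a, by omega⟩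
  · exact key Z hZ hn

/-- In each contraction the contracted vertex has degree `r`, so each of the `r` matchings uses
exactly one cut edge and each cut edge is used once. Matchings of the two sides that use the same
cut edge are merged. -/
theorem IsRegularWeight.decomposes_of_contract {r : ℕ} {w : V → V → ℕ}
    (h : IsRegularWeight r w) {X : Finset V} (h1 : Decomposes r (RGraphs.contract w X))
    (h2 : Decomposes r (RGraphs.contract w Xᶜ)) : Decomposes r w := by
  obtain ⟨m, hm, hms⟩ := h1
  obtain ⟨n, hn, hns⟩ := h2
  have hf : ∀ i, ∃ b, m i none = some b := fun i => Option.ne_none_iff_exists'.1 ((hm i).ne none)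
  have hg : ∀ i, ∃ b, n i none = some b := fun i => Option.ne_none_iff_exists'.1 ((hn i).ne none)
  choose f hf using hf
  choose g hg using hg
  -- The cut edges, parallel ones being distinguished. Both families of matchings are put in
  -- bijection with them, by `α` through the ends in `X` and by `β` through the ends outside.
  let E := Σ p : {x // x ∈ X} × {x // x ∈ Xᶜ}, Fin (w p.1 p.2)
  obtain ⟨α, hα⟩ : ∃ α : Fin r ≃ E, ∀ i, (α i).1.1 = f i := by
    apply exists_equiv_of_card_fiber_eq f fun e : E => e.1.1
    intro b
    have e1 := hms none (some b)
    simp only [pairingWeight, hf, Option.some.injEq, RGraphs.contract] at e1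
    rw [Finset.card_filter, ← e1, Finset.card_filter, Fintype.sum_sigma, Fintype.sum_prod_type,
      Finset.sum_eq_single b]
    · simp only [if_true, Finset.sum_const, Finset.card_univ, Fintype.card_fin, smul_eq_mul,
        mul_one]
      rw [Finset.univ_eq_attach, Finset.sum_attach Xᶜ fun c => w b c]
      simp_rw [h.symm]
    · intro c _ hc
      simp [hc]
    · simp
  obtain ⟨β, hβ⟩ : ∃ β : Fin r ≃ E, ∀ i, (β i).1.2 = g i := by
    apply exists_equiv_of_card_fiber_eq g fun e : E => e.1.2
    intro b
    have e1 := hns none (some b)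
    simp only [pairingWeight, hg, Option.some.injEq, RGraphs.contract] at e1
    rw [Finset.card_filter, ← e1, Finset.card_filter, Fintype.sum_sigma,
      Fintype.sum_prod_type_right, Finset.sum_eq_single b]
    · simp only [if_true, Finset.sum_const, Finset.card_univ, Fintype.card_fin, smul_eq_mul,
        mul_one, compl_compl]
      rw [Finset.univ_eq_attach, Finset.sum_attach X fun c => w c b]
    · intro c _ hc
      simp [hc]
    · simp
  let σ : Fin r ≃ Fin r := α.trans β.symm
  have hσ : ∀ i, g (σ i) = (α i).1.2 := fun i => by rw [← hβ]; simp [σ]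
  -- When the partner is the contracted vertex, the default value supplies the real partner: the far
  -- end of the cut edge `α i`.
  let M : Fin r → V → V := fun i x =>
    if hx : x ∈ X then ((m i (some ⟨x, hx⟩)).map Subtype.val).getD (g (σ i))
    else ((n (σ i) (some ⟨x, Finset.mem_compl.2 hx⟩)).map Subtype.val).getD (f i)
  have hMX : ∀ i (x : {x // x ∈ X}),
      M i x = ((m i (some x)).map Subtype.val).getD (g (σ i)) := fun i x => by
    simp only [M]
    rw [dif_pos x.2]
  have hMY : ∀ i (x : {x // x ∈ Xᶜ}),
      M i x = ((n (σ i) (some x)).map Subtype.val).getD (f i) := fun i x => by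
    simp only [M]
    rw [dif_neg (Finset.mem_compl.1 x.2)]
  have hcases : ∀ x : V, (∃ a : {x // x ∈ X}, a.1 = x) ∨ ∃ a : {x // x ∈ Xᶜ}, a.1 = x := by
    intro x
    by_cases hx : x ∈ X
    · exact Or.inl ⟨⟨x, hx⟩, rfl⟩
    · exact Or.inr ⟨⟨x, Finset.mem_compl.2 hx⟩, rfl⟩
  have hfn : ∀ i a, m i (some a) = none ↔ f i = a := fun i a => by
    constructor
    · intro e
      have := (hm i).invol (some a)
      rw [e, hf] at this
      exact Option.some_injective _ this
    · rintro rfl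
      rw [← hf, (hm i).invol]
  have hgn : ∀ i a, n i (some a) = none ↔ g i = a := fun i a => by
    constructor
    · intro e
      have := (hn i).invol (some a)
      rw [e, hg] at this
      exact Option.some_injective _ this
    · rintro rfl
      rw [← hg, (hn i).invol]
  have hXY : ∀ (a : {x // x ∈ X}) (b : {x // x ∈ Xᶜ}), (a : V) ≠ b := fun a b hab =>
    Finset.mem_compl.1 b.2 (hab ▸ a.2)
  have hM : ∀ i, IsPairing (M i) := by
    refine fun i => ⟨fun x => ?_, fun x => ?_⟩
    · obtain ⟨a, rfl⟩ | ⟨a, rfl⟩ := hcases x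
      · rw [hMX]
        cases e : m i (some a) with
        | none =>
          simp only [Option.map_none, Option.getD_none]
          rw [hMY, (hgn _ _).2 rfl]
          simpa using (hfn _ _).1 e
        | some b =>
          simp only [Option.map_some, Option.getD_some]
          rw [hMX, ← e, (hm i).invol]
          simp
      · rw [hMY]
        cases e : n (σ i) (some a) with
        | none =>
          simp only [Option.map_none, Option.getD_none]
          rw [hMX, (hfn _ _).2 rfl]
          simpa using (hgn _ _).1 e
        | some b =>
          simp only [Option.map_some, Option.getD_some]
          rw [hMY, ← e, (hn (σ i)).invol]
          simp
    · obtain ⟨a, rfl⟩ | ⟨a, rfl⟩ := hcases x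
      · rw [hMX]
        cases e : m i (some a) with
        | none => simpa using (hXY a _).symm
        | some b =>
          simp only [Option.map_some, Option.getD_some]
          intro hb
          apply (hm i).ne (some a)
          rw [e, Subtype.ext hb]
      · rw [hMY]
        cases e : n (σ i) (some a) with
        | none => simpa using hXY _ a
        | some b =>
          simp only [Option.map_some, Option.getD_some]
          intro hb
          apply (hn (σ i)).ne (some a)
          rw [e, Subtype.ext hb]
  have hcross : ∀ (a : {x // x ∈ X}) (b : {x // x ∈ Xᶜ}),
      w a b = ∑ i, pairingWeight (M i) a b := by
    intro a b
    have e1 : ∀ i, pairingWeight (M i) (a : V) b = if (α i).1 = (a, b) then 1 else 0 := by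
      intro i
      unfold pairingWeight
      congr 1
      rw [hMX, Prod.ext_iff, hα, ← hσ, ← hfn]
      cases e : m i (some a) with
      | none =>
        simp only [Option.map_none, Option.getD_none, true_and]
        exact propext Subtype.ext_iff.symm
      | some c => simpa using hXY c b
    simp_rw [e1]
    rw [Equiv.sum_comp α fun e => if e.1 = (a, b) then 1 else 0, Fintype.sum_sigma,
      Finset.sum_eq_single (a, b)]
    · simp
    · intro c _ hc
      simp [hc]
    · simp
  refine ⟨M, hM, fun x y => ?_⟩
  obtain ⟨a, rfl⟩ | ⟨a, rfl⟩ := hcases x <;> obtain ⟨b, rfl⟩ | ⟨b, rfl⟩ := hcases y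
  · refine (hms (some a) (some b)).trans (Finset.sum_congr rfl fun i _ => ?_)
    unfold pairingWeight
    congr 1
    rw [hMX]
    cases e : m i (some a) with
    | none => simpa using (hXY b _).symm
    | some c =>
      simp only [Option.map_some, Option.getD_some, Option.some.injEq]
      exact propext Subtype.ext_iff
  · exact hcross a b
  · rw [h.symm, hcross]
    exact Finset.sum_congr rfl fun i _ => (hM i).pairingWeight_symm _ _
  · have := hns (some a) (some b)
    rw [← Equiv.sum_comp σ] at this
    refine this.trans (Finset.sum_congr rfl fun i _ => ?_)
    unfold pairingWeight
    congr 1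
    rw [hMY]
    cases e : n (σ i) (some a) with
    | none => simpa using hXY _ b
    | some c =>
      simp only [Option.map_some, Option.getD_some, Option.some.injEq]
      exact propext Subtype.ext_iff

end Contraction

/-- Every `r`-graph with at most eight vertices is class 1. -/
theorem IsRWeight.decomposes_of_card_le {V : Type u} [Fintype V] [DecidableEq V] {r : ℕ}
    {w : V → V → ℕ} (h : IsRWeight r w) (hV : Fintype.card V ≤ 8) : Decomposes r w := by
  induction hn : Fintype.card V using Nat.strong_induction_on generalizing V r with
  | _ n ih =>
  subst hn
  induction r generalizing w with
  | zero => exact h.toIsRegularWeight.decomposes_zero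
  | succ r ihr =>
    by_cases ht : ∃ X : Finset V, Odd X.card ∧ 3 ≤ X.card ∧ 3 ≤ Xᶜ.card ∧ cutWeight w X = r + 1
    · obtain ⟨X, h1, h2, h3, h4⟩ := ht
      have h5 := Finset.card_add_card_compl X
      have h6 : Odd Xᶜ.card := by
        obtain ⟨a, ha⟩ := h1
        obtain ⟨b, hb⟩ := h.even_card (Nat.succ_pos r)
        exact ⟨b - a - 1, by omega⟩
      have h7 : cutWeight w Xᶜ = r + 1 := by rw [h.toIsRegularWeight.cut_compl, h4]
      have c1 : Fintype.card (Option {x // x ∈ X}) = X.card + 1 := by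
        rw [Fintype.card_option, Fintype.card_coe]
      have c2 : Fintype.card (Option {x // x ∈ Xᶜ}) = Xᶜ.card + 1 := by
        rw [Fintype.card_option, Fintype.card_coe]
      exact h.toIsRegularWeight.decomposes_of_contract
        (ih _ (by omega) (h.contract h4 h1) (by omega) rfl)
        (ih _ (by omega) (h.contract h7 h6) (by omega) rfl)
    · have hnt := h.noTightCut fun X h1 h2 h3 h4 => ht ⟨X, h1, h2, h3, h4⟩
      rcases isEmpty_or_nonempty V with hE | ⟨⟨x⟩⟩
      · exact ⟨fun _ => id, fun i => ⟨fun x => hE.elim x, fun x => hE.elim x⟩,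
          fun x => hE.elim x⟩
      · obtain ⟨y, hy⟩ := h.toIsRegularWeight.exists_pos (Nat.succ_pos r) x
        obtain ⟨m, hm, hs, -⟩ := h.exists_pairing hy
        -- Here the degree is `r + 1`, so the cut weighs at least `r + 3`. One side has exactly
        -- three vertices, hence `m` uses at most three of its edges and `r` remain.
        obtain ⟨w', h1, h2⟩ := h.exists_sub hm hs fun X h1 h2 h3 => by
          have e1 := hnt X h1 h2 h3
          have e2 := IsPairing.cutWeight_le_card m X
          have e3 := hm.cutWeight_le_card_compl X
          have e4 := Finset.card_add_card_compl X
          obtain ⟨a, ha⟩ := h1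
          obtain ⟨b, hb⟩ := h.even_card (Nat.succ_pos r)
          omega
        exact (ihr h1).add_pairing hm h2

/-- An `r`-graph on ten vertices with a tight cut separating at least three vertices from at
least three others is class 1. -/
theorem IsRWeight.decomposes_of_not_noTightCut {V : Type u} [Fintype V] [DecidableEq V] {r : ℕ}
    {w : V → V → ℕ} (h : IsRWeight r w) (hV : Fintype.card V = 10) (ht : ¬ NoTightCut r w) :
    Decomposes r w := by
  have : ∃ X : Finset V, Odd X.card ∧ 3 ≤ X.card ∧ 3 ≤ Xᶜ.card ∧ cutWeight w X = r := by
    by_contra hc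
    exact ht (h.noTightCut fun X h1 h2 h3 h4 => hc ⟨X, h1, h2, h3, h4⟩)
  obtain ⟨X, h1, h2, h3, h4⟩ := this
  have h5 := Finset.card_add_card_compl X
  have h6 : Odd Xᶜ.card := by
    obtain ⟨a, ha⟩ := h1
    exact ⟨4 - a, by omega⟩
  have h7 : cutWeight w Xᶜ = r := by rw [h.toIsRegularWeight.cut_compl, h4]
  exact h.toIsRegularWeight.decomposes_of_contract
    ((h.contract h4 h1).decomposes_of_card_le
      (by rw [Fintype.card_option, Fintype.card_coe]; omega))
    ((h.contract h7 h6).decomposes_of_card_le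
      (by rw [Fintype.card_option, Fintype.card_coe]; omega))

/-! ### Numerical consequences of the absence of tight cuts, and crossing cuts on ten vertices -/

section TenVertices

theorem sum_fin_ten (f : Fin 10 → ℕ) :
    ∑ i, f i = f 0 + f 1 + f 2 + f 3 + f 4 + f 5 + f 6 + f 7 + f 8 + f 9 := by
  rw [Fin.sum_univ_castSucc, Fin.sum_univ_castSucc, Fin.sum_univ_eight]
  rfl

theorem IsRegularWeight.deg_fin_ten {r : ℕ} {w : Fin 10 → Fin 10 → ℕ} (h : IsRegularWeight r w) :
    w 0 1 + w 0 2 + w 0 3 + w 0 4 + w 0 5 + w 0 6 + w 0 7 + w 0 8 + w 0 9 = r ∧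
    w 0 1 + w 1 2 + w 1 3 + w 1 4 + w 1 5 + w 1 6 + w 1 7 + w 1 8 + w 1 9 = r ∧
    w 0 2 + w 1 2 + w 2 3 + w 2 4 + w 2 5 + w 2 6 + w 2 7 + w 2 8 + w 2 9 = r ∧
    w 0 3 + w 1 3 + w 2 3 + w 3 4 + w 3 5 + w 3 6 + w 3 7 + w 3 8 + w 3 9 = r ∧
    w 0 4 + w 1 4 + w 2 4 + w 3 4 + w 4 5 + w 4 6 + w 4 7 + w 4 8 + w 4 9 = r ∧
    w 0 5 + w 1 5 + w 2 5 + w 3 5 + w 4 5 + w 5 6 + w 5 7 + w 5 8 + w 5 9 = r ∧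
    w 0 6 + w 1 6 + w 2 6 + w 3 6 + w 4 6 + w 5 6 + w 6 7 + w 6 8 + w 6 9 = r ∧
    w 0 7 + w 1 7 + w 2 7 + w 3 7 + w 4 7 + w 5 7 + w 6 7 + w 7 8 + w 7 9 = r ∧
    w 0 8 + w 1 8 + w 2 8 + w 3 8 + w 4 8 + w 5 8 + w 6 8 + w 7 8 + w 8 9 = r ∧
    w 0 9 + w 1 9 + w 2 9 + w 3 9 + w 4 9 + w 5 9 + w 6 9 + w 7 9 + w 8 9 = r := by
  have key : ∀ x, w x 0 + w x 1 + w x 2 + w x 3 + w x 4 + w x 5 + w x 6 + w x 7 + w x 8 + w x 9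
      = r := fun x => by rw [← sum_fin_ten fun y => w x y, h.deg]
  refine ⟨?_, ?_, ?_, ?_, ?_, ?_, ?_, ?_, ?_, ?_⟩
  · have := key 0; rw [h.diag] at this; omega
  · have := key 1; rw [h.diag, h.symm 1 0] at this; omega
  · have := key 2; rw [h.diag, h.symm 2 0, h.symm 2 1] at this; omega
  · have := key 3; rw [h.diag, h.symm 3 0, h.symm 3 1, h.symm 3 2] at this; omega
  · have := key 4
    rw [h.diag, h.symm 4 0, h.symm 4 1, h.symm 4 2, h.symm 4 3] at this; omega
  · have := key 5
    rw [h.diag, h.symm 5 0, h.symm 5 1, h.symm 5 2, h.symm 5 3, h.symm 5 4] at this; omega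
  · have := key 6
    rw [h.diag, h.symm 6 0, h.symm 6 1, h.symm 6 2, h.symm 6 3, h.symm 6 4, h.symm 6 5] at this
    omega
  · have := key 7
    rw [h.diag, h.symm 7 0, h.symm 7 1, h.symm 7 2, h.symm 7 3, h.symm 7 4, h.symm 7 5,
      h.symm 7 6] at this
    omega
  · have := key 8
    rw [h.diag, h.symm 8 0, h.symm 8 1, h.symm 8 2, h.symm 8 3, h.symm 8 4, h.symm 8 5,
      h.symm 8 6, h.symm 8 7] at this
    omega
  · have := key 9
    rw [h.diag, h.symm 9 0, h.symm 9 1, h.symm 9 2, h.symm 9 3, h.symm 9 4, h.symm 9 5,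
      h.symm 9 6, h.symm 9 7, h.symm 9 8] at this
    omega

variable {V : Type*} [Fintype V] [DecidableEq V]

/-- Twice the weight inside the triple plus its cut weight is `3 * r`, and the cut weighs at least
`r + 2`. -/
theorem NoTightCut.triple_le {r : ℕ} {w : V → V → ℕ} (ht : NoTightCut r w)
    (h : IsRegularWeight r w) (hV : 6 ≤ Fintype.card V) {a b c : V} (hab : a ≠ b) (hac : a ≠ c)
    (hbc : b ≠ c) : w a b + w a c + w b c + 1 ≤ r := by
  have h3 : ({a, b, c} : Finset V).card = 3 := Finset.card_eq_three.2 ⟨a, b, c, hab, hac, hbc, rfl⟩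
  have h1 := h.inner_add_cut {a, b, c}
  have h4 := Finset.card_add_card_compl ({a, b, c} : Finset V)
  have h2 := ht {a, b, c} (by rw [h3]; decide) h3.ge (by omega)
  rw [h3] at h1
  have ha : a ∉ ({b, c} : Finset V) := by simp [hab, hac]
  simp only [Finset.sum_insert ha, Finset.sum_pair hbc, h.diag, h.symm b a, h.symm c a,
    h.symm c b] at h1
  omega

theorem IsRegularWeight.quintuple_eq {r : ℕ} {w : V → V → ℕ} (h : IsRegularWeight r w)
    {a b c d e : V} (hn : [a, b, c, d, e].Nodup) (hc : cutWeight w {a, b, c, d, e} = r + 2) :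
    w a b + w a c + w a d + w a e + w b c + w b d + w b e + w c d + w c e + w d e + 1 = 2 * r := by
  have h1 := h.inner_add_cut {a, b, c, d, e}
  simp only [List.nodup_cons, List.mem_cons, List.not_mem_nil, or_false, not_or,
    not_false_eq_true, List.nodup_nil, and_true] at hn
  obtain ⟨⟨hab, hac, had, hae⟩, ⟨hbc, hbd, hbe⟩, ⟨hcd, hce⟩, hde⟩ := hn
  have ha : a ∉ ({b, c, d, e} : Finset V) := by simp [hab, hac, had, hae]
  have hb : b ∉ ({c, d, e} : Finset V) := by simp [hbc, hbd, hbe]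
  have hc' : c ∉ ({d, e} : Finset V) := by simp [hcd, hce]
  rw [hc, Finset.card_insert_of_notMem ha, Finset.card_insert_of_notMem hb,
    Finset.card_insert_of_notMem hc', Finset.card_pair hde] at h1
  simp only [Finset.sum_insert ha, Finset.sum_insert hb, Finset.sum_insert hc',
    Finset.sum_pair hde, h.diag, h.symm b a, h.symm c a, h.symm d a, h.symm e a,
    h.symm c b, h.symm d b, h.symm e b, h.symm d c, h.symm e c, h.symm e d] at h1
  omega

theorem map_compl_equiv {V' : Type*} [Fintype V'] [DecidableEq V'] (e : V' ≃ V) (X : Finset V') :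
    Xᶜ.map e.toEmbedding = (X.map e.toEmbedding)ᶜ := by
  ext x
  simp only [Finset.mem_map_equiv, Finset.mem_compl]

omit [DecidableEq V] in
theorem IsRegularWeight.comp {V' : Type*} [Fintype V'] [DecidableEq V'] {r : ℕ} {w : V → V → ℕ}
    (h : IsRegularWeight r w) (e : V' ≃ V) : IsRegularWeight r fun x y => w (e x) (e y) where
  symm _ _ := h.symm _ _
  diag _ := h.diag _
  deg x := by rw [Equiv.sum_comp e fun y => w (e x) y, h.deg]

theorem cutWeight_comp {V' : Type*} [Fintype V'] [DecidableEq V'] (w : V → V → ℕ) (e : V' ≃ V)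
    (X : Finset V') :
    cutWeight (fun x y => w (e x) (e y)) X = cutWeight w (X.map e.toEmbedding) := by
  rw [cutWeight, cutWeight, Finset.sum_map, ← map_compl_equiv]
  simp only [Finset.sum_map, Equiv.coe_toEmbedding]

theorem IsRWeight.comp {V' : Type*} [Fintype V'] [DecidableEq V'] {r : ℕ} {w : V → V → ℕ}
    (h : IsRWeight r w) (e : V' ≃ V) : IsRWeight r fun x y => w (e x) (e y) where
  toIsRegularWeight := h.toIsRegularWeight.comp e
  le_cut X hX := by
    rw [cutWeight_comp]
    exact h.le_cut _ (by rwa [Finset.card_map])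

theorem NoTightCut.comp {V' : Type*} [Fintype V'] [DecidableEq V'] {r : ℕ} {w : V → V → ℕ}
    (h : NoTightCut r w) (e : V' ≃ V) : NoTightCut r fun x y => w (e x) (e y) := by
  intro X hX h1 h2
  rw [cutWeight_comp]
  refine h _ (by rwa [Finset.card_map]) (by rwa [Finset.card_map]) ?_
  rwa [← map_compl_equiv, Finset.card_map]

/-- Two crossing cuts of weight `r + 2` in a graph without tight cuts. -/
theorem NoTightCut.crossing_fin_ten {r : ℕ} {w : Fin 10 → Fin 10 → ℕ} (ht : NoTightCut r w)
    (h : IsRegularWeight r w)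
    (hX : cutWeight w {0, 1, 2, 3, 4} = r + 2) (hY : cutWeight w {0, 1, 5, 6, 7} = r + 2) :
    (w 0 8 = 0 ∧ w 0 9 = 0 ∧ w 1 8 = 0 ∧ w 1 9 = 0) ∧
    (w 0 2 + w 0 3 + w 0 4 + w 1 2 + w 1 3 + w 1 4 + w 0 1 = r ∧
      w 0 5 + w 0 6 + w 0 7 + w 1 5 + w 1 6 + w 1 7 + w 0 1 = r ∧
      w 2 8 + w 2 9 + w 3 8 + w 3 9 + w 4 8 + w 4 9 + w 8 9 = r ∧
      w 5 8 + w 5 9 + w 6 8 + w 6 9 + w 7 8 + w 7 9 + w 8 9 = r) ∧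
    w 2 5 + w 2 6 + w 2 7 + w 3 5 + w 3 6 + w 3 7 + w 4 5 + w 4 6 + w 4 7 + r =
      w 0 1 + w 8 9 + 2 := by
  have q1 := h.quintuple_eq (by decide) hX
  have q2 := h.quintuple_eq (by decide) hY
  have t1 := ht.triple_le (a := 2) (b := 3) (c := 4) h (by simp) (by decide) (by decide) (by decide)
  have t2 := ht.triple_le (a := 5) (b := 6) (c := 7) h (by simp) (by decide) (by decide) (by decide)
  obtain ⟨d0, d1, d2, d3, d4, d5, d6, d7, d8, d9⟩ := h.deg_fin_ten
  -- The two cuts divide the vertices into `B = {0, 1}`, `A = {2, 3, 4}`, `D = {5, 6, 7}` and `C =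
  -- {8, 9}`. Names for the weights between and inside the parts reduce the problem to few
  -- variables.
  obtain ⟨BC, hBC⟩ : ∃ n, n = w 0 8 + w 0 9 + w 1 8 + w 1 9 := ⟨_, rfl⟩
  obtain ⟨BA, hBA⟩ : ∃ n, n = w 0 2 + w 0 3 + w 0 4 + w 1 2 + w 1 3 + w 1 4 := ⟨_, rfl⟩
  obtain ⟨BD, hBD⟩ : ∃ n, n = w 0 5 + w 0 6 + w 0 7 + w 1 5 + w 1 6 + w 1 7 := ⟨_, rfl⟩
  obtain ⟨AC, hAC⟩ : ∃ n, n = w 2 8 + w 2 9 + w 3 8 + w 3 9 + w 4 8 + w 4 9 := ⟨_, rfl⟩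
  obtain ⟨DC, hDC⟩ : ∃ n, n = w 5 8 + w 5 9 + w 6 8 + w 6 9 + w 7 8 + w 7 9 := ⟨_, rfl⟩
  obtain ⟨AD, hAD⟩ : ∃ n, n = w 2 5 + w 2 6 + w 2 7 + w 3 5 + w 3 6 + w 3 7 + w 4 5 + w 4 6 +
    w 4 7 := ⟨_, rfl⟩
  obtain ⟨A, hA⟩ : ∃ n, n = w 2 3 + w 2 4 + w 3 4 := ⟨_, rfl⟩
  obtain ⟨D, hD⟩ : ∃ n, n = w 5 6 + w 5 7 + w 6 7 := ⟨_, rfl⟩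
  have e1 : 2 * w 0 1 + BA + BD + BC = 2 * r := by linarith only [d0, d1, hBA, hBD, hBC]
  have e2 : 2 * w 8 9 + AC + DC + BC = 2 * r := by linarith only [d8, d9, hAC, hDC, hBC]
  have e3 : 2 * A + BA + AC + AD = 3 * r := by linarith only [d2, d3, d4, hA, hBA, hAC, hAD]
  have e4 : 2 * D + BD + DC + AD = 3 * r := by linarith only [d5, d6, d7, hD, hBD, hDC, hAD]
  have e5 : w 0 1 + BA + A + 1 = 2 * r := by linarith only [q1, hBA, hA]
  have e6 : w 0 1 + BD + D + 1 = 2 * r := by linarith only [q2, hBD, hD]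
  have e7 : A + 1 ≤ r := by linarith only [t1, hA]
  have e8 : D + 1 ≤ r := by linarith only [t2, hD]
  clear d0 d1 d2 d3 d4 d5 d6 d7 d8 d9 q1 q2 t1 t2 hA hD
  -- Uncrossing: the cuts of `A`, of `D` and twice the weight `BC` add up to the cuts of `X` and
  -- `Y`, namely `2 * r + 4`. As `A` and `D` are triples, their cuts already account for all of it.
  -- The remaining identities follow from this equality.
  have e9 : BC = 0 := by clear hBC hBA hBD hAC hDC hAD; omega
  rw [← hAD, ← hBA, ← hBD, ← hAC, ← hDC]
  refine ⟨?_, ?_⟩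
  · clear hBA hBD hAC hDC hAD
    omega
  · clear hBC hBA hBD hAC hDC hAD
    omega

/-- `NoTightCut.crossing_fin_ten` for an arbitrary labelling of the vertices. -/
theorem NoTightCut.crossing {r : ℕ} {w : Fin 10 → Fin 10 → ℕ} (ht : NoTightCut r w)
    (h : IsRegularWeight r w) (l : Fin 10 → Fin 10) (hl : Function.Injective l)
    (hX : cutWeight w {l 0, l 1, l 2, l 3, l 4} = r + 2)
    (hY : cutWeight w {l 0, l 1, l 5, l 6, l 7} = r + 2) :
    (w (l 0) (l 8) = 0 ∧ w (l 0) (l 9) = 0 ∧ w (l 1) (l 8) = 0 ∧ w (l 1) (l 9) = 0) ∧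
    (w (l 0) (l 2) + w (l 0) (l 3) + w (l 0) (l 4) + w (l 1) (l 2) + w (l 1) (l 3) +
        w (l 1) (l 4) + w (l 0) (l 1) = r ∧
      w (l 0) (l 5) + w (l 0) (l 6) + w (l 0) (l 7) + w (l 1) (l 5) + w (l 1) (l 6) +
        w (l 1) (l 7) + w (l 0) (l 1) = r ∧
      w (l 2) (l 8) + w (l 2) (l 9) + w (l 3) (l 8) + w (l 3) (l 9) + w (l 4) (l 8) +
        w (l 4) (l 9) + w (l 8) (l 9) = r ∧
      w (l 5) (l 8) + w (l 5) (l 9) + w (l 6) (l 8) + w (l 6) (l 9) + w (l 7) (l 8) +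
        w (l 7) (l 9) + w (l 8) (l 9) = r) ∧
    w (l 2) (l 5) + w (l 2) (l 6) + w (l 2) (l 7) + w (l 3) (l 5) + w (l 3) (l 6) +
      w (l 3) (l 7) + w (l 4) (l 5) + w (l 4) (l 6) + w (l 4) (l 7) + r =
      w (l 0) (l 1) + w (l 8) (l 9) + 2 := by
  let e : Fin 10 ≃ Fin 10 := Equiv.ofBijective l (Finite.injective_iff_bijective.1 hl)
  refine (ht.comp e).crossing_fin_ten (h.comp e) ?_ ?_
  · rw [cutWeight_comp]
    simpa [e] using hX
  · rw [cutWeight_comp]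
    simpa [e] using hY

theorem IsPairing.conj {V V' : Type*} {m : V → V} (hm : IsPairing m) (e : V ≃ V') :
    IsPairing fun x => e (m (e.symm x)) where
  invol x := by simp [hm.invol]
  ne x hx := hm.ne (e.symm x) (e.injective (by simpa using hx))

/-- A bound on the weights of all perfect matchings, applied to the perfect matching formed by
the pairs `{l 0, l 1}, …, {l 8, l 9}`. -/
theorem pairing_weight_le {b : ℕ} {w : Fin 10 → Fin 10 → ℕ} (hw : ∀ x y, w x y = w y x)
    (H : ∀ m, IsPairing m → (∀ x, 1 ≤ w x (m x)) → ∑ x, w x (m x) ≤ 2 * b)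
    (l : Fin 10 → Fin 10) (hl : Function.Injective l) (h0 : 1 ≤ w (l 0) (l 1))
    (h1 : 1 ≤ w (l 2) (l 3)) (h2 : 1 ≤ w (l 4) (l 5)) (h3 : 1 ≤ w (l 6) (l 7))
    (h4 : 1 ≤ w (l 8) (l 9)) :
    w (l 0) (l 1) + w (l 2) (l 3) + w (l 4) (l 5) + w (l 6) (l 7) + w (l 8) (l 9) ≤ b := by
  let e : Fin 10 ≃ Fin 10 := Equiv.ofBijective l (Finite.injective_iff_bijective.1 hl)
  have he : ∀ x, e x = l x := fun x => rfl
  have hm : IsPairing (![1, 0, 3, 2, 5, 4, 7, 6, 9, 8] : Fin 10 → Fin 10) :=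
    ⟨by decide, by decide⟩
  have := H _ (hm.conj e) ?_
  · rw [← Equiv.sum_comp e, sum_fin_ten] at this
    simp only [Equiv.symm_apply_apply] at this
    change w (l 0) (l 1) + w (l 1) (l 0) + w (l 2) (l 3) + w (l 3) (l 2) + w (l 4) (l 5) +
      w (l 5) (l 4) + w (l 6) (l 7) + w (l 7) (l 6) + w (l 8) (l 9) + w (l 9) (l 8) ≤ _ at this
    rw [hw (l 1), hw (l 3), hw (l 5), hw (l 7), hw (l 9)] at this
    omega
  · intro x
    obtain ⟨x, rfl⟩ := e.surjective x
    rw [Equiv.symm_apply_apply]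
    fin_cases x
    · exact h0
    · exact (hw _ _).trans_ge h0
    · exact h1
    · exact (hw _ _).trans_ge h1
    · exact h2
    · exact (hw _ _).trans_ge h2
    · exact h3
    · exact (hw _ _).trans_ge h3
    · exact h4
    · exact (hw _ _).trans_ge h4

end TenVertices

/-! ### The three impossible configurations of three cuts -/

section Configurations

/-- Three cuts of weight `r + 2` without common vertex, the pairs of which have two, two and three
common vertices. -/
theorem false_of_card_inter_two_two_three {r : ℕ} {w : Fin 10 → Fin 10 → ℕ} (h : IsRegularWeight r w)
    (ht : NoTightCut r w)
    (hX : cutWeight w {0, 1, 2, 3, 7} = r + 2) (hY : cutWeight w {0, 1, 4, 5, 6} = r + 2)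
    (hZ : cutWeight w {2, 3, 4, 5, 6} = r + 2) : False := by
  have t := fun a b c hab hac hbc => ht.triple_le (a := a) (b := b) (c := c) h (by simp) hab hac hbc
  have q1 := h.quintuple_eq (by decide) hX
  have q2 := h.quintuple_eq (by decide) hY
  have q3 := h.quintuple_eq (by decide) hZ
  -- The contradiction is linear. Uncrossing the first two cuts shows that the pairs with an end in
  -- `{0, 1}` inside `{0, 1, 2, 3, 7}` have total weight `r`. Uncrossing the last two, with corners
  -- `{4, 5, 6}` and `{7, 8, 9}`, shows that nothing joins `{0, 1}` to `{2, 3}`. Hence the triple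
  -- `{0, 1, 7}` has weight `r`, which is one too much.
  obtain ⟨d0, d1, d2, d3, d4, d5, d6, d7, d8, d9⟩ := h.deg_fin_ten
  have t1 := t 2 3 7 (by decide) (by decide) (by decide)
  have t2 := t 4 5 6 (by decide) (by decide) (by decide)
  have t3 := t 0 1 7 (by decide) (by decide) (by decide)
  have t4 := t 7 8 9 (by decide) (by decide) (by decide)
  linarith

/-- Three cuts of weight `r + 2` with one common vertex, the pairs of which have two, two and three
common vertices. -/
theorem false_of_card_inter_two_two_three_of_common {r : ℕ} (hr : 4 ≤ r) {w : Fin 10 → Fin 10 → ℕ}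
    (h : IsRegularWeight r w) (ht : NoTightCut r w)
    (H : ∀ m, IsPairing m → (∀ x, 1 ≤ w x (m x)) → ∑ x, w x (m x) ≤ 2 * (r + 2))
    (hX : cutWeight w {0, 1, 2, 5, 6} = r + 2) (hY : cutWeight w {0, 1, 3, 4, 7} = r + 2)
    (hZ : cutWeight w {0, 2, 3, 4, 8} = r + 2)
    (hXY : 1 ≤ ∑ a ∈ {0, 1}, ∑ d ∈ {8, 9}, w a d + ∑ a ∈ {2, 5, 6}, ∑ d ∈ {3, 4, 7}, w a d)
    (hXZ : 1 ≤ ∑ a ∈ {0, 2}, ∑ d ∈ {7, 9}, w a d + ∑ a ∈ {1, 5, 6}, ∑ d ∈ {3, 4, 8}, w a d)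
    (hYZ : 1 ≤ ∑ a ∈ {0, 3, 4}, ∑ d ∈ {5, 6, 9}, w a d + ∑ a ∈ {1, 7}, ∑ d ∈ {2, 8}, w a d) :
    False := by
  have t := fun a b c hab hac hbc => ht.triple_le (a := a) (b := b) (c := c) h (by simp) hab hac hbc
  have hY' : cutWeight w {1, 7, 0, 3, 4} = r + 2 := by
    rw [← hY]; congr 1; decide
  -- The second and third sets share three vertices. Passing to the complement of the third makes
  -- the intersection `{1, 7}`, as uncrossing requires.
  have hZ' : cutWeight w {1, 7, 5, 6, 9} = r + 2 := by
    rw [← hZ, ← h.cut_compl]; congr 1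
  obtain ⟨⟨y1, y2, y3, y4⟩, -, y5⟩ : (w 0 8 = 0 ∧ w 0 9 = 0 ∧ w 1 8 = 0 ∧ w 1 9 = 0) ∧ _ ∧
      w 2 3 + w 2 4 + w 2 7 + w 5 3 + w 5 4 + w 5 7 + w 6 3 + w 6 4 + w 6 7 + r =
      w 0 1 + w 8 9 + 2 :=
    ht.crossing h ![0, 1, 2, 5, 6, 3, 4, 7, 8, 9] (by decide) hX hY
  obtain ⟨⟨y6, y7, y8, y9⟩, -, y10⟩ : (w 0 7 = 0 ∧ w 0 9 = 0 ∧ w 2 7 = 0 ∧ w 2 9 = 0) ∧ _ ∧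
      w 1 3 + w 1 4 + w 1 8 + w 5 3 + w 5 4 + w 5 8 + w 6 3 + w 6 4 + w 6 8 + r =
      w 0 2 + w 7 9 + 2 :=
    ht.crossing h ![0, 2, 1, 5, 6, 3, 4, 8, 7, 9] (by decide) (by rw [← hX]; congr 1; decide) hZ
  obtain ⟨⟨y11, y12, y13, y14⟩, -, y15⟩ : (w 1 2 = 0 ∧ w 1 8 = 0 ∧ w 7 2 = 0 ∧ w 7 8 = 0) ∧ _ ∧
      w 0 5 + w 0 6 + w 0 9 + w 3 5 + w 3 6 + w 3 9 + w 4 5 + w 4 6 + w 4 9 + r =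
      w 1 7 + w 2 8 + 2 :=
    ht.crossing h ![1, 7, 0, 3, 4, 5, 6, 9, 2, 8] (by decide) hY' hZ'
  -- Uncrossing has killed the weights between the intersection and the outside. Thus an edge
  -- crossing both cuts must join the two differences, which makes the corresponding sums in `y5`,
  -- `y10` and `y15` positive.
  simp [y1, y2, y3, y4] at hXY
  simp [y6, y7, y8, y9] at hXZ
  simp [y11, y12, y13, y14] at hYZ
  have s1 : r ≤ w 0 1 + w 8 9 + 1 := by clear hXZ hYZ; omega
  have s2 : r ≤ w 0 2 + w 7 9 + 1 := by clear hXY hYZ; omega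
  have s3 : r ≤ w 1 7 + w 2 8 + 1 := by clear hXY hXZ; omega
  clear y5 y10 y15 hXY hXZ hYZ
  have u1 := t 0 1 2 (by decide) (by decide) (by decide)
  have u2 := t 0 2 8 (by decide) (by decide) (by decide)
  have u3 := t 2 8 9 (by decide) (by decide) (by decide)
  have u4 := t 7 8 9 (by decide) (by decide) (by decide)
  have u5 := t 1 7 9 (by decide) (by decide) (by decide)
  have u6 := t 0 1 7 (by decide) (by decide) (by decide)
  -- The vertices `0, 1, 7, 9, 8, 2` form a hexagon. Opposite sides weigh at least `r - 1` together
  -- by `s1`, `s2`, `s3`, and consecutive sides at most `r - 1` by the triples. So equality holds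
  -- throughout, and alternate sides have equal weight.
  have e1 : w 0 1 = w 2 8 ∧ w 0 1 = w 7 9 ∧ w 0 2 = w 8 9 ∧ w 0 2 = w 1 7 ∧
      w 0 1 + w 0 2 + 1 = r := by omega
  obtain ⟨e1, e2, e3, e4, e5⟩ := e1
  clear u1 u2 u3 u4 u5 u6 s1 s2 s3
  have i1 : 2 * r ≤ w 3 4 + w 3 5 + w 3 6 + w 4 5 + w 4 6 + w 5 6 + 3 := by
    obtain ⟨d0, d1, d2, d3, d4, d5, d6, d7, d8, d9⟩ := h.deg_fin_ten
    linarith only [d0, d1, d2, d3, d4, d5, d6, d7, d8, d9, e1, e2, e3, e4, e5,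
      Nat.zero_le (w 0 8), Nat.zero_le (w 1 9), Nat.zero_le (w 2 7)]
  have v1 := t 3 4 5 (by decide) (by decide) (by decide)
  have v2 := t 3 4 6 (by decide) (by decide) (by decide)
  have v3 := t 3 5 6 (by decide) (by decide) (by decide)
  have v4 := t 4 5 6 (by decide) (by decide) (by decide)
  -- Otherwise the positive pairs on `{3, 4, 5, 6}` lie in a triangle or a star. The triple bounds
  -- then allow a total of at most `r - 1` or `3 * (r - 1) / 2`, below the `2 * r - 3` of `i1` since
  -- `r ≥ 4`.
  have hp : (1 ≤ w 3 4 ∧ 1 ≤ w 5 6) ∨ (1 ≤ w 3 5 ∧ 1 ≤ w 4 6) ∨ (1 ≤ w 3 6 ∧ 1 ≤ w 4 5) := by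
    by_contra hc
    simp only [not_or, not_and_or, not_le, Nat.lt_one_iff] at hc
    obtain ⟨h1 | h1, h2 | h2, h3 | h3⟩ := hc <;> omega
  have e1 : w 0 1 = w 2 8 ∧ w 0 1 = w 7 9 ∧ w 0 2 = w 8 9 ∧ w 0 2 = w 1 7 ∧
      w 0 1 + w 0 2 + 1 = r := by
    refine ⟨?_, ?_, ?_, ?_, ?_⟩ <;> linarith
  obtain ⟨e1, e2, e3, e4, e5⟩ := e1
  -- The heavier alternate sides of the hexagon, each of weight at least `(r - 1) / 2`, are
  -- completed by two pairs on `{3, 4, 5, 6}`. For `r ≥ 4` this perfect matching weighs more than `r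
  -- + 2`.
  rcases le_total (w 0 1) (w 0 2) with hle | hle
  · rcases hp with hp | hp | hp
    · have : w 0 2 + w 8 9 + w 1 7 + w 3 4 + w 5 6 ≤ r + 2 := pairing_weight_le h.symm H
        ![0, 2, 8, 9, 1, 7, 3, 4, 5, 6] (by decide) (by change 1 ≤ w 0 2; omega)
        (by change 1 ≤ w 8 9; omega) (by change 1 ≤ w 1 7; omega) hp.1 hp.2
      omega
    · have : w 0 2 + w 8 9 + w 1 7 + w 3 5 + w 4 6 ≤ r + 2 := pairing_weight_le h.symm H
        ![0, 2, 8, 9, 1, 7, 3, 5, 4, 6] (by decide) (by change 1 ≤ w 0 2; omega)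
        (by change 1 ≤ w 8 9; omega) (by change 1 ≤ w 1 7; omega) hp.1 hp.2
      omega
    · have : w 0 2 + w 8 9 + w 1 7 + w 3 6 + w 4 5 ≤ r + 2 := pairing_weight_le h.symm H
        ![0, 2, 8, 9, 1, 7, 3, 6, 4, 5] (by decide) (by change 1 ≤ w 0 2; omega)
        (by change 1 ≤ w 8 9; omega) (by change 1 ≤ w 1 7; omega) hp.1 hp.2
      omega
  · rcases hp with hp | hp | hp
    · have : w 0 1 + w 2 8 + w 7 9 + w 3 4 + w 5 6 ≤ r + 2 := pairing_weight_le h.symm H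
        ![0, 1, 2, 8, 7, 9, 3, 4, 5, 6] (by decide) (by change 1 ≤ w 0 1; omega)
        (by change 1 ≤ w 2 8; omega) (by change 1 ≤ w 7 9; omega) hp.1 hp.2
      omega
    · have : w 0 1 + w 2 8 + w 7 9 + w 3 5 + w 4 6 ≤ r + 2 := pairing_weight_le h.symm H
        ![0, 1, 2, 8, 7, 9, 3, 5, 4, 6] (by decide) (by change 1 ≤ w 0 1; omega)
        (by change 1 ≤ w 2 8; omega) (by change 1 ≤ w 7 9; omega) hp.1 hp.2
      omega
    · have : w 0 1 + w 2 8 + w 7 9 + w 3 6 + w 4 5 ≤ r + 2 := pairing_weight_le h.symm H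
        ![0, 1, 2, 8, 7, 9, 3, 6, 4, 5] (by decide) (by change 1 ≤ w 0 1; omega)
        (by change 1 ≤ w 2 8; omega) (by change 1 ≤ w 7 9; omega) hp.1 hp.2
      omega

/-- Three cuts of weight `r + 2` without common vertex, the pairs of which have two common vertices
each. -/
theorem false_of_card_inter_two_two_two {r : ℕ} (hr : 4 ≤ r) {w : Fin 10 → Fin 10 → ℕ}
    (h : IsRegularWeight r w) (ht : NoTightCut r w)
    (H : ∀ m, IsPairing m → (∀ x, 1 ≤ w x (m x)) → ∑ x, w x (m x) ≤ 2 * (r + 2))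
    (hX : cutWeight w {0, 1, 2, 3, 6} = r + 2) (hY : cutWeight w {0, 1, 4, 5, 7} = r + 2)
    (hZ : cutWeight w {2, 3, 4, 5, 8} = r + 2)
    (hXY : 1 ≤ ∑ a ∈ {0, 1}, ∑ d ∈ {8, 9}, w a d + ∑ a ∈ {2, 3, 6}, ∑ d ∈ {4, 5, 7}, w a d)
    (hXZ : 1 ≤ ∑ a ∈ {2, 3}, ∑ d ∈ {7, 9}, w a d + ∑ a ∈ {0, 1, 6}, ∑ d ∈ {4, 5, 8}, w a d)
    (hYZ : 1 ≤ ∑ a ∈ {4, 5}, ∑ d ∈ {6, 9}, w a d + ∑ a ∈ {0, 1, 7}, ∑ d ∈ {2, 3, 8}, w a d) :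
    False := by
  have t := fun a b c hab hac hbc => ht.triple_le (a := a) (b := b) (c := c) h (by simp) hab hac hbc
  obtain ⟨⟨y1, y2, y3, y4⟩, ⟨m1, m2, m3, m4⟩, y5⟩ :
      (w 0 8 = 0 ∧ w 0 9 = 0 ∧ w 1 8 = 0 ∧ w 1 9 = 0) ∧
      (w 0 2 + w 0 3 + w 0 6 + w 1 2 + w 1 3 + w 1 6 + w 0 1 = r ∧
      w 0 4 + w 0 5 + w 0 7 + w 1 4 + w 1 5 + w 1 7 + w 0 1 = r ∧
      w 2 8 + w 2 9 + w 3 8 + w 3 9 + w 6 8 + w 6 9 + w 8 9 = r ∧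
      w 4 8 + w 4 9 + w 5 8 + w 5 9 + w 7 8 + w 7 9 + w 8 9 = r) ∧
      w 2 4 + w 2 5 + w 2 7 + w 3 4 + w 3 5 + w 3 7 + w 6 4 + w 6 5 + w 6 7 + r =
      w 0 1 + w 8 9 + 2 :=
    ht.crossing h ![0, 1, 2, 3, 6, 4, 5, 7, 8, 9] (by decide) hX hY
  obtain ⟨⟨y6, y7, y8, y9⟩, ⟨m5, m6, m7, m8⟩, y10⟩ :
      (w 2 7 = 0 ∧ w 2 9 = 0 ∧ w 3 7 = 0 ∧ w 3 9 = 0) ∧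
      (w 2 0 + w 2 1 + w 2 6 + w 3 0 + w 3 1 + w 3 6 + w 2 3 = r ∧
      w 2 4 + w 2 5 + w 2 8 + w 3 4 + w 3 5 + w 3 8 + w 2 3 = r ∧
      w 0 7 + w 0 9 + w 1 7 + w 1 9 + w 6 7 + w 6 9 + w 7 9 = r ∧
      w 4 7 + w 4 9 + w 5 7 + w 5 9 + w 8 7 + w 8 9 + w 7 9 = r) ∧
      w 0 4 + w 0 5 + w 0 8 + w 1 4 + w 1 5 + w 1 8 + w 6 4 + w 6 5 + w 6 8 + r =
      w 2 3 + w 7 9 + 2 :=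
    ht.crossing h ![2, 3, 0, 1, 6, 4, 5, 8, 7, 9] (by decide) (by rw [← hX]; congr 1; decide) hZ
  obtain ⟨⟨y11, y12, y13, y14⟩, ⟨m9, m10, m11, m12⟩, y15⟩ :
      (w 4 6 = 0 ∧ w 4 9 = 0 ∧ w 5 6 = 0 ∧ w 5 9 = 0) ∧
      (w 4 0 + w 4 1 + w 4 7 + w 5 0 + w 5 1 + w 5 7 + w 4 5 = r ∧
      w 4 2 + w 4 3 + w 4 8 + w 5 2 + w 5 3 + w 5 8 + w 4 5 = r ∧
      w 0 6 + w 0 9 + w 1 6 + w 1 9 + w 7 6 + w 7 9 + w 6 9 = r ∧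
      w 2 6 + w 2 9 + w 3 6 + w 3 9 + w 8 6 + w 8 9 + w 6 9 = r) ∧
      w 0 2 + w 0 3 + w 0 8 + w 1 2 + w 1 3 + w 1 8 + w 7 2 + w 7 3 + w 7 8 + r =
      w 4 5 + w 6 9 + 2 :=
    ht.crossing h ![4, 5, 0, 1, 7, 2, 3, 8, 6, 9] (by decide) (by rw [← hY]; congr 1; decide)
      (by rw [← hZ]; congr 1; decide)
  simp [y1, y2, y3, y4] at hXY
  simp [y6, y7, y8, y9] at hXZ
  simp [y11, y12, y13, y14] at hYZ
  have s1 : r ≤ w 0 1 + w 8 9 + 1 := by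
    clear hXZ hYZ m1 m2 m3 m4 m5 m6 m7 m8 m9 m10 m11 m12 y10 y15
    omega
  have s2 : r ≤ w 2 3 + w 7 9 + 1 := by
    clear hXY hYZ m1 m2 m3 m4 m5 m6 m7 m8 m9 m10 m11 m12 y5 y15
    omega
  have s3 : r ≤ w 4 5 + w 6 9 + 1 := by
    clear hXY hXZ m1 m2 m3 m4 m5 m6 m7 m8 m9 m10 m11 m12 y5 y10
    omega
  clear hXY hXZ hYZ y5 y10 y15
  obtain ⟨d4, d5, d9⟩ : (w 0 4 + w 1 4 + w 2 4 + w 3 4 + w 4 5 + w 4 6 + w 4 7 + w 4 8 + w 4 9 = r) ∧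
      (w 0 5 + w 1 5 + w 2 5 + w 3 5 + w 4 5 + w 5 6 + w 5 7 + w 5 8 + w 5 9 = r) ∧
      w 0 9 + w 1 9 + w 2 9 + w 3 9 + w 4 9 + w 5 9 + w 6 9 + w 7 9 + w 8 9 = r := by
    obtain ⟨d0, d1, d2, d3, d4, d5, d6, d7, d8, d9⟩ := h.deg_fin_ten
    exact ⟨d4, d5, d9⟩
  have u1 := t 6 7 9 (by decide) (by decide) (by decide)
  have u2 := t 6 8 9 (by decide) (by decide) (by decide)
  have u3 := t 7 8 9 (by decide) (by decide) (by decide)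
  -- Uncrossing leaves vertex `9` only the neighbours `6`, `7` and `8`.
  have a1 : w 6 9 + w 7 9 + w 8 9 = r := by omega
  -- By `s1`, `s2`, `s3` and `a1`, the pairs `01`, `23`, `45` weigh at least `2 * r - 3` together.
  -- Adding one pair inside `{6, 7, 8}` and the pair of `9` with the third vertex, which is positive
  -- by the triple bounds, exceeds `r + 2`.
  have hh : ¬ (1 ≤ w 6 7 ∨ 1 ≤ w 6 8 ∨ 1 ≤ w 7 8) := by
    clear m1 m2 m3 m4 m5 m6 m7 m8 m9 m10 m11 m12 d4 d5 d9 y1 y2 y3 y4 y6 y7 y8 y9 y11 y12 y13 y14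
    intro hh
    rcases hh with hh | hh | hh
    · have : w 0 1 + w 2 3 + w 4 5 + w 8 9 + w 6 7 ≤ r + 2 := pairing_weight_le h.symm H
        ![0, 1, 2, 3, 4, 5, 8, 9, 6, 7] (by decide) (by change 1 ≤ w 0 1; omega)
        (by change 1 ≤ w 2 3; omega) (by change 1 ≤ w 4 5; omega)
        (by change 1 ≤ w 8 9; omega) hh
      omega
    · have : w 0 1 + w 2 3 + w 4 5 + w 7 9 + w 6 8 ≤ r + 2 := pairing_weight_le h.symm H
        ![0, 1, 2, 3, 4, 5, 7, 9, 6, 8] (by decide) (by change 1 ≤ w 0 1; omega)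
        (by change 1 ≤ w 2 3; omega) (by change 1 ≤ w 4 5; omega)
        (by change 1 ≤ w 7 9; omega) hh
      omega
    · have : w 0 1 + w 2 3 + w 4 5 + w 6 9 + w 7 8 ≤ r + 2 := pairing_weight_le h.symm H
        ![0, 1, 2, 3, 4, 5, 6, 9, 7, 8] (by decide) (by change 1 ≤ w 0 1; omega)
        (by change 1 ≤ w 2 3; omega) (by change 1 ≤ w 4 5; omega)
        (by change 1 ≤ w 6 9; omega) hh
      omega
  have p1 : 1 ≤ w 0 1 := by
    linarith only [hr, s1, u1, u2, u3, a1,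
    Nat.zero_le (w 6 7), Nat.zero_le (w 6 8), Nat.zero_le (w 7 8)]
  have p2 : 1 ≤ w 2 3 := by
    linarith only [hr, s2, u1, u2, u3, a1,
    Nat.zero_le (w 6 7), Nat.zero_le (w 6 8), Nat.zero_le (w 7 8)]
  have p3 : 1 ≤ w 4 5 := by
    linarith only [hr, s3, u1, u2, u3, a1,
    Nat.zero_le (w 6 7), Nat.zero_le (w 6 8), Nat.zero_le (w 7 8)]
  have h67 : w 6 7 = 0 := by clear m1 m2 m3 m4 m5 m6 m7 m8 m9 m10 m11 m12; omega
  have h68 : w 6 8 = 0 := by clear m1 m2 m3 m4 m5 m6 m7 m8 m9 m10 m11 m12; omega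
  have h78 : w 7 8 = 0 := by clear m1 m2 m3 m4 m5 m6 m7 m8 m9 m10 m11 m12; omega
  rw [h.symm 2 0, h.symm 2 1, h.symm 3 0, h.symm 3 1] at m5
  rw [h.symm 8 7, h78] at m8
  rw [h.symm 4 0, h.symm 4 1, h.symm 5 0, h.symm 5 1] at m9
  rw [h.symm 4 2, h.symm 4 3, h.symm 5 2, h.symm 5 3] at m10
  rw [h.symm 7 6, h67] at m11
  rw [h.symm 8 6, h68] at m12
  rw [h68] at m3
  rw [h78] at m4
  rw [h67] at m7
  have b1 : w 0 7 + w 1 7 = w 8 9 := by clear m1 m2 m3 m4 m5 m6 m8 m9 m10 m11 m12; omega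
  have b2 : w 0 6 + w 1 6 = w 8 9 := by clear m1 m2 m3 m4 m5 m6 m7 m8 m9 m10 m12; omega
  have b3 : w 2 6 + w 3 6 = w 7 9 := by clear m1 m2 m3 m4 m5 m6 m7 m8 m9 m10 m11; omega
  have b4 : w 2 8 + w 3 8 = w 7 9 := by clear m1 m2 m4 m5 m6 m7 m8 m9 m10 m11 m12; omega
  have b5 : w 4 7 + w 5 7 = w 6 9 := by clear m1 m2 m3 m4 m5 m6 m7 m9 m10 m11 m12; omega
  have b6 : w 4 8 + w 5 8 = w 6 9 := by clear m1 m2 m3 m5 m6 m7 m8 m9 m10 m11 m12; omega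
  clear m3 m4 m7 m8 m11 m12 u1 u2 u3 d9 h67 h68 h78 hh
  have f1 : w 0 2 + w 0 3 + w 1 2 + w 1 3 + w 8 9 + w 0 1 = r := by
    linarith only [m1, b2]
  have f2 : w 0 4 + w 0 5 + w 1 4 + w 1 5 + w 8 9 + w 0 1 = r := by
    linarith only [m2, b1]
  have f3 : w 0 2 + w 0 3 + w 1 2 + w 1 3 + w 7 9 + w 2 3 = r := by
    linarith only [m5, b3]
  have f4 : w 2 4 + w 2 5 + w 3 4 + w 3 5 + w 7 9 + w 2 3 = r := by
    linarith only [m6, b4]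
  have f5 : w 0 4 + w 0 5 + w 1 4 + w 1 5 + w 6 9 + w 4 5 = r := by
    linarith only [m9, b5]
  have f6 : w 2 4 + w 2 5 + w 3 4 + w 3 5 + w 6 9 + w 4 5 = r := by
    linarith only [m10, b6]
  clear m1 m2 m5 m6 m9 m10
  have t1 := t 0 1 6 (by decide) (by decide) (by decide)
  have t2 := t 2 3 6 (by decide) (by decide) (by decide)
  have t3 := t 4 5 7 (by decide) (by decide) (by decide)
  have g3 : w 0 1 + w 8 9 + 1 = r := by linarith only [s1, t1, b2]
  have g2 : w 2 3 + w 7 9 + 1 = r := by linarith only [s2, t2, b3]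
  have g1 : w 4 5 + w 6 9 + 1 = r := by linarith only [s3, t3, b5]
  -- Exactly one edge joins any two of the pairs `{0, 1}`, `{2, 3}`, `{4, 5}`.
  have c1 : w 0 2 + w 0 3 + w 1 2 + w 1 3 = 1 := by linarith only [f1, g3]
  have c2 : w 0 4 + w 0 5 + w 1 4 + w 1 5 = 1 := by linarith only [f2, g3]
  have c3 : w 2 4 + w 2 5 + w 3 4 + w 3 5 = 1 := by linarith only [f4, g2]
  clear f1 f2 f3 f4 f5 f6 t1 t2 t3 s1 s2 s3
  obtain ⟨d0, d1, d2, d3, -⟩ := h.deg_fin_ten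
  have h3 : 2 ≤ w 6 9 ∨ 2 ≤ w 7 9 ∨ 2 ≤ w 8 9 := by
    clear d0 d1 d2 d3 d4 d5 b1 b2 b3 b4 b5 b6 c1 c2 c3 g1 g2 g3
    omega
  -- The three cases are symmetric. If `w 6 9 ≥ 2`, a perfect matching with `69`, `01`, `23` and two
  -- positive pairs between `{4, 5}` and `{7, 8}` weighs at least `r + 4`. If there is none, `4` or
  -- `5` has no neighbour in `{7, 8}`, and its degree forces `w 6 9 ≤ 1`.
  rcases h3 with h3 | h3 | h3
  · have h69 : 1 ≤ w 6 9 := le_trans (by norm_num) h3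
    by_cases k1 : 1 ≤ w 4 7 ∧ 1 ≤ w 5 8
    · have : w 6 9 + w 0 1 + w 2 3 + w 4 7 + w 5 8 ≤ r + 2 := pairing_weight_le h.symm H
        ![6, 9, 0, 1, 2, 3, 4, 7, 5, 8] (by decide) h69 p1 p2 k1.1 k1.2
      linarith only [this, a1, g1, g2, g3, h3, k1.1, k1.2]
    by_cases k2 : 1 ≤ w 5 7 ∧ 1 ≤ w 4 8
    · have : w 6 9 + w 0 1 + w 2 3 + w 5 7 + w 4 8 ≤ r + 2 := pairing_weight_le h.symm H
        ![6, 9, 0, 1, 2, 3, 5, 7, 4, 8] (by decide) h69 p1 p2 k2.1 k2.2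
      linarith only [this, a1, g1, g2, g3, h3, k2.1, k2.2]
    have : (w 4 7 = 0 ∧ w 4 8 = 0) ∨ (w 5 7 = 0 ∧ w 5 8 = 0) := by
      clear d0 d1 d2 d3 d4 d5 c1 c2 c3 g1 g2 g3 a1 hr p1 p2 p3
      omega
    rcases this with k | k
    · linarith only [k.1, k.2, d4, g1, h3, c2, c3, y11, y12, y13, y14]
    · linarith only [k.1, k.2, d5, g1, h3, c2, c3, y11, y12, y13, y14]
  · have h79 : 1 ≤ w 7 9 := le_trans (by norm_num) h3
    by_cases k1 : 1 ≤ w 2 6 ∧ 1 ≤ w 3 8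
    · have : w 7 9 + w 0 1 + w 4 5 + w 2 6 + w 3 8 ≤ r + 2 := pairing_weight_le h.symm H
        ![7, 9, 0, 1, 4, 5, 2, 6, 3, 8] (by decide) h79 p1 p3 k1.1 k1.2
      linarith only [this, a1, g1, g2, g3, h3, k1.1, k1.2]
    by_cases k2 : 1 ≤ w 3 6 ∧ 1 ≤ w 2 8
    · have : w 7 9 + w 0 1 + w 4 5 + w 3 6 + w 2 8 ≤ r + 2 := pairing_weight_le h.symm H
        ![7, 9, 0, 1, 4, 5, 3, 6, 2, 8] (by decide) h79 p1 p3 k2.1 k2.2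
      linarith only [this, a1, g1, g2, g3, h3, k2.1, k2.2]
    have : (w 2 6 = 0 ∧ w 2 8 = 0) ∨ (w 3 6 = 0 ∧ w 3 8 = 0) := by
      clear d0 d1 d2 d3 d4 d5 c1 c2 c3 g1 g2 g3 a1 hr p1 p2 p3
      omega
    rcases this with k | k
    · linarith only [k.1, k.2, d2, g2, h3, c1, c3, y6, y7, y8, y9]
    · linarith only [k.1, k.2, d3, g2, h3, c1, c3, y6, y7, y8, y9]
  · have h89 : 1 ≤ w 8 9 := le_trans (by norm_num) h3
    by_cases k1 : 1 ≤ w 0 6 ∧ 1 ≤ w 1 7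
    · have : w 8 9 + w 2 3 + w 4 5 + w 0 6 + w 1 7 ≤ r + 2 := pairing_weight_le h.symm H
        ![8, 9, 2, 3, 4, 5, 0, 6, 1, 7] (by decide) h89 p2 p3 k1.1 k1.2
      linarith only [this, a1, g1, g2, g3, h3, k1.1, k1.2]
    by_cases k2 : 1 ≤ w 1 6 ∧ 1 ≤ w 0 7
    · have : w 8 9 + w 2 3 + w 4 5 + w 1 6 + w 0 7 ≤ r + 2 := pairing_weight_le h.symm H
        ![8, 9, 2, 3, 4, 5, 1, 6, 0, 7] (by decide) h89 p2 p3 k2.1 k2.2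
      linarith only [this, a1, g1, g2, g3, h3, k2.1, k2.2]
    have : (w 0 6 = 0 ∧ w 0 7 = 0) ∨ (w 1 6 = 0 ∧ w 1 7 = 0) := by
      clear d0 d1 d2 d3 d4 d5 c1 c2 c3 g1 g2 g3 a1 hr p1 p2 p3
      omega
    rcases this with k | k
    · linarith only [k.1, k.2, d0, g3, h3, c1, c2, y1, y2, y3, y4]
    · linarith only [k.1, k.2, d1, g3, h3, c1, c2, y1, y2, y3, y4]

end Configurations

/-! ### Cuts crossed by all edges of a perfect matching -/

section Uncrossing

variable {V : Type*} [Fintype V] [DecidableEq V]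

theorem sum_sum_eq_ite (w : V → V → ℕ) (S T : Finset V) :
    ∑ x ∈ S, ∑ y ∈ T, w x y = ∑ x, ∑ y, if x ∈ S ∧ y ∈ T then w x y else 0 := by
  rw [← Finset.sum_subset (Finset.subset_univ S)]
  · refine Finset.sum_congr rfl fun x hx => ?_
    rw [← Finset.sum_subset (Finset.subset_univ T)]
    · exact Finset.sum_congr rfl fun y hy => by simp [hx, hy]
    · intro y _ hy
      simp [hy]
  · intro x _ hx
    simp [hx]

theorem cutWeight_add_cutWeight (w : V → V → ℕ) (X Y : Finset V) :
    cutWeight w X + cutWeight w Y = cutWeight w (X ∩ Y) + cutWeight w (X ∪ Y) +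
      ∑ x ∈ X \ Y, ∑ y ∈ Y \ X, w x y + ∑ x ∈ Y \ X, ∑ y ∈ X \ Y, w x y := by
  unfold cutWeight
  rw [sum_sum_eq_ite w X Xᶜ, sum_sum_eq_ite w Y Yᶜ, sum_sum_eq_ite w (X ∩ Y) (X ∩ Y)ᶜ,
    sum_sum_eq_ite w (X ∪ Y) (X ∪ Y)ᶜ, sum_sum_eq_ite w (X \ Y) (Y \ X),
    sum_sum_eq_ite w (Y \ X) (X \ Y)]
  rw [← Finset.sum_add_distrib, ← Finset.sum_add_distrib, ← Finset.sum_add_distrib,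
    ← Finset.sum_add_distrib]
  refine Finset.sum_congr rfl fun x _ => ?_
  rw [← Finset.sum_add_distrib, ← Finset.sum_add_distrib, ← Finset.sum_add_distrib,
    ← Finset.sum_add_distrib]
  refine Finset.sum_congr rfl fun y _ => ?_
  simp only [Finset.mem_inter, Finset.mem_union, Finset.mem_sdiff, Finset.mem_compl]
  by_cases h1 : x ∈ X <;> by_cases h2 : x ∈ Y <;> by_cases h3 : y ∈ X <;> by_cases h4 : y ∈ Y <;>
    simp [h1, h2, h3, h4]

/-- Every edge of the perfect matching `m` crosses the cut. -/
def CrossesAll (m : V → V) (Y : Finset V) : Prop := ∀ x, x ∈ Y ↔ m x ∉ Y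

/-- Some edge of `w` crosses both cuts. -/
def CrossedTogether (w : V → V → ℕ) (X Y : Finset V) : Prop :=
  ∃ a d, 1 ≤ w a d ∧ (a ∈ X ↔ d ∉ X) ∧ (a ∈ Y ↔ d ∉ Y)

omit [Fintype V] [DecidableEq V] in
theorem CrossedTogether.symm {w : V → V → ℕ} {X Y : Finset V} (h : CrossedTogether w X Y) :
    CrossedTogether w Y X := by
  obtain ⟨a, d, h1, h2, h3⟩ := h
  exact ⟨a, d, h1, h3, h2⟩

theorem CrossedTogether.compl_left {w : V → V → ℕ} {X Y : Finset V}
    (h : CrossedTogether w X Y) : CrossedTogether w Xᶜ Y := by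
  obtain ⟨a, d, h1, h2, h3⟩ := h
  refine ⟨a, d, h1, ?_, h3⟩
  simp only [Finset.mem_compl]
  tauto

theorem CrossedTogether.one_le_sum {w : V → V → ℕ} (hw : ∀ x y, w x y = w y x) {X Y : Finset V}
    {A B C D : Finset V} (h : CrossedTogether w X Y) (hA : X ∩ Y = A) (hB : (X ∪ Y)ᶜ = B)
    (hC : X \ Y = C) (hD : Y \ X = D) :
    1 ≤ ∑ a ∈ A, ∑ d ∈ B, w a d + ∑ a ∈ C, ∑ d ∈ D, w a d := by
  subst hA hB hC hD
  obtain ⟨a, d, h1, h2, h3⟩ := h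
  wlog ha : a ∈ X generalizing a d
  · exact this d a (by rwa [hw]) (by tauto) (by tauto) (by tauto)
  have hd : d ∉ X := h2.1 ha
  have key : ∀ S T : Finset V, a ∈ S → d ∈ T → 1 ≤ ∑ x ∈ S, ∑ y ∈ T, w x y := by
    intro S T hS hT
    refine h1.trans ((Finset.single_le_sum (f := fun y => w a y) (fun _ _ => Nat.zero_le _) hT).trans
      (Finset.single_le_sum (f := fun x => ∑ y ∈ T, w x y) (fun _ _ => Nat.zero_le _) hS))
  by_cases haY : a ∈ Y
  · have := key (X ∩ Y) (X ∪ Y)ᶜ (by simp [ha, haY]) (by simp [hd, h3.1 haY])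
    omega
  · have hdY : d ∈ Y := by tauto
    have := key (X \ Y) (Y \ X) (by simp [ha, haY]) (by simp [hd, hdY])
    omega

theorem IsPairing.crossesAll {m : V → V} (hm : IsPairing m) {X : Finset V}
    (hc : Xᶜ.card ≤ X.card) (h : ∀ x ∈ X, m x ∉ X) : CrossesAll m X := by
  have h1 : cutWeight (pairingWeight m) X = X.card := by
    rw [IsPairing.cutWeight_eq, Finset.filter_true_of_mem h]
  rw [← hm.isRegularWeight.cut_compl, IsPairing.cutWeight_eq] at h1
  have h2 : (Xᶜ.filter fun x => m x ∉ Xᶜ) = Xᶜ :=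
    Finset.eq_of_subset_of_card_le (Finset.filter_subset _ _) (h1 ▸ hc)
  intro x
  refine ⟨h x, fun hx => ?_⟩
  by_contra hxX
  have : x ∈ Xᶜ.filter fun x => m x ∉ Xᶜ := by
    rw [h2]
    simpa using hxX
  simp [hx] at this

theorem IsPairing.sum_le_cutWeight {w : V → V → ℕ} {m : V → V} {X : Finset V}
    (h : ∀ x ∈ X, m x ∉ X) : ∑ x ∈ X, w x (m x) ≤ cutWeight w X :=
  Finset.sum_le_sum fun x hx => Finset.single_le_sum (f := fun y => w x y)
    (fun _ _ => Nat.zero_le _) (Finset.mem_compl.2 (h x hx))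

/-- By parity a perfect matching has an edge across the odd set `X`, and that edge also crosses `Y`.
-/
theorem IsPairing.crossedTogether {w : V → V → ℕ} {m : V → V} (hm : IsPairing m)
    (hs : ∀ x, 1 ≤ w x (m x)) {X Y : Finset V} (hX : Odd X.card) (hY : CrossesAll m Y) :
    CrossedTogether w X Y := by
  have h1 := (hm.odd_cutWeight hX).pos
  rw [IsPairing.cutWeight_eq, Finset.card_pos] at h1
  obtain ⟨x, hx⟩ := h1
  rw [Finset.mem_filter] at hx
  exact ⟨x, m x, hs x, by tauto, hY x⟩

/-- The intersection and the complement of the union are single vertices, with cuts of weight `r`.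
Uncrossing therefore leaves only weight two between `X \ Y` and `Y \ X`. But if all edges of `m`
crossed `Y`, at least three of the four vertices of `Y \ X` would be matched into `X \ Y`, as only
one vertex lies outside the union. -/
theorem not_crossesAll_of_card_inter_eq_one {r : ℕ} {w : V → V → ℕ} (h : IsRegularWeight r w)
    (hV : Fintype.card V = 10) {m : V → V} (hm : IsPairing m) (hs : ∀ x, 1 ≤ w x (m x))
    {X Y : Finset V} (hX : X.card = 5) (hY : Y.card = 5) (hcX : cutWeight w X = r + 2)
    (hcY : cutWeight w Y = r + 2) (hXY : (X ∩ Y).card = 1) : ¬ CrossesAll m Y := by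
  intro hc
  have h1 := cutWeight_add_cutWeight w X Y
  have h2 := Finset.card_union_add_card_inter X Y
  have h3 := Finset.card_add_card_compl (X ∪ Y)
  have h4 : (X ∪ Y)ᶜ.card = 1 := by omega
  rw [h.cut_of_card_eq_one hXY, h.cut_of_card_compl_eq_one h4, hcX, hcY] at h1
  have h5 : ∑ x ∈ X \ Y, ∑ y ∈ Y \ X, w x y = ∑ x ∈ Y \ X, ∑ y ∈ X \ Y, w x y := by
    rw [Finset.sum_comm]
    exact Finset.sum_congr rfl fun x _ => Finset.sum_congr rfl fun y _ => h.symm y x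
  have h6 : (Y \ X).card = 4 := by
    have := Finset.card_sdiff_add_card_inter Y X
    rw [Finset.inter_comm] at this
    omega
  have h7 : ((Y \ X).filter fun y => m y ∈ X \ Y).card ≤ ∑ x ∈ Y \ X, ∑ y ∈ X \ Y, w x y := by
    rw [Finset.card_filter]
    refine Finset.sum_le_sum fun x _ => ?_
    split_ifs with hx
    · exact (hs x).trans (Finset.single_le_sum (f := fun y => w x y)
        (fun _ _ => Nat.zero_le _) hx)
    · exact Nat.zero_le _
  have h8 : ((Y \ X).filter fun y => ¬ m y ∈ X \ Y).card ≤ 1 := by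
    rw [← h4]
    refine Finset.card_le_card_of_injOn m ?_ ?_
    · intro y hy
      simp only [Finset.coe_filter, Finset.mem_sdiff, Set.mem_ofPred_eq] at hy
      have := (hc y).1 hy.1.1
      simp only [Finset.coe_compl, Set.mem_compl_iff, Finset.mem_coe, Finset.mem_union]
      tauto
    · intro x _ y _ hxy
      rw [← hm.invol x, hxy, hm.invol]
  have h9 := Finset.card_filter_add_card_filter_not (s := Y \ X) (fun y => m y ∈ X \ Y)
  omega

/-- Intersections of size one are excluded above, and those of size four by passing to the
complement of `X`. Size zero or five would make `Y` equal to `Xᶜ` or `X`, although some edge of `m`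
does not cross `X`. -/
theorem card_inter_of_crossesAll {r : ℕ} {w : V → V → ℕ} (h : IsRegularWeight r w)
    (hV : Fintype.card V = 10) {m : V → V} (hm : IsPairing m) (hs : ∀ x, 1 ≤ w x (m x))
    {X Y : Finset V} (hX : X.card = 5) (hY : Y.card = 5) (hcX : cutWeight w X = r + 2)
    (hcY : cutWeight w Y = r + 2) (hc : CrossesAll m Y) (hne : ∃ x, x ∈ X ↔ m x ∈ X) :
    (X ∩ Y).card = 2 ∨ (X ∩ Y).card = 3 := by
  obtain ⟨x, hx⟩ := hne
  have hX' := Finset.card_add_card_compl X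
  have h1 : (X ∩ Y).card ≠ 1 := fun h1 =>
    not_crossesAll_of_card_inter_eq_one h hV hm hs hX hY hcX hcY h1 hc
  have hsplit : (X ∩ Y).card + (Xᶜ ∩ Y).card = 5 := by
    rw [← hY, ← Finset.card_sdiff_add_card_inter Y X, Finset.inter_comm Y X,
      Finset.sdiff_eq_inter_compl, Finset.inter_comm Y Xᶜ, add_comm]
  have h4 : (X ∩ Y).card ≠ 4 := fun h4 =>
    not_crossesAll_of_card_inter_eq_one h hV hm hs (X := Xᶜ) (by omega) hY
      (by rw [h.cut_compl, hcX]) hcY (by omega) hc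
  have h5 : (X ∩ Y).card ≠ 5 := by
    intro h5
    have e1 : X ∩ Y = X := Finset.eq_of_subset_of_card_le Finset.inter_subset_left (by omega)
    have e2 : X ∩ Y = Y := Finset.eq_of_subset_of_card_le Finset.inter_subset_right (by omega)
    rw [e1] at e2
    subst e2
    have := hc x
    tauto
  have h0 : (X ∩ Y).card ≠ 0 := by
    intro h5
    have e1 : Xᶜ ∩ Y = Xᶜ := Finset.eq_of_subset_of_card_le Finset.inter_subset_left (by omega)
    have e2 : Xᶜ ∩ Y = Y := Finset.eq_of_subset_of_card_le Finset.inter_subset_right (by omega)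
    rw [e1] at e2
    subst e2
    have := hc x
    simp only [Finset.mem_compl] at this
    tauto
  omega

end Uncrossing

/-! ### Relabelling three sets by their intersection numbers -/

section Labelling

variable {V : Type*} [Fintype V] [DecidableEq V]

/-- The part of the vertex set containing `x` in the partition induced by three sets. -/
def signature (X Y Z : Finset V) (x : V) : Bool × Bool × Bool :=
  (decide (x ∈ X), decide (x ∈ Y), decide (x ∈ Z))

theorem card_eq_sum_signature (X Y Z S : Finset V) (F : Bool × Bool × Bool → Bool)
    (hF : ∀ x, x ∈ S ↔ F (signature X Y Z x) = true) :
    S.card = ∑ c, if F c = true then (Finset.univ.filter fun x => signature X Y Z x = c).card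
      else 0 := by
  have h1 : S = Finset.univ.filter fun x => F (signature X Y Z x) = true := by
    ext x
    simp [hF]
  rw [h1, Finset.card_filter, ← Finset.sum_fiberwise _ (signature X Y Z)]
  refine Finset.sum_congr rfl fun c _ => ?_
  rw [Finset.sum_congr rfl fun x hx => by rw [(Finset.mem_filter.1 hx).2]]
  split_ifs <;> simp

/-- Two triples of sets with the same cardinalities of all intersections differ by a relabelling. -/
theorem exists_equiv_of_card_inter_eq {V' : Type*} [Fintype V'] [DecidableEq V']
    (hV : Fintype.card V' = Fintype.card V) {X Y Z : Finset V} {X' Y' Z' : Finset V'}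
    (hX : X'.card = X.card) (hY : Y'.card = Y.card) (hZ : Z'.card = Z.card)
    (hXY : (X' ∩ Y').card = (X ∩ Y).card) (hXZ : (X' ∩ Z').card = (X ∩ Z).card)
    (hYZ : (Y' ∩ Z').card = (Y ∩ Z).card) (hXYZ : (X' ∩ Y' ∩ Z').card = (X ∩ Y ∩ Z).card) :
    ∃ e : V' ≃ V, X'.map e.toEmbedding = X ∧ Y'.map e.toEmbedding = Y ∧
      Z'.map e.toEmbedding = Z := by
  obtain ⟨e, he⟩ : ∃ e : V' ≃ V, ∀ x, signature X Y Z (e x) = signature X' Y' Z' x := by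
    apply exists_equiv_of_card_fiber_eq
    rw [card_eq_sum_signature X Y Z X (fun c => c.1) (by simp [signature]),
      card_eq_sum_signature X' Y' Z' X' (fun c => c.1) (by simp [signature])] at hX
    rw [card_eq_sum_signature X Y Z Y (fun c => c.2.1) (by simp [signature]),
      card_eq_sum_signature X' Y' Z' Y' (fun c => c.2.1) (by simp [signature])] at hY
    rw [card_eq_sum_signature X Y Z Z (fun c => c.2.2) (by simp [signature]),
      card_eq_sum_signature X' Y' Z' Z' (fun c => c.2.2) (by simp [signature])] at hZ
    rw [card_eq_sum_signature X Y Z (X ∩ Y) (fun c => c.1 && c.2.1) (by simp [signature]),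
      card_eq_sum_signature X' Y' Z' (X' ∩ Y') (fun c => c.1 && c.2.1) (by simp [signature])] at hXY
    rw [card_eq_sum_signature X Y Z (X ∩ Z) (fun c => c.1 && c.2.2) (by simp [signature]),
      card_eq_sum_signature X' Y' Z' (X' ∩ Z') (fun c => c.1 && c.2.2) (by simp [signature])] at hXZ
    rw [card_eq_sum_signature X Y Z (Y ∩ Z) (fun c => c.2.1 && c.2.2) (by simp [signature]),
      card_eq_sum_signature X' Y' Z' (Y' ∩ Z') (fun c => c.2.1 && c.2.2)
        (by simp [signature])] at hYZ
    rw [card_eq_sum_signature X Y Z (X ∩ Y ∩ Z) (fun c => c.1 && c.2.1 && c.2.2)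
        (by simp [signature, and_assoc]),
      card_eq_sum_signature X' Y' Z' (X' ∩ Y' ∩ Z') (fun c => c.1 && c.2.1 && c.2.2)
        (by simp [signature, and_assoc])] at hXYZ
    rw [← Finset.card_univ, ← Finset.card_univ,
      card_eq_sum_signature X Y Z Finset.univ (fun _ => true) (by simp),
      card_eq_sum_signature X' Y' Z' Finset.univ (fun _ => true) (by simp)] at hV
    generalize (fun c => (Finset.univ.filter fun x => signature X Y Z x = c).card) = n at *
    -- The sizes of the eight cells are determined by the eight given cardinalities, by inclusion
    -- and exclusion.
    simp only [Fintype.sum_prod_type, Fintype.sum_bool, Bool.and_true, Bool.and_false,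
      if_true, Bool.false_eq_true, if_false] at *
    rintro ⟨_ | _, _ | _, _ | _⟩ <;> omega
  have key : ∀ x, (e x ∈ X ↔ x ∈ X') ∧ (e x ∈ Y ↔ x ∈ Y') ∧ (e x ∈ Z ↔ x ∈ Z') := by
    intro x
    have := he x
    simpa only [signature, Prod.mk.injEq, decide_eq_decide] using this
  have key' : ∀ (S : Finset V) (S' : Finset V'), (∀ x, e x ∈ S ↔ x ∈ S') →
      S'.map e.toEmbedding = S := by
    intro S S' hS
    ext x
    rw [Finset.mem_map_equiv, ← hS, Equiv.apply_symm_apply]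
  exact ⟨e, key' _ _ fun x => (key x).1, key' _ _ fun x => (key x).2.1,
    key' _ _ fun x => (key x).2.2⟩

end Labelling

/-! ### A removable perfect matching exists for `r ≥ 4` -/

section GoodPairing

theorem CrossedTogether.comp {V V' : Type*} [Fintype V] [DecidableEq V] [Fintype V']
    [DecidableEq V'] {w : V → V → ℕ} {e : V' ≃ V} {X Y : Finset V'}
    (h : CrossedTogether w (X.map e.toEmbedding) (Y.map e.toEmbedding)) :
    CrossedTogether (fun x y => w (e x) (e y)) X Y := by
  obtain ⟨a, d, h1, h2, h3⟩ := h
  simp only [Finset.mem_map_equiv] at h2 h3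
  exact ⟨e.symm a, e.symm d, by simpa using h1, h2, h3⟩

theorem pairing_bound_comp {V V' : Type*} [Fintype V] [Fintype V'] {b : ℕ} {w : V → V → ℕ}
    (H : ∀ m, IsPairing m → (∀ x, 1 ≤ w x (m x)) → ∑ x, w x (m x) ≤ b) (e : V' ≃ V) :
    ∀ m, IsPairing m → (∀ x, 1 ≤ w (e x) (e (m x))) → ∑ x, w (e x) (e (m x)) ≤ b := by
  intro m hm hs
  have := H _ (hm.conj e) fun x => by simpa using hs (e.symm x)
  rw [← Equiv.sum_comp e] at this
  simpa using this

/-- The situation of three pairwise crossing cuts of weight `r + 2`. -/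
structure IsCutTriple (r : ℕ) (w : Fin 10 → Fin 10 → ℕ) (X Y Z : Finset (Fin 10)) : Prop where
  card_X : X.card = 5
  card_Y : Y.card = 5
  card_Z : Z.card = 5
  cut_X : cutWeight w X = r + 2
  cut_Y : cutWeight w Y = r + 2
  cut_Z : cutWeight w Z = r + 2
  cXY : CrossedTogether w X Y
  cXZ : CrossedTogether w X Z
  cYZ : CrossedTogether w Y Z

theorem card_compl_inter_fin_ten {X : Finset (Fin 10)} (Y : Finset (Fin 10)) :
    (X ∩ Y).card + (Xᶜ ∩ Y).card = Y.card := by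
  rw [← Finset.card_sdiff_add_card_inter Y X, Finset.inter_comm Y X,
    Finset.sdiff_eq_inter_compl, Finset.inter_comm Y Xᶜ, add_comm]

theorem IsCutTriple.compl_left {r : ℕ} {w : Fin 10 → Fin 10 → ℕ} (h : IsRegularWeight r w)
    {X Y Z : Finset (Fin 10)} (t : IsCutTriple r w X Y Z) : IsCutTriple r w Xᶜ Y Z where
  card_X := by
    have := Finset.card_add_card_compl X
    rw [t.card_X, Fintype.card_fin] at this
    omega
  card_Y := t.card_Y
  card_Z := t.card_Z
  cut_X := by rw [h.cut_compl, t.cut_X]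
  cut_Y := t.cut_Y
  cut_Z := t.cut_Z
  cXY := t.cXY.compl_left
  cXZ := t.cXZ.compl_left
  cYZ := t.cYZ

theorem IsCutTriple.rotate {r : ℕ} {w : Fin 10 → Fin 10 → ℕ}
    {X Y Z : Finset (Fin 10)} (t : IsCutTriple r w X Y Z) : IsCutTriple r w Y Z X where
  card_X := t.card_Y
  card_Y := t.card_Z
  card_Z := t.card_X
  cut_X := t.cut_Y
  cut_Y := t.cut_Z
  cut_Z := t.cut_X
  cXY := t.cYZ
  cXZ := t.cXY.symm
  cYZ := t.cXZ.symm

theorem IsCutTriple.comp {r : ℕ} {w : Fin 10 → Fin 10 → ℕ} {X Y Z X' Y' Z' : Finset (Fin 10)}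
    (t : IsCutTriple r w X Y Z) {e : Fin 10 ≃ Fin 10} (hX : X'.map e.toEmbedding = X)
    (hY : Y'.map e.toEmbedding = Y) (hZ : Z'.map e.toEmbedding = Z) :
    IsCutTriple r (fun x y => w (e x) (e y)) X' Y' Z' := by
  subst hX hY hZ
  exact ⟨by simpa using t.card_X, by simpa using t.card_Y, by simpa using t.card_Z,
    by simpa only [cutWeight_comp] using t.cut_X, by simpa only [cutWeight_comp] using t.cut_Y,
    by simpa only [cutWeight_comp] using t.cut_Z, t.cXY.comp, t.cXZ.comp, t.cYZ.comp⟩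

theorem IsCutTriple.false_of_normalized {r : ℕ} (hr : 4 ≤ r) {w : Fin 10 → Fin 10 → ℕ}
    (h : IsRegularWeight r w) (ht : NoTightCut r w)
    (H : ∀ m, IsPairing m → (∀ x, 1 ≤ w x (m x)) → ∑ x, w x (m x) ≤ 2 * (r + 2))
    {X Y Z : Finset (Fin 10)} (t : IsCutTriple r w X Y Z) (hXY : (X ∩ Y).card = 2)
    (hXZ : (X ∩ Z).card = 2)
    (hYZ : ((Y ∩ Z).card = 2 ∧ (X ∩ Y ∩ Z).card = 0) ∨
      ((Y ∩ Z).card = 3 ∧ ((X ∩ Y ∩ Z).card = 0 ∨ (X ∩ Y ∩ Z).card = 1))) : False := by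
  have hX := t.card_X
  have hY := t.card_Y
  have hZ := t.card_Z
  rcases hYZ with ⟨hYZ, hk⟩ | ⟨hYZ, hk | hk⟩
  · obtain ⟨e, eX, eY, eZ⟩ := exists_equiv_of_card_inter_eq (V' := Fin 10) rfl
      (X := X) (Y := Y) (Z := Z)
      (X' := {0, 1, 2, 3, 6}) (Y' := {0, 1, 4, 5, 7}) (Z' := {2, 3, 4, 5, 8})
      (by rw [hX]; rfl) (by rw [hY]; rfl) (by rw [hZ]; rfl) (by rw [hXY]; rfl)
      (by rw [hXZ]; rfl) (by rw [hYZ]; rfl) (by rw [hk]; rfl)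
    have t' := t.comp eX eY eZ
    have h' := h.comp e
    refine false_of_card_inter_two_two_two hr h' (ht.comp e) (pairing_bound_comp H e)
      t'.cut_X t'.cut_Y t'.cut_Z ?_ ?_ ?_
    · exact t'.cXY.one_le_sum h'.symm (by decide) (by decide) (by decide) (by decide)
    · exact t'.cXZ.one_le_sum h'.symm (by decide) (by decide) (by decide) (by decide)
    · exact t'.cYZ.one_le_sum h'.symm (by decide) (by decide) (by decide) (by decide)
  · obtain ⟨e, eX, eY, eZ⟩ := exists_equiv_of_card_inter_eq (V' := Fin 10) rfl
      (X := X) (Y := Y) (Z := Z)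
      (X' := {0, 1, 2, 3, 7}) (Y' := {0, 1, 4, 5, 6}) (Z' := {2, 3, 4, 5, 6})
      (by rw [hX]; rfl) (by rw [hY]; rfl) (by rw [hZ]; rfl) (by rw [hXY]; rfl)
      (by rw [hXZ]; rfl) (by rw [hYZ]; rfl) (by rw [hk]; rfl)
    have t' := t.comp eX eY eZ
    exact false_of_card_inter_two_two_three (h.comp e) (ht.comp e) t'.cut_X t'.cut_Y t'.cut_Z
  · obtain ⟨e, eX, eY, eZ⟩ := exists_equiv_of_card_inter_eq (V' := Fin 10) rfl
      (X := X) (Y := Y) (Z := Z)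
      (X' := {0, 1, 2, 5, 6}) (Y' := {0, 1, 3, 4, 7}) (Z' := {0, 2, 3, 4, 8})
      (by rw [hX]; rfl) (by rw [hY]; rfl) (by rw [hZ]; rfl) (by rw [hXY]; rfl)
      (by rw [hXZ]; rfl) (by rw [hYZ]; rfl) (by rw [hk]; rfl)
    have t' := t.comp eX eY eZ
    have h' := h.comp e
    refine false_of_card_inter_two_two_three_of_common hr h' (ht.comp e) (pairing_bound_comp H e)
      t'.cut_X t'.cut_Y t'.cut_Z ?_ ?_ ?_
    · exact t'.cXY.one_le_sum h'.symm (by decide) (by decide) (by decide) (by decide)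
    · exact t'.cXZ.one_le_sum h'.symm (by decide) (by decide) (by decide) (by decide)
    · exact t'.cYZ.one_le_sum h'.symm (by decide) (by decide) (by decide) (by decide)

theorem card_inter_inter_compl (X Y Z : Finset (Fin 10)) :
    (Xᶜ ∩ Yᶜ ∩ Zᶜ).card + X.card + Y.card + Z.card + (X ∩ Y ∩ Z).card =
      10 + (X ∩ Y).card + (X ∩ Z).card + (Y ∩ Z).card := by
  have h1 : Xᶜ ∩ Yᶜ ∩ Zᶜ = (X ∪ Y ∪ Z)ᶜ := by
    simp only [Finset.compl_union]
  have h2 := Finset.card_add_card_compl (X ∪ Y ∪ Z)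
  have h3 := Finset.card_union_add_card_inter (X ∪ Y) Z
  have h4 := Finset.card_union_add_card_inter X Y
  have h5 := Finset.card_union_add_card_inter (X ∩ Z) (Y ∩ Z)
  have h6 : (X ∪ Y) ∩ Z = X ∩ Z ∪ Y ∩ Z := Finset.union_inter_distrib_right X Y Z
  have h7 : X ∩ Z ∩ (Y ∩ Z) = X ∩ Y ∩ Z := by
    ext x
    simp only [Finset.mem_inter]
    tauto
  rw [h7] at h5
  rw [h6] at h3
  rw [Fintype.card_fin] at h2
  rw [h1]
  omega

/-- A cut has the same weight as its complementary cut, so each set may be replaced by its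
complement. Replacing `Y` and `Z` where needed makes both intersections with `X` have size two,
after which only three configurations are essentially different. -/
theorem IsCutTriple.false {r : ℕ} (hr : 4 ≤ r) {w : Fin 10 → Fin 10 → ℕ}
    (h : IsRegularWeight r w) (ht : NoTightCut r w)
    (H : ∀ m, IsPairing m → (∀ x, 1 ≤ w x (m x)) → ∑ x, w x (m x) ≤ 2 * (r + 2))
    {X Y Z : Finset (Fin 10)} (t : IsCutTriple r w X Y Z)
    (hXY : (X ∩ Y).card = 2 ∨ (X ∩ Y).card = 3) (hXZ : (X ∩ Z).card = 2 ∨ (X ∩ Z).card = 3)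
    (hYZ : (Y ∩ Z).card = 2 ∨ (Y ∩ Z).card = 3) : False := by
  wlog h2 : (X ∩ Y).card = 2 generalizing Y
  · have e1 := card_compl_inter_fin_ten (X := Y) X
    have e2 := card_compl_inter_fin_ten (X := Y) Z
    have h5 := t.card_X
    have h6 := t.card_Z
    rw [Finset.inter_comm] at e1
    rw [Finset.inter_comm Yᶜ X] at e1
    have e3 := (t.rotate.compl_left h).rotate.rotate
    refine this (Y := Yᶜ) ?_ ?_ ?_ ?_ <;> first | exact e3 | omega
  wlog h3 : (X ∩ Z).card = 2 generalizing Z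
  · have e1 := card_compl_inter_fin_ten (X := Z) X
    have e2 := card_compl_inter_fin_ten (X := Z) Y
    have h5 := t.card_X
    have h6 := t.card_Y
    rw [Finset.inter_comm] at e1 e2
    rw [Finset.inter_comm Zᶜ X] at e1
    rw [Finset.inter_comm Zᶜ Y] at e2
    have e3 := (t.rotate.rotate.compl_left h).rotate
    refine this (Z := Zᶜ) ?_ ?_ ?_ ?_ <;> first | exact e3 | omega
  have hk := card_inter_inter_compl X Y Z
  have hX := t.card_X
  have hY := t.card_Y
  have hZ := t.card_Z
  have hc : ∀ S T : Finset (Fin 10), S.card = 5 → T.card = 5 → (Sᶜ ∩ Tᶜ).card = (S ∩ T).card := by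
    intro S T hS hT
    have e1 := card_compl_inter_fin_ten (X := S) T
    have e2 := card_compl_inter_fin_ten (X := T) Sᶜ
    rw [Finset.inter_comm T, Finset.inter_comm Tᶜ] at e2
    have e3 := Finset.card_add_card_compl S
    rw [Fintype.card_fin] at e3
    omega
  by_cases hn : ((Y ∩ Z).card = 2 ∧ (X ∩ Y ∩ Z).card = 0) ∨
      ((Y ∩ Z).card = 3 ∧ ((X ∩ Y ∩ Z).card = 0 ∨ (X ∩ Y ∩ Z).card = 1))
  · exact t.false_of_normalized hr h ht H h2 h3 hn
  · refine ((((t.compl_left h).rotate.compl_left h).rotate.compl_left h).rotate).false_of_normalized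
      hr h ht H ?_ ?_ ?_
    · rw [hc X Y hX hY, h2]
    · rw [hc X Z hX hZ, h3]
    · rw [hc Y Z hY hZ]
      omega

/-- If two cuts of weight `r + 2` cross, then some edge crosses neither of them. -/
theorem exists_edge_of_crossing {r : ℕ} (hr : 2 ≤ r) {w : Fin 10 → Fin 10 → ℕ}
    (h : IsRegularWeight r w) (ht : NoTightCut r w) {X Y : Finset (Fin 10)} (hX : X.card = 5)
    (hY : Y.card = 5) (hcX : cutWeight w X = r + 2) (hcY : cutWeight w Y = r + 2)
    (hc : CrossedTogether w X Y) (hXY : (X ∩ Y).card = 2 ∨ (X ∩ Y).card = 3) :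
    ∃ a b, 1 ≤ w a b ∧ (a ∈ X ↔ b ∈ X) ∧ (a ∈ Y ↔ b ∈ Y) := by
  wlog h2 : (X ∩ Y).card = 2 generalizing X
  · have e1 := card_compl_inter_fin_ten (X := X) Y
    have e2 := Finset.card_add_card_compl X
    rw [Fintype.card_fin] at e2
    obtain ⟨a, b, h1, h2, h3⟩ := this (X := Xᶜ) (by omega) (by rw [h.cut_compl, hcX])
      hc.compl_left (by omega) (by omega)
    refine ⟨a, b, h1, ?_, h3⟩
    simp only [Finset.mem_compl] at h2
    tauto
  obtain ⟨e, rfl, rfl, -⟩ := exists_equiv_of_card_inter_eq (V' := Fin 10) rfl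
      (X := X) (Y := Y) (Z := ∅)
      (X' := {0, 1, 2, 3, 4}) (Y' := {0, 1, 5, 6, 7}) (Z' := ∅)
      (by rw [hX]; rfl) (by rw [hY]; rfl) rfl (by rw [h2]; rfl)
      (by simp) (by simp) (by simp)
  have h' := h.comp e
  rw [← cutWeight_comp] at hcX hcY
  obtain ⟨⟨z1, z2, z3, z4⟩, -, hw⟩ := (ht.comp e).crossing_fin_ten h' hcX hcY
  have hs' : 1 ≤ ∑ a ∈ {0, 1}, ∑ d ∈ {8, 9}, w (e a) (e d) +
      ∑ a ∈ {2, 3, 4}, ∑ d ∈ {5, 6, 7}, w (e a) (e d) :=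
    hc.comp.one_le_sum h'.symm (by decide) (by decide) (by decide) (by decide)
  simp [z1, z2, z3, z4] at hs'
  -- By `hs'` and `hw` these two weights add up to at least `r - 1`. The pairs lie inside the
  -- intersection and outside the union, so they cross neither cut.
  have : 1 ≤ w (e 0) (e 1) ∨ 1 ≤ w (e 8) (e 9) := by omega
  rcases this with h1 | h1
  · exact ⟨e 0, e 1, h1, by simp, by simp⟩
  · exact ⟨e 8, e 9, h1, by simp, by simp⟩

/-- An `r`-graph on ten vertices without tight cuts has a perfect matching that has an edge not
crossing the cut, for each cut of weight `r + 2` with five vertices on both sides. -/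
theorem IsRWeight.exists_good_pairing {r : ℕ} (hr : 4 ≤ r) {w : Fin 10 → Fin 10 → ℕ}
    (h : IsRWeight r w) (ht : NoTightCut r w) :
    ∃ m, IsPairing m ∧ (∀ x, 1 ≤ w x (m x)) ∧
      ∀ X : Finset (Fin 10), X.card = 5 → cutWeight w X = r + 2 → ∃ x ∈ X, m x ∈ X := by
  by_contra hcon
  push Not at hcon
  have hreg := h.toIsRegularWeight
  have hbad : ∀ m, IsPairing m → (∀ x, 1 ≤ w x (m x)) →
      ∃ X : Finset (Fin 10), X.card = 5 ∧ cutWeight w X = r + 2 ∧ CrossesAll m X := by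
    intro m hm hs
    obtain ⟨X, h1, h2, h3⟩ := hcon m hm hs
    have h4 := Finset.card_add_card_compl X
    rw [Fintype.card_fin] at h4
    exact ⟨X, h1, h2, hm.crossesAll (by omega) h3⟩
  -- All edges of an obstructed perfect matching, with their parallel copies, lie in a cut of weight
  -- `r + 2`. The factor two appears because the sum over vertices counts each pair twice.
  have H : ∀ m, IsPairing m → (∀ x, 1 ≤ w x (m x)) → ∑ x, w x (m x) ≤ 2 * (r + 2) := by
    intro m hm hs
    obtain ⟨X, -, h2, h3⟩ := hbad m hm hs
    have h4 : ∑ x ∈ X, w x (m x) ≤ cutWeight w X :=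
      IsPairing.sum_le_cutWeight fun x hx => (h3 x).1 hx
    have h5 : ∑ x ∈ Xᶜ, w x (m x) ≤ cutWeight w Xᶜ :=
      IsPairing.sum_le_cutWeight fun x hx hx' => by
        have := h3 x
        simp only [Finset.mem_compl] at hx hx'
        tauto
    rw [hreg.cut_compl] at h5
    rw [← Finset.sum_add_sum_compl X]
    omega
  obtain ⟨y0, hy0⟩ := hreg.exists_pos (by omega) 0
  obtain ⟨m1, hm1, hs1, -⟩ := h.exists_pairing hy0
  obtain ⟨X, hX, hcX, -⟩ := hbad m1 hm1 hs1
  -- With no edge inside `X`, the cut would have weight `5 * r`. Each further matching is chosen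
  -- through an edge that avoids the cuts found so far, so that its obstructing cut is new.
  have hin : ∃ a ∈ X, ∃ b ∈ X, 1 ≤ w a b := by
    by_contra hc
    push Not at hc
    have h1 := hreg.inner_add_cut X
    rw [Finset.sum_eq_zero fun a ha => Finset.sum_eq_zero fun b hb =>
      Nat.lt_one_iff.1 (hc a ha b hb), hX, hcX] at h1
    omega
  obtain ⟨a, ha, b, hb, hab⟩ := hin
  obtain ⟨m2, hm2, hs2, hab2⟩ := h.exists_pairing hab
  obtain ⟨Y, hY, hcY, hmY⟩ := hbad m2 hm2 hs2
  have hXY := card_inter_of_crossesAll hreg (by simp) hm2 hs2 hX hY hcX hcY hmY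
    ⟨a, by rw [hab2]; tauto⟩
  have hoX : Odd X.card := by rw [hX]; decide
  have hoY : Odd Y.card := by rw [hY]; decide
  have tXY := hm2.crossedTogether hs2 hoX hmY
  obtain ⟨c, d, hcd, hcd1, hcd2⟩ :=
    exists_edge_of_crossing (by omega) hreg ht hX hY hcX hcY tXY hXY
  obtain ⟨m3, hm3, hs3, hcd3⟩ := h.exists_pairing hcd
  obtain ⟨Z, hZ, hcZ, hmZ⟩ := hbad m3 hm3 hs3
  have hXZ := card_inter_of_crossesAll hreg (by simp) hm3 hs3 hX hZ hcX hcZ hmZ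
    ⟨c, by rw [hcd3]; exact hcd1⟩
  have hYZ := card_inter_of_crossesAll hreg (by simp) hm3 hs3 hY hZ hcY hcZ hmZ
    ⟨c, by rw [hcd3]; exact hcd2⟩
  exact IsCutTriple.false hr hreg ht H ⟨hX, hY, hZ, hcX, hcY, hcZ, tXY,
    hm3.crossedTogether hs3 hoX hmZ, hm3.crossedTogether hs3 hoY hmZ⟩ hXY hXZ hYZ

/-- A good pairing can be split off. -/
theorem IsRWeight.exists_sub_of_good {r : ℕ} {w : Fin 10 → Fin 10 → ℕ}
    (h : IsRWeight (r + 1) w) (ht : NoTightCut (r + 1) w) {m : Fin 10 → Fin 10}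
    (hm : IsPairing m) (hs : ∀ x, 1 ≤ w x (m x))
    (hgood : ∀ X : Finset (Fin 10), X.card = 5 → cutWeight w X = r + 1 + 2 → ∃ x ∈ X, m x ∈ X) :
    ∃ w', IsRWeight r w' ∧ ∀ x y, w x y = w' x y + pairingWeight m x y := by
  refine h.exists_sub hm hs fun X hX h3 h3' => ?_
  have e1 := ht X hX h3 h3'
  have e2 := IsPairing.cutWeight_le_card m X
  have e3 := hm.cutWeight_le_card_compl X
  have e4 := Finset.card_add_card_compl X
  rw [Fintype.card_fin] at e4
  -- If a side has three vertices, `m` uses at most three cut edges. With five on each side, `m`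
  -- uses an odd number of them: at most three if the cut weighs `r + 3`, by goodness, and at most
  -- five otherwise, when parity gives weight at least `r + 5`.
  by_cases h5 : X.card = 5
  · obtain ⟨a, ha⟩ := hm.odd_cutWeight hX
    by_cases h6 : cutWeight w X = r + 1 + 2
    · obtain ⟨x, hx, hmx⟩ := hgood X h5 h6
      have h7 : cutWeight (pairingWeight m) X < X.card := by
        rw [IsPairing.cutWeight_eq]
        refine Finset.card_lt_card (Finset.filter_ssubset.2 ⟨x, hx, ?_⟩)
        simpa using hmx
      omega
    · have h8 := h.toIsRegularWeight.even_cut_iff X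
      rw [Nat.even_mul, h5] at h8
      have h9 : ¬ Even 5 := by decide
      have h10 : cutWeight w X ≠ r + 1 + 3 := by
        intro h10
        rw [h10] at h8
        have : Even (r + 1 + 3) ↔ ¬ Even (r + 1) := by
          rw [Nat.even_add]
          have : ¬ Even 3 := by decide
          tauto
        tauto
      omega
  · obtain ⟨a, ha⟩ := hX
    omega

end GoodPairing

/-! ### The Petersen graph as two five-cycles and spokes -/

section PetersenWeight

/-- The disjoint union of the five-cycles on `{0, 1, 2, 3, 4}` and `{5, 6, 7, 8, 9}`. -/
def doubleCycle (x y : Fin 10) : ℕ :=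
  if x.val / 5 = y.val / 5 ∧ ((x.val + 1) % 5 = y.val % 5 ∨ (y.val + 1) % 5 = x.val % 5)
  then 1 else 0

/-- The perfect matching joining the two five-cycles of the Petersen graph. -/
def petersenSpoke : Fin 10 → Fin 10 := ![5, 7, 9, 6, 8, 0, 3, 1, 4, 2]

/-- The adjacency matrix of the Petersen graph. -/
def petersenWeight (x y : Fin 10) : ℕ := doubleCycle x y + pairingWeight petersenSpoke x y

theorem isPairing_petersenSpoke : IsPairing petersenSpoke := ⟨by decide, by decide⟩

theorem isRegularWeight_doubleCycle : IsRegularWeight 2 doubleCycle :=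
  ⟨by decide, by decide, by decide⟩

theorem doubleCycle_closed {S : Finset (Fin 10)} (h : cutWeight doubleCycle S = 0) {x y : Fin 10}
    (hxy : doubleCycle x y = 1) (hx : x ∈ S) : y ∈ S := by
  by_contra hy
  have h1 : doubleCycle x y ≤ cutWeight doubleCycle S :=
    (Finset.single_le_sum (f := fun y => doubleCycle x y) (fun _ _ => Nat.zero_le _)
      (Finset.mem_compl.2 hy)).trans
      (Finset.single_le_sum (f := fun x => ∑ y ∈ Sᶜ, doubleCycle x y) (fun _ _ => Nat.zero_le _) hx)
  omega

theorem eq_of_cutWeight_doubleCycle {S : Finset (Fin 10)} (h : cutWeight doubleCycle S = 0)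
    (hS : Odd S.card) : S = {0, 1, 2, 3, 4} ∨ S = {0, 1, 2, 3, 4}ᶜ := by
  have c := fun x y hxy => doubleCycle_closed h (x := x) (y := y) hxy
  have a0 := c 0 1 (by decide)
  have a1 := c 1 2 (by decide)
  have a2 := c 2 3 (by decide)
  have a3 := c 3 4 (by decide)
  have a4 := c 4 0 (by decide)
  have b0 := c 5 6 (by decide)
  have b1 := c 6 7 (by decide)
  have b2 := c 7 8 (by decide)
  have b3 := c 8 9 (by decide)
  have b4 := c 9 5 (by decide)
  have i1 : (1 : Fin 10) ∈ S ↔ (0 : Fin 10) ∈ S := ⟨fun h => a4 (a3 (a2 (a1 h))), a0⟩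
  have i2 : (2 : Fin 10) ∈ S ↔ (0 : Fin 10) ∈ S := ⟨fun h => a4 (a3 (a2 h)), fun h => a1 (a0 h)⟩
  have i3 : (3 : Fin 10) ∈ S ↔ (0 : Fin 10) ∈ S := ⟨fun h => a4 (a3 h), fun h => a2 (a1 (a0 h))⟩
  have i4 : (4 : Fin 10) ∈ S ↔ (0 : Fin 10) ∈ S := ⟨a4, fun h => a3 (a2 (a1 (a0 h)))⟩
  have i6 : (6 : Fin 10) ∈ S ↔ (5 : Fin 10) ∈ S := ⟨fun h => b4 (b3 (b2 (b1 h))), b0⟩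
  have i7 : (7 : Fin 10) ∈ S ↔ (5 : Fin 10) ∈ S := ⟨fun h => b4 (b3 (b2 h)), fun h => b1 (b0 h)⟩
  have i8 : (8 : Fin 10) ∈ S ↔ (5 : Fin 10) ∈ S := ⟨fun h => b4 (b3 h), fun h => b2 (b1 (b0 h))⟩
  have i9 : (9 : Fin 10) ∈ S ↔ (5 : Fin 10) ∈ S := ⟨b4, fun h => b3 (b2 (b1 (b0 h)))⟩
  have key : ∀ T : Finset (Fin 10), ((0 : Fin 10) ∈ S ↔ (0 : Fin 10) ∈ T) →
      ((5 : Fin 10) ∈ S ↔ (5 : Fin 10) ∈ T) →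
      ((1 : Fin 10) ∈ T ↔ (0 : Fin 10) ∈ T) → ((2 : Fin 10) ∈ T ↔ (0 : Fin 10) ∈ T) →
      ((3 : Fin 10) ∈ T ↔ (0 : Fin 10) ∈ T) → ((4 : Fin 10) ∈ T ↔ (0 : Fin 10) ∈ T) →
      ((6 : Fin 10) ∈ T ↔ (5 : Fin 10) ∈ T) → ((7 : Fin 10) ∈ T ↔ (5 : Fin 10) ∈ T) →
      ((8 : Fin 10) ∈ T ↔ (5 : Fin 10) ∈ T) → ((9 : Fin 10) ∈ T ↔ (5 : Fin 10) ∈ T) →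
      S = T := by
    intro T t0 t5 t1 t2 t3 t4 t6 t7 t8 t9
    ext x
    fin_cases x
    · exact t0
    · exact i1.trans (t0.trans t1.symm)
    · exact i2.trans (t0.trans t2.symm)
    · exact i3.trans (t0.trans t3.symm)
    · exact i4.trans (t0.trans t4.symm)
    · exact t5
    · exact i6.trans (t5.trans t6.symm)
    · exact i7.trans (t5.trans t7.symm)
    · exact i8.trans (t5.trans t8.symm)
    · exact i9.trans (t5.trans t9.symm)
  clear i1 i2 i3 i4 i6 i7 i8 i9 a0 a1 a2 a3 a4 b0 b1 b2 b3 b4 c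
  by_cases h0 : (0 : Fin 10) ∈ S <;> by_cases h5 : (5 : Fin 10) ∈ S
  · rw [key Finset.univ (by simp [h0]) (by simp [h5]) (by decide) (by decide) (by decide)
      (by decide) (by decide) (by decide) (by decide) (by decide)] at hS
    exact absurd hS (by decide)
  · left
    exact key _ (by simp [h0]) (by simp [h5]) (by decide) (by decide) (by decide)
      (by decide) (by decide) (by decide) (by decide) (by decide)
  · right
    exact key _ (by simp [h0]) (by simp [h5]) (by decide) (by decide) (by decide)
      (by decide) (by decide) (by decide) (by decide) (by decide)
  · rw [key ∅ (by simp [h0]) (by simp [h5]) (by decide) (by decide) (by decide)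
      (by decide) (by decide) (by decide) (by decide) (by decide)] at hS
    exact absurd hS (by decide)

/-- Two disjoint five-cycles, joined by at least three edges of a perfect matching. -/
theorem isRWeight_doubleCycle_add {m : Fin 10 → Fin 10} (hm : IsPairing m)
    (hc : 3 ≤ cutWeight (pairingWeight m) {0, 1, 2, 3, 4}) :
    IsRWeight 3 fun x y => doubleCycle x y + pairingWeight m x y := by
  have h2 := isRegularWeight_doubleCycle
  have h1 := hm.isRegularWeight
  refine ⟨⟨fun x y => by rw [h2.symm x, h1.symm x], fun x => by rw [h2.diag, h1.diag],
    fun x => by rw [Finset.sum_add_distrib, h2.deg, h1.deg]⟩, fun S hS => ?_⟩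
  rw [cutWeight_add]
  obtain ⟨a, ha⟩ := hm.odd_cutWeight hS
  obtain ⟨b, hb⟩ := (h2.even_cut_iff S).2 (by simp)
  -- A cut of the cycles is even, so it is zero or at least two, while an odd cut of `m` is at least
  -- one. If it is zero, `S` is the vertex set of one of the cycles and the hypothesis `hc` applies.
  by_cases h0 : cutWeight doubleCycle S = 0
  · rcases eq_of_cutWeight_doubleCycle h0 hS with rfl | rfl
    · omega
    · rw [h1.cut_compl]
      omega
  · omega

theorem isRWeight_petersenWeight : IsRWeight 3 petersenWeight :=
  isRWeight_doubleCycle_add isPairing_petersenSpoke (by decide)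

theorem petersenWeight_le_one : ∀ x y, petersenWeight x y ≤ 1 := by decide

end PetersenWeight

/-! ### Checks over all perfect matchings of the complete graph on ten vertices -/

section Enumeration

/-- `forallPairings p n l []` checks whether `p` holds for all partitions of the list `l` into `n`
pairs. -/
def forallPairings (p : List (Fin 10 × Fin 10) → Bool) :
    ℕ → List (Fin 10) → List (Fin 10 × Fin 10) → Bool
  | _, [], acc => p acc
  | 0, _ :: _, _ => false
  | n + 1, a :: l, acc => l.all fun b => forallPairings p n (l.erase b) ((a, b) :: acc)

/-- The search visits the pairs of `m` along one of its branches. The identity for all `f` says that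
the pairs in `L` partition `l`, in the form needed to turn sums over vertices into sums over pairs.
-/
theorem exists_of_forallPairings {p : List (Fin 10 × Fin 10) → Bool} {m : Fin 10 → Fin 10}
    (hm : IsPairing m) (n : ℕ) (l : List (Fin 10)) (acc : List (Fin 10 × Fin 10))
    (h : forallPairings p n l acc = true) (hl : l.Nodup) (hml : ∀ x ∈ l, m x ∈ l) :
    ∃ L : List (Fin 10 × Fin 10), p (L ++ acc) = true ∧ (∀ q ∈ L, m q.1 = q.2) ∧
      ∀ f : Fin 10 → ℕ, (l.map f).sum = (L.map fun q => f q.1 + f q.2).sum := by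
  induction n generalizing l acc with
  | zero =>
    cases l with
    | nil => exact ⟨[], by simpa [forallPairings] using h, by simp, by simp⟩
    | cons a l => simp [forallPairings] at h
  | succ n ih =>
    cases l with
    | nil => exact ⟨[], by simpa [forallPairings] using h, by simp, by simp⟩
    | cons a l =>
      simp only [forallPairings, List.all_eq_true] at h
      rw [List.nodup_cons] at hl
      have hma : m a ∈ l := by
        have := hml a List.mem_cons_self
        rw [List.mem_cons] at this
        exact this.resolve_left (hm.ne a)
      have hcl : ∀ x ∈ l.erase (m a), m x ∈ l.erase (m a) := by
        intro x hx
        rw [hl.2.mem_erase_iff] at hx ⊢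
        have := hml x (List.mem_cons_of_mem _ hx.2)
        rw [List.mem_cons] at this
        refine ⟨fun hxa => ?_, this.resolve_left fun hxa => hx.1 ?_⟩
        · have : x = a := by rw [← hm.invol x, hxa, hm.invol]
          exact hl.1 (this ▸ hx.2)
        · rw [← hxa, hm.invol]
      obtain ⟨L, h1, h2, h3⟩ := ih _ _ (h _ hma) (hl.2.erase _) hcl
      refine ⟨L ++ [(a, m a)], by simpa using h1, ?_, fun f => ?_⟩
      · intro q hq
        rw [List.mem_append, List.mem_singleton] at hq
        rcases hq with hq | rfl
        · exact h2 q hq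
        · rfl
      · have h4 := ((List.perm_cons_erase hma).map f).sum_eq
        simp only [List.map_cons, List.sum_cons, List.map_append, List.map_nil, List.sum_nil,
          List.sum_append, ← h3] at h4 ⊢
        omega

theorem exists_of_forallPairings_fin_ten {p : List (Fin 10 × Fin 10) → Bool}
    (h : forallPairings p 5 [0, 1, 2, 3, 4, 5, 6, 7, 8, 9] [] = true) {m : Fin 10 → Fin 10}
    (hm : IsPairing m) :
    ∃ L : List (Fin 10 × Fin 10), p L = true ∧ (∀ q ∈ L, m q.1 = q.2) ∧
      ∀ f : Fin 10 → ℕ, ∑ x, f x = (L.map fun q => f q.1 + f q.2).sum := by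
  obtain ⟨L, h1, h2, h3⟩ := exists_of_forallPairings hm 5 _ [] h (by decide)
    (fun x _ => by generalize m x = y; revert y; decide)
  refine ⟨L, by simpa using h1, h2, fun f => ?_⟩
  rw [← h3, sum_fin_ten]
  simp only [List.map_cons, List.map_nil, List.sum_cons, List.sum_nil]
  omega

theorem sum_congr_of_pairs {L : List (Fin 10 × Fin 10)} {f g : Fin 10 × Fin 10 → ℕ}
    (h : ∀ q ∈ L, f q = g q) : (L.map f).sum = (L.map g).sum := by
  rw [List.map_congr_left h]

/-- The sum identity is applied to the indicator of the vertices at which the claim fails. -/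
theorem petersenWeight_eq_one_of_all {m : Fin 10 → Fin 10} (hm : IsPairing m)
    {L : List (Fin 10 × Fin 10)} (hL : ∀ q ∈ L, m q.1 = q.2)
    (hs : ∀ f : Fin 10 → ℕ, ∑ x, f x = (L.map fun q => f q.1 + f q.2).sum)
    (h : ∀ q ∈ L, petersenWeight q.1 q.2 = 1) (x : Fin 10) : petersenWeight x (m x) = 1 := by
  have h1 := hs fun x => if petersenWeight x (m x) = 1 then 0 else 1
  rw [sum_congr_of_pairs (g := fun _ => 0)] at h1
  · simp only [List.map_const', List.sum_replicate, smul_eq_mul, mul_zero,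
      Finset.sum_eq_zero_iff, Finset.mem_univ, true_implies] at h1
    by_contra hx
    have := h1 x
    simp [hx] at this
  · intro q hq
    have e1 := hL q hq
    have e2 := h q hq
    have e3 : m q.2 = q.1 := by rw [← e1, hm.invol]
    rw [e1, e3, isRWeight_petersenWeight.symm q.2 q.1, e2]
    rfl

/-- Automorphisms of the Petersen graph such that the preimages of `{0, 1, 2, 3, 4}` represent the
six pairs of disjoint five-cycles. -/
def petersenAut : List (Fin 10 → Fin 10) :=
  [![0, 1, 2, 3, 4, 5, 6, 7, 8, 9], ![0, 1, 2, 9, 5, 4, 8, 7, 6, 3],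
    ![0, 1, 7, 8, 4, 5, 9, 2, 3, 6], ![0, 1, 7, 6, 5, 4, 3, 2, 9, 8],
    ![0, 5, 9, 2, 1, 4, 3, 6, 7, 8], ![0, 5, 6, 7, 1, 4, 8, 9, 2, 3]]

theorem petersenAut_spec : ∀ B ∈ petersenAut, Function.Injective B ∧
    ∀ x y, petersenWeight (B x) (B y) = petersenWeight x y := by
  simp only [petersenAut, List.forall_mem_cons, List.not_mem_nil, false_imp_iff, implies_true,
    and_true]
  refine ⟨⟨?_, ?_⟩, ⟨?_, ?_⟩, ⟨?_, ?_⟩, ⟨?_, ?_⟩, ⟨?_, ?_⟩, ⟨?_, ?_⟩⟩ <;> decide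

/-- The six pairs of complementary five-cycles are tested by moving each to the standard pair; two
vertices lie on the same standard cycle when division by `5` gives the same value. -/
theorem forallPairings_crossing : forallPairings (fun L =>
    (L.all fun q => petersenWeight q.1 q.2 == 1) ||
    petersenAut.any fun B =>
      (L.map fun q => if (B q.1).val / 5 = (B q.2).val / 5 then 0 else 1).sum == 3)
    5 [0, 1, 2, 3, 4, 5, 6, 7, 8, 9] [] = true := by
  decide +kernel

/-- A perfect matching of the complete graph on the vertices of the Petersen graph is contained
in the Petersen graph, or three of its edges join two disjoint five-cycles. -/
theorem petersen_pairing_or_crossing {m : Fin 10 → Fin 10} (hm : IsPairing m) :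
    (∀ x, petersenWeight x (m x) = 1) ∨ ∃ e : Fin 10 ≃ Fin 10,
      (∀ x y, petersenWeight (e x) (e y) = petersenWeight x y) ∧
      cutWeight (pairingWeight fun x => e (m (e.symm x))) {0, 1, 2, 3, 4} = 3 := by
  obtain ⟨L, h1, h2, h3⟩ := exists_of_forallPairings_fin_ten forallPairings_crossing hm
  rw [Bool.or_eq_true] at h1
  rcases h1 with h1 | h1
  · left
    refine petersenWeight_eq_one_of_all hm h2 h3 fun q hq => ?_
    rw [List.all_eq_true] at h1
    simpa using h1 q hq
  · right
    rw [List.any_eq_true] at h1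
    obtain ⟨B, hB, h1⟩ := h1
    obtain ⟨hinj, hB⟩ := petersenAut_spec B hB
    refine ⟨Equiv.ofBijective B (Finite.injective_iff_bijective.1 hinj), hB, ?_⟩
    set e := Equiv.ofBijective B (Finite.injective_iff_bijective.1 hinj) with he
    have heB : ∀ x, e x = B x := fun _ => rfl
    have hmem : ∀ x : Fin 10, x ∈ ({0, 1, 2, 3, 4} : Finset (Fin 10)) ↔ x.val / 5 = 0 := by decide
    rw [IsPairing.cutWeight_eq, Finset.card_filter]
    have h4 := h3 fun x => if (B x).val / 5 = 0 ∧ (B (m x)).val / 5 ≠ 0 then 1 else 0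
    have h5 : ∑ x ∈ {0, 1, 2, 3, 4}, (if e (m (e.symm x)) ∉ ({0, 1, 2, 3, 4} : Finset (Fin 10))
        then 1 else 0) = ∑ x, if (B x).val / 5 = 0 ∧ (B (m x)).val / 5 ≠ 0 then 1 else 0 := by
      rw [← Finset.sum_subset (Finset.subset_univ
        (({0, 1, 2, 3, 4} : Finset (Fin 10)).map e.symm.toEmbedding)), Finset.sum_map]
      · refine Finset.sum_congr rfl fun x hx => ?_
        have h6 := (hmem x).1 hx
        simp only [hmem, Equiv.coe_toEmbedding, ← heB, Equiv.apply_symm_apply, h6, true_and, ne_eq]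
      · intro x _ hx
        rw [Finset.mem_map_equiv, Equiv.symm_symm, hmem, heB] at hx
        simp [hx]
    rw [h5, h4]
    rw [beq_iff_eq] at h1
    rw [← h1]
    refine sum_congr_of_pairs fun q hq => ?_
    have e1 := h2 q hq
    have e3 : m q.2 = q.1 := by rw [← e1, hm.invol]
    rw [e1, e3]
    have hlt : ∀ x : Fin 10, x.val / 5 = 0 ∨ x.val / 5 = 1 := by decide
    rcases hlt (B q.1) with k1 | k1 <;> rcases hlt (B q.2) with k2 | k2 <;> simp [k1, k2]

theorem forallPairings_even : forallPairings (fun L =>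
    (L.map fun q => if (q = (1, 2) ∨ q = (3, 4) ∨ q = (7, 8)) ∨
      (q = (2, 1) ∨ q = (4, 3) ∨ q = (8, 7)) then 1 else 0).sum % 2 == 0 ||
      L.any fun q => petersenWeight q.1 q.2 == 0)
    5 [0, 1, 2, 3, 4, 5, 6, 7, 8, 9] [] = true := by
  decide +kernel

/-- Three edges of the Petersen graph such that each perfect matching contains an even number
of them. -/
theorem even_of_petersen_pairing {m : Fin 10 → Fin 10} (hm : IsPairing m)
    (hs : ∀ x, 1 ≤ petersenWeight x (m x)) :
    Even (pairingWeight m 1 2 + pairingWeight m 3 4 + pairingWeight m 7 8) := by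
  obtain ⟨L, h1, h2, h3⟩ := exists_of_forallPairings_fin_ten forallPairings_even hm
  rw [Bool.or_eq_true] at h1
  rcases h1 with h1 | h1
  · rw [beq_iff_eq] at h1
    have h4 := h3 fun x => (if x = 1 ∧ m x = 2 then 1 else 0) + (if x = 3 ∧ m x = 4 then 1 else 0) +
      (if x = 7 ∧ m x = 8 then 1 else 0)
    have h5 : ∑ x, ((if x = 1 ∧ m x = 2 then 1 else 0) + (if x = 3 ∧ m x = 4 then 1 else 0) +
      (if x = 7 ∧ m x = 8 then 1 else 0)) =
        pairingWeight m 1 2 + pairingWeight m 3 4 + pairingWeight m 7 8 := by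
      simp only [Finset.sum_add_distrib, ite_and, Finset.sum_ite_eq', Finset.mem_univ, if_true,
        pairingWeight]
    rw [← h5, h4, Nat.even_iff]
    refine Eq.trans (congrArg (· % 2) (sum_congr_of_pairs fun q hq => ?_)) h1
    have e1 := h2 q hq
    have e3 : m q.2 = q.1 := by rw [← e1, hm.invol]
    rw [e1, e3]
    clear * -
    obtain ⟨a, b⟩ := q
    revert a b
    decide
  · rw [List.any_eq_true] at h1
    obtain ⟨q, hq, h1⟩ := h1
    rw [beq_iff_eq, ← h2 q hq] at h1
    have := hs q.1
    omega

end Enumeration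

/-! ### Adding perfect matchings to the Petersen graph -/

section PetersenSum

theorem Decomposes.comp {V V' : Type*} [Fintype V] [DecidableEq V] [Fintype V'] [DecidableEq V']
    {r : ℕ} {w : V → V → ℕ} (h : Decomposes r w) (e : V' ≃ V) :
    Decomposes r fun x y => w (e x) (e y) := by
  obtain ⟨m, hm, hw⟩ := h
  refine ⟨fun i x => e.symm (m i (e x)), fun i => ?_, fun x y => ?_⟩
  · simpa using (hm i).conj e.symm
  · simp only [hw, pairingWeight, Equiv.symm_apply_eq]

theorem Decomposes.add {V : Type*} [Fintype V] [DecidableEq V] {r s : ℕ} {w w' : V → V → ℕ}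
    (h : Decomposes r w) (h' : Decomposes s w') : Decomposes (r + s) fun x y => w x y + w' x y := by
  obtain ⟨m, hm, hw⟩ := h
  obtain ⟨n, hn, hw'⟩ := h'
  refine ⟨Fin.append m n, fun i => ?_, fun x y => ?_⟩
  · refine Fin.addCases (fun i => ?_) (fun i => ?_) i
    · simpa using hm i
    · simpa using hn i
  · simp [Fin.sum_univ_add, hw, hw']

theorem pairingWeight_conj {V V' : Type*} [DecidableEq V] [DecidableEq V'] (m : V → V) (e : V ≃ V')
    (x y : V) : pairingWeight (fun x => e (m (e.symm x))) (e x) (e y) = pairingWeight m x y := by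
  simp [pairingWeight]

/-- After an automorphism, exactly three edges of `m` join the two five-cycles. The cycles plus `m`
are then a `3`-graph with a tight cut of five vertices on each side, so they split into three
perfect matchings; the spokes are the fourth. -/
theorem decomposes_petersenWeight_add {m : Fin 10 → Fin 10} (hm : IsPairing m)
    (h : ¬ ∀ x, petersenWeight x (m x) = 1) :
    Decomposes 4 fun x y => petersenWeight x y + pairingWeight m x y := by
  obtain ⟨e, he, hc⟩ := (petersen_pairing_or_crossing hm).resolve_left h
  have hm' := hm.conj e
  have h1 : Decomposes 3 fun x y =>
      doubleCycle x y + pairingWeight (fun x => e (m (e.symm x))) x y := by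
    refine (isRWeight_doubleCycle_add hm' hc.ge).decomposes_of_not_noTightCut (by simp) fun ht => ?_
    have h2 := ht {0, 1, 2, 3, 4} (by decide) (by decide) (by decide)
    rw [cutWeight_add, hc] at h2
    have h3 : cutWeight doubleCycle {0, 1, 2, 3, 4} = 0 := by decide
    omega
  have h2 := (h1.add_pairing isPairing_petersenSpoke fun _ _ => rfl).comp e
  convert h2 using 3 with x y
  rw [pairingWeight_conj, ← he]
  unfold petersenWeight
  omega

/-- Count the edges `12`, `34`, `78` modulo two. Each perfect matching of `P` contributes an even
number, but `P` itself contributes three. -/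
theorem not_decomposes_petersenWeight_add {k : ℕ} {n : Fin k → Fin 10 → Fin 10}
    (hn : ∀ i, IsPairing (n i)) (hs : ∀ i x, petersenWeight x (n i x) = 1) :
    ¬ Decomposes (k + 3) fun x y => petersenWeight x y + ∑ i, pairingWeight (n i) x y := by
  rintro ⟨m, hm, hw⟩
  beta_reduce at hw
  -- The total weight is supported on the edges of `P`, so every matching in a decomposition lies in
  -- `P`.
  have hms : ∀ i x, 1 ≤ petersenWeight x (m i x) := by
    intro i x
    have h1 := hw x (m i x)
    have h2 := Finset.single_le_sum (f := fun i' => pairingWeight (m i') x (m i x))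
      (fun _ _ => Nat.zero_le _) (Finset.mem_univ i)
    have h3 : pairingWeight (m i) x (m i x) = 1 := by simp [pairingWeight]
    by_contra hc
    have h4 : ∑ j, pairingWeight (n j) x (m i x) = 0 := by
      refine Finset.sum_eq_zero fun j _ => ?_
      unfold pairingWeight
      rw [if_neg]
      intro h5
      have := hs j x
      rw [h5] at this
      omega
    omega
  have h0 : petersenWeight 1 2 = 1 ∧ petersenWeight 3 4 = 1 ∧ petersenWeight 7 8 = 1 := by decide
  have h1 : Even (∑ i, pairingWeight (m i) 1 2 + ∑ i, pairingWeight (m i) 3 4 +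
      ∑ i, pairingWeight (m i) 7 8) := by
    rw [← Finset.sum_add_distrib, ← Finset.sum_add_distrib]
    exact Finset.even_sum _ fun i _ => even_of_petersen_pairing (hm i) (hms i)
  have h2 : Even (∑ i, pairingWeight (n i) 1 2 + ∑ i, pairingWeight (n i) 3 4 +
      ∑ i, pairingWeight (n i) 7 8) := by
    rw [← Finset.sum_add_distrib, ← Finset.sum_add_distrib]
    exact Finset.even_sum _ fun i _ => even_of_petersen_pairing (hn i) fun x => (hs i x).ge
  rw [← hw, ← hw, ← hw, h0.1, h0.2.1, h0.2.2] at h1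
  obtain ⟨a, ha⟩ := h1
  obtain ⟨b, hb⟩ := h2
  omega

theorem isRWeight_petersenWeight_add {k : ℕ} {n : Fin k → Fin 10 → Fin 10}
    (hn : ∀ i, IsPairing (n i)) :
    IsRWeight (k + 3) fun x y => petersenWeight x y + ∑ i, pairingWeight (n i) x y := by
  induction k with
  | zero => simpa using isRWeight_petersenWeight
  | succ k ih =>
    have h1 := ih fun i => hn i.succ
    have h2 := (hn 0).isRegularWeight
    simp only [Fin.sum_univ_succ]
    refine ⟨⟨fun x y => ?_, fun x => ?_, fun x => ?_⟩, fun X hX => ?_⟩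
    · have := h1.symm x y
      rw [h2.symm x y]
      omega
    · have := h1.diag x
      rw [h2.diag x]
      omega
    · have := h1.deg x
      simp only [Finset.sum_add_distrib, h2.deg] at this ⊢
      omega
    · have h3 := h1.le_cut X hX
      obtain ⟨a, ha⟩ := (hn 0).odd_cutWeight hX
      rw [cutWeight_add] at h3 ⊢
      rw [cutWeight_add]
      omega

end PetersenSum

/-! ### Two five-cycles joined by a perfect matching -/

section CubicCase

/-- The adjacency matrix of the five-cycle. -/
def fiveCycle (i j : Fin 5) : ℕ := if i + 1 = j ∨ j + 1 = i then 1 else 0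

/-- The adjacency matrix with the given entries above the diagonal. -/
def symmTable (b01 b02 b03 b04 b12 b13 b14 b23 b24 b34 : Bool) : Fin 5 → Fin 5 → ℕ :=
  ![![0, b01.toNat, b02.toNat, b03.toNat, b04.toNat],
    ![b01.toNat, 0, b12.toNat, b13.toNat, b14.toNat],
    ![b02.toNat, b12.toNat, 0, b23.toNat, b24.toNat],
    ![b03.toNat, b13.toNat, b23.toNat, 0, b34.toNat],
    ![b04.toNat, b14.toNat, b24.toNat, b34.toNat, 0]]

/-- One cyclic order for each of the twelve five-cycles on five given vertices. -/
def cyclicOrders : List (Fin 5 → Fin 5) :=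
  [![0, 1, 2, 3, 4],
    ![0, 1, 2, 4, 3],
    ![0, 1, 3, 2, 4],
    ![0, 1, 3, 4, 2],
    ![0, 1, 4, 2, 3],
    ![0, 1, 4, 3, 2],
    ![0, 2, 1, 3, 4],
    ![0, 2, 1, 4, 3],
    ![0, 2, 3, 1, 4],
    ![0, 3, 1, 4, 2],
    ![0, 3, 1, 2, 4],
    ![0, 3, 2, 1, 4]]

theorem exists_cyclicOrder_symmTable : ∀ b01 b02 b03 b04 b12 b13 b14 b23 b24 b34 : Bool,
    (∀ i, ∑ j, symmTable b01 b02 b03 b04 b12 b13 b14 b23 b24 b34 i j = 2) →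
      ∃ t ∈ cyclicOrders, ∀ i j, symmTable b01 b02 b03 b04 b12 b13 b14 b23 b24 b34 (t i) (t j) = fiveCycle i j := by
  decide +kernel

/-- A simple `2`-regular graph on five vertices is a five-cycle. Its matrix is given by the ten
entries above the diagonal, which makes the claim a finite check. -/
theorem exists_cyclicOrder {c : Fin 5 → Fin 5 → ℕ} (hs : ∀ i j, c i j = c j i)
    (hd : ∀ i, c i i = 0) (h1 : ∀ i j, c i j ≤ 1) (hr : ∀ i, ∑ j, c i j = 2) :
    ∃ t ∈ cyclicOrders, ∀ i j, c (t i) (t j) = fiveCycle i j := by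
  have hb : ∀ i j, c i j = (decide (c i j = 1)).toNat := by
    intro i j
    have := h1 i j
    by_cases h : c i j = 1
    · simp [h]
    · simp only [h, decide_false, Bool.toNat_false]
      omega
  have hc : c = symmTable (decide (c 0 1 = 1)) (decide (c 0 2 = 1)) (decide (c 0 3 = 1)) (decide (c 0 4 = 1)) (decide (c 1 2 = 1)) (decide (c 1 3 = 1)) (decide (c 1 4 = 1)) (decide (c 2 3 = 1)) (decide (c 2 4 = 1)) (decide (c 3 4 = 1)) := by
    funext i j
    fin_cases i <;> fin_cases j <;>
      first
      | exact hd _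
      | exact hb _ _
      | exact (hs _ _).trans (hb _ _)
  rw [hc] at hr ⊢
  exact exists_cyclicOrder_symmTable _ _ _ _ _ _ _ _ _ _ hr

theorem injective_of_mem_cyclicOrders : ∀ t ∈ cyclicOrders, Function.Injective t := by
  decide +kernel

/-- Two five-cycles, joined by a perfect matching. -/
def joinedCycles (t : Fin 5 → Fin 5) (x y : Fin 10) : ℕ :=
  Fin.addCases (m := 5) (n := 5) (motive := fun _ => ℕ)
    (fun i => Fin.addCases (m := 5) (n := 5) (motive := fun _ => ℕ)
      (fun j => fiveCycle i j) (fun j => if t j = i then 1 else 0) y)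
    (fun i => Fin.addCases (m := 5) (n := 5) (motive := fun _ => ℕ)
      (fun j => if t i = j then 1 else 0) (fun j => fiveCycle i j) y) x

theorem forall_isPairing_three {V : Type*} {m₀ m₁ m₂ : V → V} (h₀ : (∀ x, m₀ (m₀ x) = x) ∧ ∀ x, m₀ x ≠ x)
    (h₁ : (∀ x, m₁ (m₁ x) = x) ∧ ∀ x, m₁ x ≠ x) (h₂ : (∀ x, m₂ (m₂ x) = x) ∧ ∀ x, m₂ x ≠ x)
    (i : Fin 3) : IsPairing (![m₀, m₁, m₂] i) := by
  fin_cases i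
  exacts [⟨h₀.1, h₀.2⟩, ⟨h₁.1, h₁.2⟩, ⟨h₂.1, h₂.2⟩]

/-- Explicit decompositions for eleven of the twelve cyclic orders. The exception is the pentagram
order `0, 3, 1, 4, 2`, which gives the Petersen graph. -/
theorem decomposes_joinedCycles : ∀ t ∈ cyclicOrders, Decomposes 3 (joinedCycles t) ∨
    ∀ x y, joinedCycles t x y = petersenWeight x y := by
  simp only [cyclicOrders, List.forall_mem_cons, List.not_mem_nil, false_imp_iff, implies_true,
    and_true]
  refine ⟨?_, ?_, ?_, ?_, ?_, ?_, ?_, ?_, ?_, ?_, ?_, ?_⟩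
  · exact Or.inl ⟨![![1, 0, 7, 8, 9, 6, 5, 2, 3, 4],
      ![4, 6, 3, 2, 0, 9, 1, 8, 7, 5],
      ![5, 2, 1, 4, 3, 0, 7, 6, 9, 8]],
      forall_isPairing_three (by decide) (by decide) (by decide), by decide⟩
  · exact Or.inl ⟨![![1, 0, 7, 9, 8, 6, 5, 2, 4, 3],
      ![4, 6, 3, 2, 0, 9, 1, 8, 7, 5],
      ![5, 2, 1, 4, 3, 0, 7, 6, 9, 8]],
      forall_isPairing_three (by decide) (by decide) (by decide), by decide⟩
  · exact Or.inl ⟨![![1, 0, 8, 7, 9, 6, 5, 3, 2, 4],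
      ![4, 6, 3, 2, 0, 9, 1, 8, 7, 5],
      ![5, 2, 1, 4, 3, 0, 7, 6, 9, 8]],
      forall_isPairing_three (by decide) (by decide) (by decide), by decide⟩
  · exact Or.inl ⟨![![1, 0, 9, 7, 8, 6, 5, 3, 4, 2],
      ![4, 6, 3, 2, 0, 9, 1, 8, 7, 5],
      ![5, 2, 1, 4, 3, 0, 7, 6, 9, 8]],
      forall_isPairing_three (by decide) (by decide) (by decide), by decide⟩
  · exact Or.inl ⟨![![1, 0, 8, 9, 7, 6, 5, 4, 2, 3],
      ![4, 6, 3, 2, 0, 9, 1, 8, 7, 5],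
      ![5, 2, 1, 4, 3, 0, 7, 6, 9, 8]],
      forall_isPairing_three (by decide) (by decide) (by decide), by decide⟩
  · exact Or.inl ⟨![![1, 0, 9, 8, 7, 6, 5, 4, 3, 2],
      ![4, 6, 3, 2, 0, 9, 1, 8, 7, 5],
      ![5, 2, 1, 4, 3, 0, 7, 6, 9, 8]],
      forall_isPairing_three (by decide) (by decide) (by decide), by decide⟩
  · exact Or.inl ⟨![![1, 0, 6, 4, 3, 9, 2, 8, 7, 5],
      ![4, 7, 3, 2, 0, 6, 5, 1, 9, 8],
      ![5, 2, 1, 8, 9, 0, 7, 6, 3, 4]],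
      forall_isPairing_three (by decide) (by decide) (by decide), by decide⟩
  · exact Or.inl ⟨![![1, 0, 6, 4, 3, 9, 2, 8, 7, 5],
      ![4, 7, 3, 2, 0, 6, 5, 1, 9, 8],
      ![5, 2, 1, 9, 8, 0, 7, 6, 4, 3]],
      forall_isPairing_three (by decide) (by decide) (by decide), by decide⟩
  · exact Or.inl ⟨![![1, 0, 6, 4, 3, 9, 2, 8, 7, 5],
      ![4, 2, 1, 7, 0, 6, 5, 3, 9, 8],
      ![5, 8, 3, 2, 9, 0, 7, 6, 1, 4]],
      forall_isPairing_three (by decide) (by decide) (by decide), by decide⟩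
  · exact Or.inr (by decide)
  · exact Or.inl ⟨![![1, 0, 8, 4, 3, 9, 7, 6, 2, 5],
      ![4, 7, 3, 2, 0, 6, 5, 1, 9, 8],
      ![5, 2, 1, 6, 9, 0, 3, 8, 7, 4]],
      forall_isPairing_three (by decide) (by decide) (by decide), by decide⟩
  · exact Or.inl ⟨![![1, 0, 7, 4, 3, 6, 5, 2, 9, 8],
      ![4, 8, 3, 2, 0, 9, 7, 6, 1, 5],
      ![5, 2, 1, 6, 9, 0, 3, 8, 7, 4]],
      forall_isPairing_three (by decide) (by decide) (by decide), by decide⟩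

end CubicCase

/-! ### The dichotomy on ten vertices -/

section MainStep

/-- Every vertex of `X` sends its matching edge across the cut, and the cut has only `X.card` edges.
Hence nothing else crosses. -/
theorem IsRegularWeight.inner_of_crossesAll {V : Type*} [Fintype V] [DecidableEq V] {r : ℕ}
    {w : V → V → ℕ} (h : IsRegularWeight r w) {m : V → V} (hs : ∀ x, 1 ≤ w x (m x)) {X : Finset V}
    (hX : cutWeight w X = X.card) (hc : ∀ x ∈ X, m x ∉ X) {x : V} (hx : x ∈ X) :
    ∑ y ∈ X, w x y + 1 = r ∧ ∀ y ∉ X, w x y = pairingWeight m x y := by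
  have h1 : ∀ x ∈ X, 1 ≤ ∑ y ∈ Xᶜ, w x y := fun x hx =>
    (hs x).trans (Finset.single_le_sum (f := fun y => w x y) (fun _ _ => Nat.zero_le _)
      (Finset.mem_compl.2 (hc x hx)))
  have h2 : ∑ y ∈ Xᶜ, w x y = 1 := by
    refine le_antisymm (not_lt.1 fun hlt => ?_) (h1 x hx)
    have : ∑ x ∈ X, 1 < ∑ x ∈ X, ∑ y ∈ Xᶜ, w x y := Finset.sum_lt_sum h1 ⟨x, hx, hlt⟩
    rw [Finset.sum_const, smul_eq_mul, mul_one, ← hX] at this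
    exact lt_irrefl _ this
  constructor
  · rw [← h.deg x, ← Finset.sum_add_sum_compl X, h2]
  · intro y hy
    rw [← Finset.add_sum_erase _ _ (Finset.mem_compl.2 (hc x hx))] at h2
    have h3 := hs x
    unfold pairingWeight
    split_ifs with hxy
    · subst hxy
      omega
    · have h4 : w x y ≤ ∑ y ∈ Xᶜ.erase (m x), w x y :=
        Finset.single_le_sum (f := fun y => w x y) (fun _ _ => Nat.zero_le _)
          (Finset.mem_erase.2 ⟨Ne.symm hxy, Finset.mem_compl.2 hy⟩)
      omega

theorem IsRegularWeight.exists_cyclicOrder {V : Type*} [Fintype V] [DecidableEq V] {r : ℕ}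
    {w : V → V → ℕ} (h : IsRegularWeight r w) {v : Fin 5 → V} (hv : Function.Injective v)
    {X : Finset V} (hX : Finset.univ.map ⟨v, hv⟩ = X) (h2 : ∀ x ∈ X, ∑ y ∈ X, w x y = 2)
    (hle : ∀ x ∈ X, ∀ y ∈ X, w x y ≤ 1) :
    ∃ t ∈ cyclicOrders, ∀ i j, w (v (t i)) (v (t j)) = fiveCycle i j := by
  have hvX : ∀ i, v i ∈ X := fun i => by rw [← hX]; simp
  refine RGraphs.exists_cyclicOrder (c := fun i j => w (v i) (v j)) (fun _ _ => h.symm _ _)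
    (fun _ => h.diag _) (fun i j => hle _ (hvX i) _ (hvX j)) fun i => ?_
  rw [← h2 _ (hvX i), ← hX, Finset.sum_map]
  rfl

/-- A `3`-graph of order ten without tight cuts, and five vertices such that their edges to the
other vertices form a perfect matching. -/
theorem NoTightCut.exists_equiv_joinedCycles {w : Fin 10 → Fin 10 → ℕ} (ht : NoTightCut 3 w)
    (h : IsRegularWeight 3 w) {m : Fin 10 → Fin 10} (hm : IsPairing m)
    (hs : ∀ x, 1 ≤ w x (m x)) {X : Finset (Fin 10)} (hX : X.card = 5) (hcut : cutWeight w X = 5)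
    (hc : ∀ x ∈ X, m x ∉ X) :
    ∃ t ∈ cyclicOrders, ∃ e : Fin 10 ≃ Fin 10, ∀ x y, w (e x) (e y) = joinedCycles t x y := by
  have hXc : Xᶜ.card = 5 := by rw [Finset.card_compl, hX]; rfl
  have hcr := hm.crossesAll (hXc.trans hX.symm).le hc
  have a1 := fun x hx => h.inner_of_crossesAll hs (hcut.trans hX.symm) hc (x := x) hx
  have a2 := fun x hx => h.inner_of_crossesAll hs ((h.cut_compl X).trans (hcut.trans hXc.symm))
    (fun x hx => by
      rw [Finset.mem_compl] at hx ⊢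
      exact fun h => hx ((hcr x).2 (by simpa using h))) (x := x) hx
  -- The triple `x, y, m x` has weight at most two, and one unit is taken by the edge from `x` to `m
  -- x`.
  have hle : ∀ x y, m x ≠ y → w x y ≤ 1 := by
    intro x y hxy
    by_cases hne : x = y
    · subst hne
      rw [h.diag]
      omega
    · have := ht.triple_le h (by simp) hne (hm.ne x).symm (Ne.symm hxy)
      have := hs x
      omega
  obtain ⟨v, hvX⟩ : ∃ v : Fin 5 ↪ Fin 10, Finset.univ.map v = X := by
    refine ⟨(X.orderEmbOfFin hX).toEmbedding, ?_⟩
    exact X.map_orderEmbOfFin_univ hX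
  obtain ⟨s, hsc, hsv⟩ := h.exists_cyclicOrder v.injective hvX
    (fun x hx => by have := (a1 x hx).1; omega) fun x hx y hy => hle x y fun hxy =>
      hc x hx (hxy ▸ hy)
  have hminj : Function.Injective m := fun x y hxy => by rw [← hm.invol x, hxy, hm.invol]
  have hvmem : ∀ i, v i ∈ X := fun i => by rw [← hvX]; simp
  have hsinj := injective_of_mem_cyclicOrders s hsc
  have hu : Function.Injective fun i => m (v (s i)) := hminj.comp (v.injective.comp hsinj)
  have huX : Finset.univ.map ⟨_, hu⟩ = Xᶜ := by
    refine Finset.eq_of_subset_of_card_le (fun y hy => ?_) (by simp [hXc])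
    rw [Finset.mem_map] at hy
    obtain ⟨i, -, rfl⟩ := hy
    exact Finset.mem_compl.2 (hc _ (hvmem _))
  obtain ⟨t, htc, htu⟩ := h.exists_cyclicOrder hu huX
    (fun x hx => by have := (a2 x hx).1; omega) fun x hx y hy => hle x y fun hxy => by
      rw [Finset.mem_compl] at hx hy
      exact hx ((hcr x).2 (hxy ▸ hy))
  have htinj := injective_of_mem_cyclicOrders t htc
  -- The first cycle is listed in its cyclic order `s`. The other side is labelled by the partners
  -- of these vertices and listed in its own cyclic order `t`, so `t` alone records how the spokes
  -- are attached.
  have hinj : Function.Injective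
      (Fin.append (fun i => v (s i)) (fun i => m (v (s (t i)))) : Fin (5 + 5) → Fin 10) := by
    rw [Fin.append_injective_iff]
    refine ⟨v.injective.comp hsinj, hu.comp htinj, fun i j hij => ?_⟩
    exact hc _ (hvmem (s (t j))) (hij ▸ hvmem _)
  have hcross : ∀ i j, w (v (s i)) (m (v (s (t j)))) = if t j = i then 1 else 0 := by
    intro i j
    rw [(a1 _ (hvmem _)).2 _ (hc _ (hvmem _)), pairingWeight]
    simp only [hminj.eq_iff, v.injective.eq_iff, hsinj.eq_iff, eq_comm]
  refine ⟨t, htc, Equiv.ofBijective _ (Finite.injective_iff_bijective.1 hinj), ?_⟩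
  intro x y
  rw [Equiv.ofBijective_apply, Equiv.ofBijective_apply]
  unfold joinedCycles
  refine Fin.addCases (m := 5) (n := 5) (fun i => ?_) (fun i => ?_) x <;>
    refine Fin.addCases (m := 5) (n := 5) (fun j => ?_) (fun j => ?_) y <;>
    simp only [Fin.append_left, Fin.append_right, Fin.addCases_left, Fin.addCases_right]
  · exact hsv i j
  · exact hcross i j
  · rw [h.symm]
    exact hcross j i
  · exact htu i j

/-- The weight arises from the Petersen graph by adding perfect matchings of it. -/
def IsPetersenSum (r : ℕ) (w : Fin 10 → Fin 10 → ℕ) : Prop :=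
  ∃ (k : ℕ) (e : Fin 10 ≃ Fin 10) (n : Fin k → Fin 10 → Fin 10), r = k + 3 ∧
    (∀ i, IsPairing (n i)) ∧ (∀ i x, petersenWeight x (n i x) = 1) ∧
    ∀ x y, w (e x) (e y) = petersenWeight x y + ∑ i, pairingWeight (n i) x y

theorem IsPetersenSum.add_pairing {r : ℕ} {w w' : Fin 10 → Fin 10 → ℕ} (h : IsPetersenSum r w')
    {m : Fin 10 → Fin 10} (hm : IsPairing m)
    (hw : ∀ x y, w x y = w' x y + pairingWeight m x y) :
    Decomposes (r + 1) w ∨ IsPetersenSum (r + 1) w := by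
  obtain ⟨k, e, n, rfl, hn, hs, hwn⟩ := h
  have hm' := hm.conj e.symm
  have key : ∀ x y, w (e x) (e y) = petersenWeight x y + ∑ i, pairingWeight (n i) x y +
      pairingWeight (fun x => e.symm (m (e.symm.symm x))) x y := by
    intro x y
    rw [hw, hwn, ← pairingWeight_conj m e.symm (e x) (e y)]
    simp
  by_cases hp : ∀ x, petersenWeight x (e.symm (m (e.symm.symm x))) = 1
  · right
    refine ⟨k + 1, e, Fin.cons (fun x => e.symm (m (e.symm.symm x))) n, rfl, fun i => ?_,
      fun i => ?_, fun x y => ?_⟩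
    · refine Fin.cases ?_ (fun i => ?_) i
      exacts [hm', hn i]
    · refine Fin.cases ?_ (fun i => ?_) i
      exacts [hp, hs i]
    · rw [key, Fin.sum_univ_succ]
      simp only [Fin.cons_zero, Fin.cons_succ]
      omega
  · left
    have h1 := (decomposes_petersenWeight_add hm' hp).add
      (w' := fun x y => ∑ i, pairingWeight (n i) x y) ⟨n, hn, fun _ _ => rfl⟩
    have h2 := h1.comp e.symm
    rw [show k + 3 + 1 = 4 + k by omega]
    convert h2 using 3 with x y
    have h3 := key (e.symm x) (e.symm y)
    rw [Equiv.apply_symm_apply, Equiv.apply_symm_apply] at h3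
    rw [h3]
    omega

/-- Induction on `r`: either a cut is tight, or a perfect matching can be split off, or the graph is
cubic and made of two joined five-cycles. -/
theorem IsRWeight.decomposes_or_isPetersenSum {r : ℕ} {w : Fin 10 → Fin 10 → ℕ}
    (h : IsRWeight r w) : Decomposes r w ∨ IsPetersenSum r w := by
  induction r generalizing w with
  | zero => exact Or.inl h.toIsRegularWeight.decomposes_zero
  | succ r ih =>
    by_cases ht : NoTightCut (r + 1) w
    swap
    · exact Or.inl (h.decomposes_of_not_noTightCut (by simp) ht)
    have step : (∃ (m : Fin 10 → Fin 10) (w' : Fin 10 → Fin 10 → ℕ), IsPairing m ∧ IsRWeight r w' ∧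
        ∀ x y, w x y = w' x y + pairingWeight m x y) →
        Decomposes (r + 1) w ∨ IsPetersenSum (r + 1) w := by
      rintro ⟨m, w', hm, h', hw⟩
      rcases ih h' with h1 | h1
      · exact Or.inl (h1.add_pairing hm hw)
      · exact h1.add_pairing hm hw
    rcases Nat.lt_or_ge r 3 with hr | hr
    swap
    · obtain ⟨m, hm, hs, hg⟩ := h.exists_good_pairing (by omega) ht
      obtain ⟨w', h', hw⟩ := h.exists_sub_of_good ht hm hs hg
      exact step ⟨m, w', hm, h', hw⟩
    obtain ⟨v, hv⟩ := h.toIsRegularWeight.exists_pos r.succ_pos 0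
    obtain ⟨m, hm, hs, -⟩ := h.exists_pairing hv
    by_cases hg : ∀ X : Finset (Fin 10), X.card = 5 → cutWeight w X = r + 1 + 2 → ∃ x ∈ X, m x ∈ X
    · obtain ⟨w', h', hw⟩ := h.exists_sub_of_good ht hm hs hg
      exact step ⟨m, w', hm, h', hw⟩
    push Not at hg
    obtain ⟨X, hX, hcut, hc⟩ := hg
    have h5 : 5 ≤ cutWeight w X :=
      calc 5 = ∑ x ∈ X, 1 := by simp [hX]
        _ ≤ ∑ x ∈ X, w x (m x) := Finset.sum_le_sum fun x _ => hs x
        _ ≤ _ := IsPairing.sum_le_cutWeight hc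
    -- An obstructing cut contains all five edges of `m`, so its weight `r + 3` is at least five,
    -- while `r < 3` in this branch.
    obtain rfl : r = 2 := by omega
    obtain ⟨t, htc, e, he⟩ := ht.exists_equiv_joinedCycles h.toIsRegularWeight hm hs hX hcut hc
    rcases decomposes_joinedCycles t htc with hd | hp
    · left
      have := hd.comp e.symm
      convert this using 3 with x y
      rw [← he]
      simp
    · right
      exact ⟨0, e, Fin.elim0, rfl, fun i => i.elim0, fun i => i.elim0, fun x y => by
        rw [he, hp]; simp⟩

end MainStep

/-! ### From graphs to weight matrices -/

section Multiplicity

variable {α β : Type*} {G : Graph α β}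

/-- The number of edges with ends `x` and `y`. -/
noncomputable def multiplicity (G : Graph α β) (x y : V(G)) : ℕ := {e | G.IsLink e x y}.ncard

theorem multiplicity_symm (x y : V(G)) : multiplicity G x y = multiplicity G y x := by
  unfold multiplicity
  simp_rw [G.isLink_comm (x := (x : α))]

theorem multiplicity_self (hG : G.Loopless) (x : V(G)) : multiplicity G x x = 0 := by
  have : {e | G.IsLink e x x} = ∅ := by
    ext e
    simp only [Set.mem_ofPred_eq, Set.mem_empty_iff_false, iff_false]
    exact fun h => h.ne rfl
  rw [multiplicity, this, Set.ncard_empty]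

theorem finite_setOf_isLink (hE : E(G).Finite) (x y : α) : {e | G.IsLink e x y}.Finite :=
  hE.subset fun _ h => Graph.IsLink.edge_mem h

/-- Disjointness of `X` and `Y` ensures that no edge is counted for both orders of its ends. -/
theorem ncard_links_eq_sum (hE : E(G).Finite) {X Y : Finset V(G)} (hXY : Disjoint X Y) :
    {e | ∃ x ∈ X, ∃ y ∈ Y, G.IsLink e x y}.ncard = ∑ x ∈ X, ∑ y ∈ Y, multiplicity G x y := by
  classical
  have hcard : ∀ x y : V(G), multiplicity G x y =
      (hE.toFinset.filter fun e => G.IsLink e x y).card := by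
    intro x y
    rw [multiplicity, ← Set.ncard_coe_finset]
    congr 1
    ext e
    simpa using fun h => Graph.IsLink.edge_mem h
  have hset : {e | ∃ x ∈ X, ∃ y ∈ Y, G.IsLink e x y} =
      ((X ×ˢ Y).biUnion fun p => hE.toFinset.filter fun e => G.IsLink e p.1 p.2 : Finset β) := by
    ext e
    simp only [Set.mem_ofPred_eq, Finset.mem_coe, Finset.mem_biUnion, Finset.mem_product,
      Finset.mem_filter, Set.Finite.mem_toFinset, Prod.exists]
    constructor
    · rintro ⟨x, hx, y, hy, h⟩
      exact ⟨x, y, ⟨hx, hy⟩, h.edge_mem, h⟩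
    · rintro ⟨x, y, ⟨hx, hy⟩, -, h⟩
      exact ⟨x, hx, y, hy, h⟩
  rw [hset, Set.ncard_coe_finset, Finset.card_biUnion, Finset.sum_product]
  · simp only [hcard]
  · rintro ⟨x, y⟩ hp ⟨x', y'⟩ hp' hne
    rw [Finset.mem_coe, Finset.mem_product] at hp hp'
    refine Finset.disjoint_left.2 fun e he he' => hne ?_
    rw [Finset.mem_filter] at he he'
    rcases he.2.eq_and_eq_or_eq_and_eq he'.2 with h | h
    · exact Prod.ext (Subtype.ext h.1) (Subtype.ext h.2)
    · exact absurd (Subtype.ext h.1 ▸ hp.1) (Finset.disjoint_right.1 hXY hp'.2)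

theorem degree_eq_sum [Fintype V(G)] [DecidableEq V(G)] (hE : E(G).Finite) (hG : G.Loopless)
    (x : V(G)) : degree G x = ∑ y, multiplicity G x y := by
  have h := ncard_links_eq_sum hE (disjoint_compl_right (a := ({x} : Finset V(G))))
  rw [Finset.sum_singleton] at h
  rw [← Finset.sum_add_sum_compl {x}, Finset.sum_singleton, multiplicity_self hG, zero_add, ← h,
    degree]
  congr 1
  ext e
  simp only [Graph.mem_incidenceSet, Set.mem_ofPred_eq, Finset.mem_singleton, Finset.mem_compl,
    exists_eq_left]
  constructor
  · rintro ⟨y, hy⟩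
    exact ⟨⟨y, hy.right_mem⟩, fun h => hy.ne (congrArg Subtype.val h).symm, hy⟩
  · rintro ⟨y, -, hy⟩
    exact ⟨y, hy⟩

theorem ncard_edgeBoundary [Fintype V(G)] [DecidableEq V(G)] (hE : E(G).Finite)
    (X : Finset V(G)) :
    (edgeBoundary G (Subtype.val '' (X : Set V(G)))).ncard = cutWeight (multiplicity G) X := by
  rw [cutWeight, ← ncard_links_eq_sum hE disjoint_compl_right]
  congr 1
  ext e
  simp only [edgeBoundary, Set.mem_ofPred_eq, Finset.mem_compl]
  constructor
  · rintro ⟨_, ⟨x, hx, rfl⟩, y, hy, h⟩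
    exact ⟨x, hx, ⟨y, h.right_mem⟩, fun h' => hy ⟨_, h', rfl⟩, h⟩
  · rintro ⟨x, hx, y, hy, h⟩
    refine ⟨x, ⟨x, hx, rfl⟩, y, ?_, h⟩
    rintro ⟨z, hz, hzy⟩
    exact hy (Subtype.ext hzy ▸ hz)

theorem IsRGraph.isRWeight [Fintype V(G)] [DecidableEq V(G)] {r : ℕ} (h : IsRGraph r G) :
    IsRWeight r (multiplicity G) where
  symm := multiplicity_symm
  diag := multiplicity_self h.loopless
  deg x := by rw [← degree_eq_sum h.finite_edgeSet h.loopless, h.regular x x.2]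
  le_cut X hX := by
    rw [← ncard_edgeBoundary h.finite_edgeSet]
    refine h.le_boundary _ (fun x hx => ?_) ?_
    · obtain ⟨y, -, rfl⟩ := hx
      exact y.2
    · rwa [Set.ncard_image_of_injective _ Subtype.val_injective, Set.ncard_coe_finset]

theorem IsRWeight.isRGraph [Fintype V(G)] [DecidableEq V(G)] [Nonempty V(G)] {r : ℕ}
    (hE : E(G).Finite) (hG : G.Loopless) (h : IsRWeight r (multiplicity G)) : IsRGraph r G where
  finite_vertexSet := Set.toFinite _
  finite_edgeSet := hE
  nonempty := Set.nonempty_coe_sort.1 inferInstance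
  loopless := hG
  regular x hx := (degree_eq_sum hE hG ⟨x, hx⟩).trans (h.deg _)
  le_boundary X hX hodd := by
    classical
    have h1 : Subtype.val '' ((Finset.univ.filter fun x : V(G) => (x : α) ∈ X : Finset V(G)) :
        Set V(G)) = X := by
      ext x
      simp only [Finset.coe_filter, Finset.mem_univ, true_and, Set.mem_image, Set.mem_ofPred_eq,
        Subtype.exists, exists_and_left, exists_prop, exists_eq_right_right]
      exact ⟨fun h => h.1, fun h => ⟨h, hX h⟩⟩
    rw [← h1, ncard_edgeBoundary hE]
    refine h.le_cut _ ?_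
    rwa [← h1, Set.ncard_image_of_injective _ Subtype.val_injective, Set.ncard_coe_finset] at hodd

/-- The pair of ends of each edge. -/
theorem exists_ends (G : Graph α β) :
    ∃ f : E(G) → Sym2 V(G), ∀ e x y, f e = s(x, y) ↔ G.IsLink e x y := by
  have h : ∀ e : E(G), ∃ p : Sym2 V(G), ∀ x y, p = s(x, y) ↔ G.IsLink e x y := by
    intro e
    obtain ⟨a, b, hab⟩ := G.exists_isLink_of_mem_edgeSet e.2
    refine ⟨s(⟨a, hab.left_mem⟩, ⟨b, hab.right_mem⟩), fun x y => ?_⟩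
    rw [hab.isLink_iff]
    simp [Subtype.ext_iff, eq_comm, and_comm]
  choose f hf using h
  exact ⟨f, hf⟩

theorem card_fiber_ends [Fintype E(G)] [DecidableEq (Sym2 V(G))] {f : E(G) → Sym2 V(G)}
    (hf : ∀ e x y, f e = s(x, y) ↔ G.IsLink e x y) (x y : V(G)) :
    (Finset.univ.filter fun e => f e = s(x, y)).card = multiplicity G x y := by
  rw [multiplicity, ← Set.ncard_coe_finset, ← Set.ncard_image_of_injective _ Subtype.val_injective]
  congr 1
  ext e
  simp only [hf, Finset.coe_filter, Finset.mem_univ, true_and, Set.mem_image, Set.mem_ofPred_eq,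
    Subtype.exists, exists_and_left, exists_prop, exists_eq_right_right]
  exact ⟨fun h => h.1, fun h => ⟨h, h.edge_mem⟩⟩

theorem Isomorphic.exists_multiplicity_eq {α' β' : Type*} {H : Graph α' β'} (h : Isomorphic G H) :
    ∃ θ : V(G) ≃ V(H), ∀ x y, multiplicity G x y = multiplicity H (θ x) (θ y) := by
  obtain ⟨θ, φ, h⟩ := h
  refine ⟨θ, fun x y => ?_⟩
  refine Set.ncard_congr (fun e he => φ ⟨e, Graph.IsLink.edge_mem he⟩)
    (fun e he => (h ⟨e, _⟩ x y).1 he) (fun e e' he he' hee => ?_) fun e he => ?_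
  · exact congrArg Subtype.val (φ.injective (Subtype.ext hee))
  · refine ⟨φ.symm ⟨e, Graph.IsLink.edge_mem he⟩, ?_, by simp⟩
    rw [Set.mem_ofPred_eq, h]
    simpa using he

/-- Edges are matched up fibrewise over their pairs of ends; parallel edges may be identified
arbitrarily. -/
theorem isomorphic_of_multiplicity_eq {α' β' : Type*} {H : Graph α' β'} (hE : E(G).Finite)
    (hE' : E(H).Finite) (θ : V(G) ≃ V(H))
    (h : ∀ x y, multiplicity G x y = multiplicity H (θ x) (θ y)) : Isomorphic G H := by
  classical
  obtain ⟨f, hf⟩ := exists_ends G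
  obtain ⟨g, hg⟩ := exists_ends H
  have := hE.fintype
  have := hE'.fintype
  obtain ⟨φ, hφ⟩ := exists_equiv_of_card_fiber_eq (fun e => (f e).map θ) g fun p => by
    induction p using Sym2.ind with
    | _ x y =>
    obtain ⟨x, rfl⟩ := θ.surjective x
    obtain ⟨y, rfl⟩ := θ.surjective y
    rw [card_fiber_ends hg, ← h, ← card_fiber_ends hf]
    simp only [← Sym2.map_mk, (Sym2.map.injective θ.injective).eq_iff]
  refine ⟨θ, φ, fun e x y => ?_⟩
  rw [← hf, ← hg, hφ, ← Sym2.map_mk, (Sym2.map.injective θ.injective).eq_iff]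

end Multiplicity

/-! ### Disjoint perfect matchings as packings of pairings -/

section PerfectMatchings

variable {α β : Type*} {G : Graph α β}

theorem IsPerfectMatching.exists_isPairing {M : Set β} (hG : G.Loopless)
    (h : IsPerfectMatching G M) : ∃ m : V(G) → V(G), IsPairing m ∧
      ∀ x y, m x = y ↔ ∃ e ∈ M, G.IsLink e x y := by
  have h1 : ∀ x : V(G), ∃ y : V(G), ∃ e ∈ M, G.IsLink e x y := by
    intro x
    obtain ⟨e, he, y, hy⟩ := h.2 x x.2
    exact ⟨⟨y, hy.right_mem⟩, e, he, hy⟩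
  have huniq : ∀ {x y z : V(G)}, (∃ e ∈ M, G.IsLink e x y) → (∃ e ∈ M, G.IsLink e x z) → y = z := by
    rintro x y z ⟨e, he, h1⟩ ⟨f, hf, h2⟩
    have hef : e = f := by
      by_contra hef
      exact h.1.2 e he f hf ⟨hef, x, h1.inc_left, h2.inc_left⟩
    subst hef
    exact Subtype.ext (h1.right_unique h2)
  choose m hm using h1
  have hmy : ∀ x y, m x = y ↔ ∃ e ∈ M, G.IsLink e x y := fun x y =>
    ⟨fun h => h ▸ hm x, fun h => huniq (hm x) h⟩
  refine ⟨m, ⟨fun x => ?_, fun x hx => ?_⟩, hmy⟩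
  · obtain ⟨e, he, h1⟩ := hm x
    exact (hmy _ _).2 ⟨e, he, h1.symm⟩
  · obtain ⟨e, he, h1⟩ := hm x
    rw [hx] at h1
    exact h1.ne rfl

/-- `w` is at least the sum of `t` perfect matchings. -/
def Packs {V : Type*} [DecidableEq V] (t : ℕ) (w : V → V → ℕ) : Prop :=
  ∃ m : Fin t → V → V, (∀ i, IsPairing (m i)) ∧ ∀ x y, ∑ i, pairingWeight (m i) x y ≤ w x y

theorem HasDisjointPerfectMatchings.packs [DecidableEq V(G)] (hE : E(G).Finite) (hG : G.Loopless)
    {t : ℕ} (h : HasDisjointPerfectMatchings G t) : Packs t (multiplicity G) := by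
  obtain ⟨M, hM, hd⟩ := h
  choose m hm hmM using fun i => (hM i).exists_isPairing hG
  refine ⟨m, hm, fun x y => ?_⟩
  choose g hg hg' using fun i => (hmM i x (m i x)).1 rfl
  simp only [pairingWeight, ← Finset.card_filter]
  rw [multiplicity, ← Set.ncard_coe_finset]
  refine Set.ncard_le_ncard_of_injOn g (fun i hi => ?_) (fun i _ j _ hij => ?_)
    (finite_setOf_isLink hE _ _)
  · simp only [Finset.coe_filter, Finset.mem_univ, true_and, Set.mem_ofPred_eq] at hi
    exact hi ▸ hg' i
  · by_contra hne
    exact Set.disjoint_left.1 (hd i j hne) (hg i) (hij ▸ hg j)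

theorem Packs.hasDisjointPerfectMatchings [Fintype V(G)] [DecidableEq V(G)] (hE : E(G).Finite)
    {t : ℕ} (h : Packs t (multiplicity G)) : HasDisjointPerfectMatchings G t := by
  classical
  obtain ⟨m, hm, hw⟩ := h
  obtain ⟨g, hg⟩ := exists_ends G
  have := hE.fintype
  have hpair : ∀ i x y, s(x, m i x) = s(y, m i y) ↔ y = x ∨ y = m i x := by
    intro i x y
    rw [Sym2.eq_iff]
    constructor
    · rintro (⟨h, -⟩ | ⟨-, h⟩)
      exacts [Or.inl h.symm, Or.inr h.symm]
    · rintro (rfl | rfl)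
      exacts [Or.inl ⟨rfl, rfl⟩, Or.inr ⟨((hm i).invol x).symm, rfl⟩]
  -- The index set consists of a colour together with a pair of that matching. Injectivity of `φ`
  -- realises different indices by different parallel edges, which makes the matchings disjoint.
  obtain ⟨φ, hφ⟩ := exists_embedding_of_card_fiber_le
    (A := Σ i : Fin t, {p : Sym2 V(G) // ∃ x, p = s(x, m i x)}) (fun a => a.2.1) g fun p => by
      induction p using Sym2.ind with
      | _ x y =>
      rw [card_fiber_ends hg]
      refine le_trans ?_ (hw x y)
      simp only [pairingWeight, ← Finset.card_filter]
      refine Finset.card_le_card_of_injOn Sigma.fst (fun a ha => ?_) fun a ha b hb hab => ?_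
      · obtain ⟨i, p, z, rfl⟩ := a
        simp only [Finset.coe_filter, Finset.mem_univ, true_and, Set.mem_ofPred_eq] at ha ⊢
        rw [Sym2.eq_iff] at ha
        rcases ha with ⟨rfl, h⟩ | ⟨rfl, h⟩
        · exact h
        · rw [← h, (hm i).invol]
      · obtain ⟨i, p, hp⟩ := a
        obtain ⟨j, q, hq⟩ := b
        simp only [Finset.coe_filter, Finset.mem_univ, true_and, Set.mem_ofPred_eq] at ha hb hab
        subst hab ha hb
        rfl
  refine ⟨fun i => {e | ∃ x, e = (φ ⟨i, s(x, m i x), x, rfl⟩ : β)}, fun i => ⟨⟨?_, ?_⟩, ?_⟩, ?_⟩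
  · rintro _ ⟨x, rfl⟩
    exact Subtype.coe_prop _
  · rintro _ ⟨x, rfl⟩ _ ⟨y, rfl⟩ ⟨hne, z, hz, hz'⟩
    have hx := (hg _ _ _).1 (hφ ⟨i, s(x, m i x), x, rfl⟩)
    have hy := (hg _ _ _).1 (hφ ⟨i, s(y, m i y), y, rfl⟩)
    have h1 := hz.eq_or_eq_of_isLink hx
    have h2 := hz'.eq_or_eq_of_isLink hy
    have h3 : s(x, m i x) = s(y, m i y) := by
      rw [hpair]
      have hinj : m i x = m i y → y = x := fun h => by rw [← (hm i).invol y, ← h, (hm i).invol]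
      have hsub : ∀ {a b : V(G)}, (a : α) = b → a = b := Subtype.ext
      rcases h1 with h1 | h1 <;> rcases h2 with h2 | h2
      · exact Or.inl (hsub (h2.symm.trans h1))
      · right
        rw [hsub (h1.symm.trans h2), (hm i).invol]
      · exact Or.inr (hsub (h2.symm.trans h1))
      · exact Or.inl (hinj (hsub (h1.symm.trans h2)))
    apply hne
    congr 2
    simp only [h3]
  · intro x hx
    have hx' := (hg _ _ _).1 (hφ ⟨i, s(⟨x, hx⟩, m i ⟨x, hx⟩), ⟨x, hx⟩, rfl⟩)
    exact ⟨_, ⟨_, rfl⟩, _, hx'⟩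
  · intro i j hij
    refine Set.disjoint_left.2 ?_
    rintro _ ⟨x, rfl⟩ ⟨y, hy⟩
    exact hij (congrArg Sigma.fst (φ.injective (Subtype.ext hy)))

/-- Both sides have row sums `r`, so the entrywise inequality is an equality. -/
theorem packs_iff_decomposes {V : Type*} [Fintype V] [DecidableEq V] {r : ℕ} {w : V → V → ℕ}
    (h : IsRegularWeight r w) : Packs r w ↔ Decomposes r w := by
  refine ⟨fun ⟨m, hm, hw⟩ => ⟨m, hm, fun x y => ?_⟩, fun ⟨m, hm, hw⟩ => ⟨m, hm, fun x y => (hw x y).ge⟩⟩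
  have h1 : ∑ y, ∑ i, pairingWeight (m i) x y = ∑ y, w x y := by
    rw [Finset.sum_comm, h.deg]
    simp [(hm _).isRegularWeight.deg]
  exact ((Finset.sum_eq_sum_iff_of_le fun y _ => hw x y).1 h1 y (Finset.mem_univ _)).symm

theorem Packs.mono {V : Type*} [DecidableEq V] {s t : ℕ} {w : V → V → ℕ} (hst : s ≤ t)
    (h : Packs t w) : Packs s w := by
  obtain ⟨m, hm, hw⟩ := h
  refine ⟨fun i => m (Fin.castLE hst i), fun i => hm _, fun x y => le_trans ?_ (hw x y)⟩
  refine (Finset.sum_map Finset.univ (Fin.castLEEmb hst)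
    fun i => pairingWeight (m i) x y).symm.trans_le ?_
  exact Finset.sum_le_sum_of_subset (Finset.subset_univ _)

theorem Packs.comp {V V' : Type*} [DecidableEq V] [DecidableEq V'] {t : ℕ} {w : V → V → ℕ}
    (h : Packs t w) (e : V' ≃ V) : Packs t fun x y => w (e x) (e y) := by
  obtain ⟨m, hm, hw⟩ := h
  refine ⟨fun i x => e.symm (m i (e x)), fun i => ?_, fun x y => ?_⟩
  · simpa using (hm i).conj e.symm
  · simpa only [pairingWeight, Equiv.symm_apply_eq] using hw (e x) (e y)

theorem IsRegularWeight.decomposes_one {V : Type*} [Fintype V] [DecidableEq V] {w : V → V → ℕ}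
    (h : IsRegularWeight 1 w) : Decomposes 1 w := by
  choose m hm using fun x => h.exists_pos one_pos x
  have h1 : ∀ x y, w x y = pairingWeight m x y := by
    intro x y
    have h2 := h.deg x
    rw [← Finset.add_sum_erase _ _ (Finset.mem_univ (m x))] at h2
    have h3 := hm x
    unfold pairingWeight
    split_ifs with hxy
    · subst hxy
      omega
    · have h4 : w x y ≤ ∑ y ∈ Finset.univ.erase (m x), w x y :=
        Finset.single_le_sum (f := fun y => w x y) (fun _ _ => Nat.zero_le _)
          (Finset.mem_erase.2 ⟨Ne.symm hxy, Finset.mem_univ _⟩)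
      omega
  refine ⟨fun _ => m, fun _ => ⟨fun x => ?_, fun x hx => ?_⟩, fun x y => by simp [h1]⟩
  · have h2 := hm x
    rw [h.symm, h1, pairingWeight] at h2
    by_contra hc
    simp [hc] at h2
  · have h2 := hm x
    rw [show m x = x from hx, h.diag] at h2
    omega

/-- An `r`-regular multigraph with `r - 1` disjoint perfect matchings has `r` of them. -/
theorem IsRegularWeight.decomposes_of_packs {V : Type*} [Fintype V] [DecidableEq V] {t : ℕ}
    {w : V → V → ℕ} (h : IsRegularWeight (t + 1) w) (hp : Packs t w) : Decomposes (t + 1) w := by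
  obtain ⟨m, hm, hw⟩ := hp
  have hsymm : ∀ x y, ∑ i, pairingWeight (m i) x y = ∑ i, pairingWeight (m i) y x := fun x y =>
    Finset.sum_congr rfl fun i _ => (hm i).pairingWeight_symm x y
  -- What remains after removing the matchings is `1`-regular, hence itself a perfect matching.
  have h1 : IsRegularWeight 1 fun x y => w x y - ∑ i, pairingWeight (m i) x y := by
    refine ⟨fun x y => by rw [h.symm, hsymm], fun x => by rw [h.diag, Nat.zero_sub], fun x => ?_⟩
    rw [Finset.sum_tsub_distrib _ fun y _ => hw x y, h.deg, Finset.sum_comm]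
    simp [(hm _).isRegularWeight.deg]
  have h2 := Decomposes.add ⟨m, hm, fun _ _ => rfl⟩ h1.decomposes_one
  convert h2 using 3 with x y
  have := hw x y
  omega

end PerfectMatchings

/-! ### Class 1 as decomposability -/

section ClassOne

variable {α β : Type*} {G : Graph α β} {r : ℕ}

theorem EdgeColorable.injective_incidenceSet {k : ℕ} {c : E(G) → Fin k}
    (hc : ∀ e f : E(G), AdjacentEdges G e f → c e ≠ c f) (x : α) :
    Function.Injective fun e : G.incidenceSet x => c ⟨e, G.incidenceSet_subset_edgeSet x e.2⟩ := by
  intro e f hef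
  by_contra hne
  exact hc ⟨e, _⟩ ⟨f, _⟩ ⟨fun h => hne (Subtype.ext h), x, e.2, f.2⟩ hef

/-- At each vertex there are `r` edges and `r` colours, so a proper colouring uses every colour
there: colour classes are perfect matchings. Conversely `r` disjoint perfect matchings exhaust the
edges at every vertex. -/
theorem IsRGraph.edgeColorable_iff (h : IsRGraph r G) :
    EdgeColorable G r ↔ HasDisjointPerfectMatchings G r := by
  have hfin : ∀ x, Finite (G.incidenceSet x) := fun x =>
    h.finite_edgeSet.subset (G.incidenceSet_subset_edgeSet x)
  have hcard : ∀ x ∈ V(G), Nat.card (G.incidenceSet x) = r := fun x hx => by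
    rw [Nat.card_coe_set_eq, ← h.regular x hx, degree]
  constructor
  · rintro ⟨c, hc⟩
    refine ⟨fun i => {e | ∃ he : e ∈ E(G), c ⟨e, he⟩ = i}, fun i => ⟨⟨?_, ?_⟩, ?_⟩, ?_⟩
    · rintro e ⟨he, -⟩
      exact he
    · rintro e ⟨he, hi⟩ f ⟨hf, hi'⟩ hef
      exact hc ⟨e, he⟩ ⟨f, hf⟩ hef (hi.trans hi'.symm)
    · intro x hx
      have := hfin x
      obtain ⟨e, he⟩ := ((EdgeColorable.injective_incidenceSet hc x).bijective_of_nat_card_le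
        (by rw [hcard x hx, Nat.card_fin])).2 i
      exact ⟨e, ⟨_, he⟩, e.2⟩
    · intro i j hij
      refine Set.disjoint_left.2 ?_
      rintro e ⟨he, hi⟩ ⟨he', hj⟩
      exact hij (hi.symm.trans hj)
  · rintro ⟨M, hM, hd⟩
    have h1 : ∀ e : E(G), ∃ i, (e : β) ∈ M i := by
      intro e
      obtain ⟨x, y, hxy⟩ := G.exists_isLink_of_mem_edgeSet e.2
      choose g hg hgx using fun i => (hM i).2 x hxy.left_mem
      have hinj : Function.Injective fun i => (⟨g i, hgx i⟩ : G.incidenceSet x) := by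
        intro i j hij
        by_contra hne
        have hgg : g i = g j := congrArg Subtype.val hij
        exact Set.disjoint_left.1 (hd i j hne) (hg i) (hgg ▸ hg j)
      have := hfin x
      obtain ⟨i, hi⟩ := (hinj.bijective_of_nat_card_le
        (by rw [hcard x hxy.left_mem, Nat.card_fin])).2 ⟨e, hxy.inc_left⟩
      exact ⟨i, congrArg Subtype.val hi ▸ hg i⟩
    choose c hc using h1
    exact ⟨c, fun e f hef hcef => (hM (c e)).1.2 e (hc e) f (hcef ▸ hc f) hef⟩

theorem IsRGraph.isClassOne_iff (h : IsRGraph r G) (hr : 0 < r) :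
    IsClassOne G ↔ HasDisjointPerfectMatchings G r := by
  have hmax : maxDegree G = r := by
    have : degree G '' V(G) = {r} := by
      rw [Set.eq_singleton_iff_nonempty_unique_mem]
      refine ⟨h.nonempty.image _, ?_⟩
      rintro _ ⟨x, hx, rfl⟩
      exact h.regular x hx
    rw [maxDegree, this, csSup_singleton]
  rw [IsClassOne, hmax, edgeChromaticNumber, ← h.edgeColorable_iff]
  constructor
  · intro h1
    -- The infimum of the empty set is `0`, which `hr` excludes.
    have h2 : {k | EdgeColorable G k}.Nonempty := Nat.nonempty_of_pos_sInf (h1 ▸ hr)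
    exact h1 ▸ Nat.sInf_mem h2
  · intro h1
    refine le_antisymm (Nat.sInf_le h1) (le_csInf ⟨r, h1⟩ ?_)
    rintro k ⟨c, hc⟩
    obtain ⟨x, hx⟩ := h.nonempty
    have := Nat.card_le_card_of_injective _ (EdgeColorable.injective_incidenceSet hc x)
    rwa [Nat.card_fin, Nat.card_coe_set_eq, ← degree, h.regular x hx] at this

theorem IsRGraph.isClassOne_iff_decomposes [Fintype V(G)] [DecidableEq V(G)] (h : IsRGraph r G)
    (hr : 0 < r) : IsClassOne G ↔ Decomposes r (multiplicity G) := by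
  rw [h.isClassOne_iff hr, ← packs_iff_decomposes h.isRWeight.toIsRegularWeight]
  exact ⟨fun h' => h'.packs h.finite_edgeSet h.loopless,
    fun h' => h'.hasDisjointPerfectMatchings h.finite_edgeSet⟩

theorem IsRGraph.ten_le_of_isClassTwo {α : Type u} {β : Type v} {G : Graph α β} (h : IsRGraph r G)
    (hr : 0 < r) (h2 : IsClassTwo G) : 10 ≤ V(G).ncard := by
  classical
  have := h.finite_vertexSet.fintype
  have h3 := h.isRWeight.even_card hr
  rw [← Nat.card_eq_fintype_card, Nat.card_coe_set_eq] at h3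
  by_contra hlt
  refine h2 ((h.isClassOne_iff_decomposes hr).2 (h.isRWeight.decomposes_of_card_le ?_))
  rw [← Nat.card_eq_fintype_card, Nat.card_coe_set_eq]
  obtain ⟨k, hk⟩ := h3
  omega

end ClassOne

/-! ### The Petersen graph on two-element subsets, and added copies of its perfect matchings -/

section PetersenGraphs

/-- A drawing of the Petersen graph as two five-cycles and a perfect matching. -/
def petersenLabel : Fin 10 → PetersenVertex :=
  ![⟨{0, 1}, rfl⟩,
    ⟨{2, 3}, rfl⟩,
    ⟨{0, 4}, rfl⟩,
    ⟨{1, 2}, rfl⟩,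
    ⟨{3, 4}, rfl⟩,
    ⟨{2, 4}, rfl⟩,
    ⟨{0, 3}, rfl⟩,
    ⟨{1, 4}, rfl⟩,
    ⟨{0, 2}, rfl⟩,
    ⟨{1, 3}, rfl⟩]

theorem petersenLabel_bijective : Function.Bijective petersenLabel :=
  (Fintype.bijective_iff_injective_and_card _).2 ⟨by decide, by decide⟩

instance : DecidableRel petersenSimple.Adj := fun s t =>
  inferInstanceAs (Decidable (Disjoint s.1 t.1))

theorem petersenLabel_adj : ∀ x y, petersenSimple.Adj (petersenLabel x) (petersenLabel y) ↔
    petersenWeight x y = 1 := by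
  decide

theorem petersen_isLink {e : Sym2 PetersenVertex} {x y : PetersenVertex} :
    petersen.IsLink e x y ↔ petersenSimple.Adj x y ∧ e = s(x, y) := by
  rw [petersen, Graph.ofSimpleGraph_isLink, and_comm]
  refine and_congr_left ?_
  rintro rfl
  exact SimpleGraph.mem_edgeSet _

/-- The vertices of a graph obtained from the Petersen graph by adding edges. -/
noncomputable def copiesLabel (𝓜 : Multiset (Set (Sym2 PetersenVertex))) :
    Fin 10 ≃ V(addCopies petersen 𝓜) :=
  (Equiv.ofBijective _ petersenLabel_bijective).trans (Equiv.Set.univ _).symm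

open Classical in
theorem multiplicity_addCopies (𝓜 : Multiset (Set (Sym2 PetersenVertex))) (x y : Fin 10) :
    multiplicity (addCopies petersen 𝓜) (copiesLabel 𝓜 x) (copiesLabel 𝓜 y) =
      if petersenWeight x y = 1 then
        1 + 𝓜.countP (fun M => s(petersenLabel x, petersenLabel y) ∈ M) else 0 := by
  have h1 : {e | (addCopies petersen 𝓜).IsLink e (copiesLabel 𝓜 x) (copiesLabel 𝓜 y)} =
      {e | petersenWeight x y = 1 ∧ e.1 = s(petersenLabel x, petersenLabel y) ∧
        e.2 ≤ 𝓜.countP (fun M => e.1 ∈ M)} := by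
    ext e
    change petersen.IsLink e.1 (petersenLabel x) (petersenLabel y) ∧
      e.2 ≤ 𝓜.countP (fun M => e.1 ∈ M) ↔ _
    rw [petersen_isLink, petersenLabel_adj, and_assoc]
    rfl
  rw [multiplicity, h1]
  split_ifs with h
  · have h2 : {e : Sym2 PetersenVertex × ℕ | petersenWeight x y = 1 ∧
        e.1 = s(petersenLabel x, petersenLabel y) ∧ e.2 ≤ 𝓜.countP (fun M => e.1 ∈ M)} =
        Prod.mk s(petersenLabel x, petersenLabel y) '' (Finset.range
          (1 + 𝓜.countP (fun M => s(petersenLabel x, petersenLabel y) ∈ M)) : Set ℕ) := by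
      ext ⟨e, j⟩
      simp only [h, true_and, Set.mem_ofPred_eq, Finset.coe_range, Set.mem_image, Set.mem_Iio,
        Prod.mk.injEq]
      constructor
      · rintro ⟨rfl, hj⟩
        exact ⟨j, by omega, rfl, rfl⟩
      · rintro ⟨i, hi, rfl, rfl⟩
        exact ⟨rfl, by omega⟩
    rw [h2, Set.ncard_image_of_injective _ (Prod.mk_right_injective _), Set.ncard_coe_finset,
      Finset.card_range]
  · simp [h]

theorem multiplicity_addCopies_eq_sum {k : ℕ} {f : Fin k → Set (Sym2 PetersenVertex)}
    {n : Fin k → Fin 10 → Fin 10} (hs : ∀ i x, petersenWeight x (n i x) = 1)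
    (hf : ∀ i x y, s(petersenLabel x, petersenLabel y) ∈ f i ↔ n i x = y) (x y : Fin 10) :
    multiplicity (addCopies petersen (Finset.univ.val.map f)) (copiesLabel _ x) (copiesLabel _ y) =
      petersenWeight x y + ∑ i, pairingWeight (n i) x y := by
  classical
  rw [multiplicity_addCopies, Multiset.countP_map]
  have h1 := petersenWeight_le_one x y
  split_ifs with h
  · rw [h]
    congr 1
    simp only [hf, pairingWeight, ← Finset.card_filter]
    rw [Finset.card_def, Finset.filter_val]
  · rw [Finset.sum_eq_zero fun i _ => ?_]
    · omega
    · rw [pairingWeight, if_neg]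
      rintro rfl
      exact h (hs i x)

theorem exists_eq_map_univ {A : Type*} {k : ℕ} (s : Multiset A) (hs : s.card = k) :
    ∃ f : Fin k → A, s = Finset.univ.val.map f := by
  obtain ⟨l, rfl⟩ : ∃ l : List A, (l : Multiset A) = s := ⟨s.toList, s.coe_toList⟩
  rw [Multiset.coe_card] at hs
  subst hs
  exact ⟨l.get, by rw [Fin.univ_val_map, List.ofFn_get]⟩

theorem petersen_loopless : petersen.Loopless :=
  ⟨fun _ _ h => (petersen_isLink.1 h).1.ne rfl⟩

/-- The vertices of the Petersen graph. -/
noncomputable def petersenEquiv : Fin 10 ≃ V(petersen) :=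
  (Equiv.ofBijective _ petersenLabel_bijective).trans (Equiv.Set.univ _).symm

theorem coe_petersenEquiv (x : Fin 10) : (petersenEquiv x : PetersenVertex) = petersenLabel x := rfl

theorem IsPerfectMatching.exists_pairing_petersen {M : Set (Sym2 PetersenVertex)}
    (h : IsPerfectMatching petersen M) : ∃ n : Fin 10 → Fin 10, IsPairing n ∧
      (∀ x, petersenWeight x (n x) = 1) ∧
      ∀ x y, s(petersenLabel x, petersenLabel y) ∈ M ↔ n x = y := by
  obtain ⟨m, hm, hmM⟩ := h.exists_isPairing petersen_loopless
  have key : ∀ x y, petersenEquiv.symm (m (petersenEquiv x)) = y ↔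
      petersenWeight x y = 1 ∧ s(petersenLabel x, petersenLabel y) ∈ M := by
    intro x y
    rw [Equiv.symm_apply_eq, hmM]
    simp only [petersen_isLink, coe_petersenEquiv, petersenLabel_adj]
    exact ⟨fun ⟨e, he, h1, h2⟩ => ⟨h1, h2 ▸ he⟩, fun ⟨h1, h2⟩ => ⟨_, h2, h1, rfl⟩⟩
  refine ⟨fun x => petersenEquiv.symm (m (petersenEquiv x)), ?_, fun x => ((key x _).1 rfl).1,
    fun x y => ?_⟩
  · simpa using hm.conj petersenEquiv.symm
  · rw [key, iff_and_self]
    intro hxy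
    obtain ⟨a, b, hab⟩ := petersen.exists_isLink_of_mem_edgeSet (h.1.1 hxy)
    have h1 := petersen_isLink.1 hab
    rw [← petersenLabel_adj]
    rcases Sym2.eq_iff.1 h1.2 with ⟨rfl, rfl⟩ | ⟨rfl, rfl⟩
    exacts [h1.1, h1.1.symm]

theorem exists_isPerfectMatching_petersen {n : Fin 10 → Fin 10} (hn : IsPairing n)
    (hs : ∀ x, petersenWeight x (n x) = 1) : ∃ M, IsPerfectMatching petersen M ∧
      ∀ x y, s(petersenLabel x, petersenLabel y) ∈ M ↔ n x = y := by
  have hlink : ∀ x, petersen.IsLink s(petersenLabel x, petersenLabel (n x)) (petersenLabel x)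
      (petersenLabel (n x)) := fun x =>
    petersen_isLink.2 ⟨(petersenLabel_adj _ _).2 (hs x), rfl⟩
  have hinj := petersenLabel_bijective.1
  refine ⟨{e | ∃ x, e = s(petersenLabel x, petersenLabel (n x))}, ⟨⟨?_, ?_⟩, ?_⟩, fun x y => ?_⟩
  · rintro _ ⟨x, rfl⟩
    exact (hlink x).edge_mem
  · rintro _ ⟨x, rfl⟩ _ ⟨y, rfl⟩ ⟨hne, z, hz, hz'⟩
    have h1 := hz.eq_or_eq_of_isLink (hlink x)
    have h2 := hz'.eq_or_eq_of_isLink (hlink y)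
    have hninj : n x = n y → x = y := fun h => by rw [← hn.invol x, h, hn.invol]
    apply hne
    rcases h1 with rfl | rfl <;> rcases h2 with h2 | h2 <;> have h2 := hinj h2
    · rw [h2]
    · rw [h2, hn.invol, Sym2.eq_swap]
    · rw [← h2, hn.invol, Sym2.eq_swap]
    · rw [hninj h2]
  · intro x _
    obtain ⟨x, rfl⟩ := petersenLabel_bijective.2 x
    exact ⟨_, ⟨x, rfl⟩, (hlink x).inc_left⟩
  · simp only [Set.mem_ofPred_eq, Sym2.eq_iff, hinj.eq_iff]
    constructor
    · rintro ⟨z, ⟨rfl, rfl⟩ | ⟨rfl, rfl⟩⟩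
      exacts [rfl, hn.invol _]
    · rintro rfl
      exact ⟨x, Or.inl ⟨rfl, rfl⟩⟩

end PetersenGraphs

/-! ### Minimal graphs and the main theorem -/

section Characterization

variable {α β : Type*} {G : Graph α β}

/-- `G` is isomorphic to the Petersen graph with `k` added copies of perfect matchings. -/
def IsPetersenWithCopies (k : ℕ) (G : Graph α β) : Prop :=
  ∃ 𝓜 : Multiset (Set (Sym2 PetersenVertex)), 𝓜.card = k ∧
    (∀ M ∈ 𝓜, IsPerfectMatching petersen M) ∧ Isomorphic G (addCopies petersen 𝓜)

theorem finite_edgeSet_addCopies (𝓜 : Multiset (Set (Sym2 PetersenVertex))) :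
    E(addCopies petersen 𝓜).Finite := by
  classical
  refine (Set.finite_univ.prod (Set.finite_Iic 𝓜.card)).subset ?_
  intro e he
  obtain ⟨x, y, -, h⟩ := (addCopies petersen 𝓜).exists_isLink_of_mem_edgeSet he
  exact ⟨trivial, h.trans (Multiset.countP_le_card _ _)⟩

theorem Isomorphic.loopless {α' β' : Type*} {H : Graph α' β'} (h : Isomorphic G H)
    (hH : H.Loopless) : G.Loopless := by
  obtain ⟨θ, φ, h⟩ := h
  exact ⟨fun e x hx => ((h ⟨e, hx.edge_mem⟩ ⟨x, hx.vertex_mem⟩ ⟨x, hx.vertex_mem⟩).1 hx).ne rfl⟩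

theorem Isomorphic.finite_edgeSet {α' β' : Type*} {H : Graph α' β'} (h : Isomorphic G H)
    (hH : E(H).Finite) : E(G).Finite := by
  obtain ⟨-, φ, -⟩ := h
  have := hH.to_subtype
  exact Set.finite_coe_iff.1 (Finite.of_equiv _ φ.symm)

theorem IsPetersenWithCopies.exists_multiplicity_eq {k : ℕ} (h : IsPetersenWithCopies k G) :
    E(G).Finite ∧ G.Loopless ∧ ∃ (e : Fin 10 ≃ V(G)) (n : Fin k → Fin 10 → Fin 10),
      (∀ i, IsPairing (n i)) ∧ (∀ i x, petersenWeight x (n i x) = 1) ∧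
      ∀ x y, multiplicity G (e x) (e y) =
        petersenWeight x y + ∑ i, pairingWeight (n i) x y := by
  obtain ⟨𝓜, hk, hM, hiso⟩ := h
  refine ⟨hiso.finite_edgeSet (finite_edgeSet_addCopies 𝓜),
    hiso.loopless ⟨fun _ _ h => petersen_loopless.not_isLoopAt _ _ h.1⟩, ?_⟩
  obtain ⟨f, rfl⟩ := exists_eq_map_univ 𝓜 hk
  choose n hn hs hf using fun i => (hM (f i) (by simp)).exists_pairing_petersen
  obtain ⟨θ, hθ⟩ := hiso.exists_multiplicity_eq
  refine ⟨(copiesLabel _).trans θ.symm, n, hn, hs, fun x y => ?_⟩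
  rw [hθ, ← multiplicity_addCopies_eq_sum hs hf]
  simp

theorem isPetersenWithCopies_of_multiplicity_eq {k : ℕ} (hE : E(G).Finite) (e : Fin 10 ≃ V(G))
    {n : Fin k → Fin 10 → Fin 10} (hn : ∀ i, IsPairing (n i))
    (hs : ∀ i x, petersenWeight x (n i x) = 1)
    (h : ∀ x y, multiplicity G (e x) (e y) = petersenWeight x y + ∑ i, pairingWeight (n i) x y) :
    IsPetersenWithCopies k G := by
  choose f hfM hf using fun i => exists_isPerfectMatching_petersen (hn i) (hs i)
  refine ⟨Finset.univ.val.map f, by simp, ?_, ?_⟩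
  · intro M hM
    obtain ⟨i, -, rfl⟩ := Multiset.mem_map.1 hM
    exact hfM i
  · refine isomorphic_of_multiplicity_eq hE (finite_edgeSet_addCopies _)
      (e.symm.trans (copiesLabel _)) fun x y => ?_
    have := h (e.symm x) (e.symm y)
    rw [← multiplicity_addCopies_eq_sum hs hf] at this
    simpa using this

theorem IsRGraph.isPetersenWithCopies {r : ℕ} (h : IsRGraph r G) (hr : 0 < r) (h2 : IsClassTwo G)
    (h10 : V(G).ncard = 10) : IsPetersenWithCopies (r - 3) G := by
  classical
  have := h.finite_vertexSet.fintype
  rw [← Nat.card_coe_set_eq, Nat.card_eq_fintype_card] at h10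
  have e := (Fintype.equivFinOfCardEq h10).symm
  rcases (h.isRWeight.comp e).decomposes_or_isPetersenSum with hd | ⟨k, e', n, rfl, hn, hs, hw⟩
  · refine absurd ((h.isClassOne_iff_decomposes hr).2 ?_) h2
    simpa using hd.comp e.symm
  · exact isPetersenWithCopies_of_multiplicity_eq h.finite_edgeSet (e'.trans e) hn hs hw

/-- The spokes and the `k` added matchings give `k + 1` disjoint perfect matchings. With `k + 2` of
them the remainder would complete a decomposition, which parity forbids. -/
theorem IsPetersenWithCopies.spec {k : ℕ} (h : IsPetersenWithCopies k G) :
    IsRGraph (k + 3) G ∧ IsClassTwo G ∧ MaxDisjointPerfectMatchings G (k + 1) ∧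
      V(G).ncard = 10 := by
  classical
  obtain ⟨hE, hG, e, n, hn, hs, hw⟩ := h.exists_multiplicity_eq
  have : Fintype V(G) := Fintype.ofEquiv _ e
  have : Nonempty V(G) := ⟨e 0⟩
  have hwc : multiplicity G = fun x y => petersenWeight (e.symm x) (e.symm y) +
      ∑ i, pairingWeight (n i) (e.symm x) (e.symm y) := by
    funext x y
    simpa using hw (e.symm x) (e.symm y)
  have hR : IsRGraph (k + 3) G := by
    refine IsRWeight.isRGraph hE hG ?_
    rw [hwc]
    exact (isRWeight_petersenWeight_add hn).comp e.symm
  have hnd : ¬ Decomposes (k + 3) (multiplicity G) := by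
    intro hd
    refine not_decomposes_petersenWeight_add hn hs ?_
    convert hd.comp e using 3 with x y
    exact (hw x y).symm
  refine ⟨hR, fun hc => hnd ((hR.isClassOne_iff_decomposes (by omega)).1 hc), ⟨?_, ?_⟩, ?_⟩
  · refine Packs.hasDisjointPerfectMatchings hE ?_
    rw [hwc]
    refine Packs.comp (w := fun x y => petersenWeight x y + ∑ i, pairingWeight (n i) x y)
      ⟨Fin.cons petersenSpoke n, fun i => ?_, fun x y => ?_⟩ e.symm
    · refine Fin.cases ?_ (fun i => ?_) i
      exacts [isPairing_petersenSpoke, hn i]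
    · rw [Fin.sum_univ_succ]
      simp only [Fin.cons_zero, Fin.cons_succ, petersenWeight]
      omega
  · intro t ht
    by_contra hlt
    exact hnd (hR.isRWeight.toIsRegularWeight.decomposes_of_packs
      ((ht.packs hE hG).mono (s := k + 2) (by omega)))
  · rw [← Nat.card_coe_set_eq, ← Nat.card_congr e, Nat.card_fin]

theorem MaxDisjointPerfectMatchings.isClassTwo {r : ℕ} (hr : 3 ≤ r) (h : IsRGraph r G)
    (hk : MaxDisjointPerfectMatchings G (r - 2)) : IsClassTwo G := fun hc => by
  have := hk.2 ((h.isClassOne_iff (by omega)).1 hc)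
  omega

/-- The same graph with its vertices and edges lifted to other universes. -/
def liftGraph {α β : Type*} (G : Graph α β) : Graph (ULift.{u} α) (ULift.{v} β) where
  vertexSet := {x | x.down ∈ V(G)}
  IsLink e x y := G.IsLink e.down x.down y.down
  isLink_symm _ _ := ⟨fun _ _ h => h.symm⟩
  eq_or_eq_of_isLink_of_isLink _ _ _ _ _ h h' :=
    (h.left_eq_or_eq h').imp (ULift.ext _ _) (ULift.ext _ _)
  left_mem_of_isLink _ _ _ h := h.left_mem

theorem isomorphic_liftGraph {α β : Type*} (G : Graph α β) :
    Isomorphic (liftGraph.{u, v} G) G := by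
  refine ⟨⟨fun x => ⟨x.1.down, x.2⟩, fun x => ⟨⟨x⟩, x.2⟩, fun _ => rfl, fun _ => rfl⟩,
    ⟨fun e => ⟨e.1.down, ?_⟩, fun e => ⟨⟨e⟩, ?_⟩, fun _ => rfl, fun _ => rfl⟩, fun _ _ _ => Iff.rfl⟩
  · obtain ⟨x, y, h⟩ := (liftGraph G).exists_isLink_of_mem_edgeSet e.2
    exact Graph.IsLink.edge_mem (G := G) h
  · obtain ⟨x, y, h⟩ := G.exists_isLink_of_mem_edgeSet e.2
    exact (show (liftGraph.{u, v} G).IsLink ⟨e⟩ ⟨x⟩ ⟨y⟩ from h).edge_mem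

/-- Minimality is tested against graphs in universes `u` and `v`, so a competitor of order ten is
needed there. -/
theorem exists_isPetersenWithCopies (k : ℕ) :
    ∃ (α : Type u) (β : Type v) (G : Graph α β), IsPetersenWithCopies k G := by
  obtain ⟨M, hM, -⟩ := exists_isPerfectMatching_petersen isPairing_petersenSpoke (by decide)
  exact ⟨_, _, liftGraph (addCopies petersen (Multiset.replicate k M)), Multiset.replicate k M,
    by simp, fun N hN => Multiset.eq_of_mem_replicate hN ▸ hM, isomorphic_liftGraph _⟩

theorem smallestClassTwo_eq {r : ℕ} (hr : 3 ≤ r) (α : Type u) (β : Type v) :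
    (smallestClassTwo r : Set (Graph α β)) = {G | IsPetersenWithCopies (r - 3) G} := by
  obtain ⟨k, rfl⟩ : ∃ k, r = k + 3 := ⟨r - 3, by omega⟩
  ext G
  constructor
  · rintro ⟨⟨h, h2⟩, hmin⟩
    obtain ⟨α', β', H, hH⟩ := exists_isPetersenWithCopies.{u, v} k
    have hH' := hH.spec
    have h1 := hmin α' β' H ⟨hH'.1, hH'.2.1⟩
    rw [hH'.2.2.2] at h1
    -- The competitor bounds the order by ten from above, and `IsRGraph.ten_le_of_isClassTwo` from
    -- below.
    exact h.isPetersenWithCopies (by omega) h2 (h1.antisymm (h.ten_le_of_isClassTwo (by omega) h2))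
  · intro h
    have h' := IsPetersenWithCopies.spec h
    refine ⟨⟨h'.1, h'.2.1⟩, fun α' β' H hH => ?_⟩
    rw [h'.2.2.2]
    exact hH.1.ten_le_of_isClassTwo (by omega) hH.2

theorem smallestWithPi_eq {r : ℕ} (hr : 3 ≤ r) (α : Type u) (β : Type v) :
    (smallestWithPi r (r - 2) : Set (Graph α β)) = {G | IsPetersenWithCopies (r - 3) G} := by
  obtain ⟨k, rfl⟩ : ∃ k, r = k + 3 := ⟨r - 3, by omega⟩
  ext G
  constructor
  · rintro ⟨⟨h, hpi⟩, hmin⟩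
    have h2 := hpi.isClassTwo hr h
    obtain ⟨α', β', H, hH⟩ := exists_isPetersenWithCopies.{u, v} k
    have hH' := hH.spec
    have h1 := hmin α' β' H ⟨hH'.1, hH'.2.2.1⟩
    rw [hH'.2.2.2] at h1
    exact h.isPetersenWithCopies (by omega) h2 (h1.antisymm (h.ten_le_of_isClassTwo (by omega) h2))
  · intro h
    have h' := IsPetersenWithCopies.spec h
    refine ⟨⟨h'.1, h'.2.2.1⟩, fun α' β' H hH => ?_⟩
    rw [h'.2.2.2]
    exact hH.1.ten_le_of_isClassTwo (by omega) (hH.2.isClassTwo hr hH.1)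

end Characterization

end RGraphs

theorem mainTheorem3 (r : ℕ) (hr : 3 ≤ r) (α : Type u) (β : Type v) :
    (RGraphs.smallestClassTwo r : Set (Graph α β)) = RGraphs.smallestWithPi r (r - 2) ∧
    (RGraphs.smallestClassTwo r : Set (Graph α β)) =
      {G | ∃ 𝓜 : Multiset (Set (Sym2 RGraphs.PetersenVertex)),
        𝓜.card = r - 3 ∧ (∀ M ∈ 𝓜, RGraphs.IsPerfectMatching RGraphs.petersen M) ∧
        RGraphs.Isomorphic G (RGraphs.addCopies RGraphs.petersen 𝓜)} ∧
    ∀ G ∈ (RGraphs.smallestClassTwo r : Set (Graph α β)),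
      V(G).ncard = 10 ∧ RGraphs.MaxDisjointPerfectMatchings G (r - 2) := by
  have h := RGraphs.smallestClassTwo_eq hr α β
  refine ⟨h.trans (RGraphs.smallestWithPi_eq hr α β).symm, h, fun G hG => ?_⟩
  rw [h] at hG
  have h' := RGraphs.IsPetersenWithCopies.spec hG
  rw [show r - 3 + 1 = r - 2 by omega] at h'
  exact ⟨h'.2.2.2, h'.2.2.1⟩
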